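/- **Setting.** Let $a_0>0$, $b_0>0$, $0<c_0<1$. Let $g:\mathbb{R}^2\to\mathbb{R}$ satisfy $$\frac{x'-x}{a_0}\le g(x',y)-g(x,y)\le a_0(x'-x)\quad (x<x',\ y\in\mathbb{R}),\qquad |g(x,y)-g(x,y')|\le b_0|y'-y|\quad (x,y,y'\in\mathbb{R}),$$ and let $u:\mathbb{R}\to\mathbb{R}$ be measurable with $|u|\le c_0/b_0$ everywhere. For $x\in\mathbb{R}$ let $\Gamma_x=\{(g(x,y),y):y\in\mathbb{R}\}$; exactly one of these curves passes through each point of the plane. Let $\theta_x=\arctan u(x)$ and rotate the coordinate axes by $\theta_x$, so that the new horizontal axis is parallel to $(1,u(x))$; the new second coordinate of a point $(s,t)$ is $y'=-s\sin\theta_x+t\cos\theta_x$. This coordinate maps $\Gamma_x$ bijectively onto $\mathbb{R}$. Let $\gamma_x(z)$ be the point of $\Gamma_x$ with $y'=z$. Let $\psi_0:\mathbb{R}\to\mathbb{C}$ be a Schwartz function supported in $[\frac12,\frac52]\cup[-\frac52,-\frac12]$ with $\sum_{k\in\mathbb{Z}}\psi_0(2^{-k}t)=1$ for all $t\ne0$.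 Let $\psi_k(t)=\psi_0(2^{-k}t)$ and $\check\psi_k(s)=\int_{\mathbb{R}}\psi_k(t)e^{2\pi i st}\,dt$. For $f:\mathbb{R}^2\to\mathbb{C}$ the adapted Littlewood–Paley projection $\tilde P_kf$ is defined at the point $\gamma_x(y')$ of $\Gamma_x$ by $$\tilde P_kf(\gamma_x(y'))=\int_{\mathbb{R}}f(\gamma_x(z))\,\check\psi_k(y'-z)\,dz .$$ For $1<p<\infty$ and $f\in L^p(\mathbb{R}^2)$, $\tilde P_k^*f$ denotes the function $h\in L^p(\mathbb{R}^2)$ with $\int_{\mathbb{R}^2}\overline{\varphi}\,h=\int_{\mathbb{R}^2}\overline{\tilde P_k\varphi}\,f$ for all $\varphi\in L^{p'}(\mathbb{R}^2)$, where $\frac1p+\frac1{p'}=1$ and the measure is Lebesgue measure. **Lemma (adapted Littlewood–Paley estimates).** Let $1<p<\infty$. There is a finite constant $C$, depending only on $a_0$ (and on the fixed data $c_0$, $p$, $\psi_0$), but not on $b_0$, $g$, $u$ or $f$, such that for every $f\in L^p(\mathbb{R}^2)$: 1. for every $k$, the integral defining $\tilde P_kf$ converges absolutely at almost every point of the plane,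 $\tilde P_kf\in L^p(\mathbb{R}^2)$, and $\tilde P_k^*f$ exists; 2. $$C^{-1}\|f\|_p\le\Big\|\Big(\sum_{k\in\mathbb{Z}}|\tilde P_kf|^2\Big)^{1/2}\Big\|_p\le C\|f\|_p ;$$ 3. $$C^{-1}\|f\|_p\le\Big\|\Big(\sum_{k\in\mathbb{Z}}|\tilde P_k^*f|^2\Big)^{1/2}\Big\|_p\le C\|f\|_p .$$ In particular, under the normalisation $b_0=10^{-2}$, $|u|\le10^{-1}$ (so that $c_0=10^{-3}$ is admissible), $C$ depends only on $a_0$, once $p$ and $\psi_0$ are fixed. -/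

import Mathlib

open MeasureTheory Set
open scoped ENNReal NNReal FourierTransform SchwartzMap ComplexConjugate

noncomputable section

namespace AdaptedLP

/-- A function `ψ` is a Littlewood-Paley cut-off: it is Schwartz, supported in
`[1/2, 5/2] ∪ [-5/2, -1/2]`, and its dyadic dilates sum to one away from the origin. -/
def IsCutoff (ψ : 𝓢(ℝ, ℂ)) : Prop :=
  Function.support ψ ⊆ Icc (1 / 2) (5 / 2) ∪ Icc (-(5 / 2)) (-(1 / 2)) ∧
    ∀ t : ℝ, t ≠ 0 → HasSum (fun k : ℤ => ψ ((2 : ℝ) ^ (-k) * t)) 1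

/-- The convolution kernel `ψ̌_k`, the inverse Fourier transform of `ψ_k(t) = ψ(2^{-k} t)`. -/
def kernel (ψ : 𝓢(ℝ, ℂ)) (k : ℤ) : ℝ → ℂ :=
  𝓕⁻ (fun t : ℝ => ψ ((2 : ℝ) ^ (-k) * t))

/-- The one dimensional Littlewood-Paley projection `P_k h = h * ψ̌_k`. -/
def proj (ψ : 𝓢(ℝ, ℂ)) (k : ℤ) (h : ℝ → ℂ) (y : ℝ) : ℂ :=
  ∫ z, h z * kernel ψ k (y - z)

/-- The horizontal distortion condition
`(x' - x) / a₀ ≤ g(x', y) - g(x, y) ≤ a₀ (x' - x)` for `x < x'`. -/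
def HorizontalBound (g : ℝ → ℝ → ℝ) (a₀ : ℝ) : Prop :=
  ∀ x x' y : ℝ, x < x' →
    (x' - x) / a₀ ≤ g x' y - g x y ∧ g x' y - g x y ≤ a₀ * (x' - x)

/-- The curves `y ↦ g(x, y)` are Lipschitz with constant `b₀`. -/
def VerticalBound (g : ℝ → ℝ → ℝ) (b₀ : ℝ) : Prop :=
  ∀ x y y' : ℝ, |g x y - g x y'| ≤ b₀ * |y' - y|

/-- The point at height `y` of the curve `Γ_x = {(g(x, y), y) : y ∈ ℝ}`. -/
def curve (g : ℝ → ℝ → ℝ) (x y : ℝ) : ℝ × ℝ := (g x y, y)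

/-- `foot g (x, y) = P(x, y)`: the parameter of the curve through `(x, y)`, so that
`(x, y) ↦ (P(x, y), y)` inverts `(x, y) ↦ (g(x, y), y)`. -/
def foot (g : ℝ → ℝ → ℝ) (q : ℝ × ℝ) : ℝ :=
  Function.invFun (fun x : ℝ => g x q.2) q.1

/-- The coordinates `(x', y')` of a point after the axes are rotated by the angle `arctan s`, so
that the `x'`-axis is parallel to `(1, s)`. -/
def rotated (s : ℝ) (q : ℝ × ℝ) : ℝ × ℝ :=
  (q.1 * Real.cos (Real.arctan s) + q.2 * Real.sin (Real.arctan s),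
    -q.1 * Real.sin (Real.arctan s) + q.2 * Real.cos (Real.arctan s))

/-- The point of the curve `Γ_x` whose rotated second coordinate (with respect to the direction
`(1, u(x))`) equals `z`; in the rotated coordinates this is the point `(g_x(z), z)`. -/
def graphPoint (g : ℝ → ℝ → ℝ) (u : ℝ → ℝ) (x z : ℝ) : ℝ × ℝ :=
  curve g x (Function.invFun (fun y : ℝ => (rotated (u x) (curve g x y)).2) z)

/-- The restriction `z ↦ f(g_x(z), z)` of `f` to `Γ_x`, read in the rotated coordinates. -/
def restrict (g : ℝ → ℝ → ℝ) (u : ℝ → ℝ) (f : ℝ × ℝ → ℂ) (x z : ℝ) : ℂ :=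
  f (graphPoint g u x z)

/-- The adapted Littlewood-Paley projection `P̃_k f`: at a point `q` of `Γ_x` with rotated second
coordinate `y'` its value is `P_k` of the restriction of `f` to `Γ_x`, taken at `y'`. -/
def adaptedProj (ψ : 𝓢(ℝ, ℂ)) (g : ℝ → ℝ → ℝ) (u : ℝ → ℝ) (k : ℤ) (f : ℝ × ℝ → ℂ)
    (q : ℝ × ℝ) : ℂ :=
  proj ψ k (restrict g u f (foot g q)) (rotated (u (foot g q)) q).2

/-- `h` is the value at `f ∈ L^p` of the adjoint `T^*` of an operator `T` on `L^{p'}`, for the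
pairing given by Lebesgue measure: `⟨φ, h⟩ = ⟨T φ, f⟩` for all `φ ∈ L^{p'}`. -/
def IsAdjointValue (T : (ℝ × ℝ → ℂ) → ℝ × ℝ → ℂ) (p : ℝ≥0∞) (f h : ℝ × ℝ → ℂ) : Prop :=
  MemLp h p volume ∧
    ∀ φ : ℝ × ℝ → ℂ, MemLp φ (ENNReal.conjExponent p) volume →
      ∫ q, conj (φ q) * h q = ∫ q, conj (T φ q) * f q

/-- The square function `(∑_k |F_k|²)^{1/2}`, with values in `[0, ∞]`. -/
def squareFunction (F : ℤ → ℝ × ℝ → ℂ) (q : ℝ × ℝ) : ℝ≥0∞ :=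
  (∑' k : ℤ, ‖F k q‖ₑ ^ 2) ^ (1 / 2 : ℝ)

/-- A real function whose difference quotients lie between positive bounds is a bijection; with the
two facts below this shows that the inverses in `foot` and `graphPoint` are genuine. -/
theorem bijective_of_slope {F : ℝ → ℝ} {m M : ℝ} (hm : 0 < m)
    (h : ∀ s t, s < t → m * (t - s) ≤ F t - F s ∧ F t - F s ≤ M * (t - s)) :
    Function.Bijective F := by
  have hmono : StrictMono F := fun s t hst => by
    have := (h s t hst).1
    have := mul_pos hm (sub_pos.2 hst)
    linarith
  have hcont : Continuous F := by
    refine (LipschitzWith.of_le_add_mul' M fun x y => ?_).continuous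
    have hM : 0 ≤ M := by
      have := h 0 1 one_pos
      linarith [this.1, this.2]
    rcases lt_trichotomy x y with hxy | rfl | hxy
    · have := hmono hxy
      have := mul_nonneg hM (dist_nonneg (x := x) (y := y))
      linarith
    · simp
    · have := (h y x hxy).2
      rw [Real.dist_eq, abs_of_pos (sub_pos.2 hxy)]
      linarith
  refine ⟨hmono.injective, hcont.surjective ?_ ?_⟩
  · refine Filter.tendsto_atTop_mono' _ (f₁ := fun t => m * t + F 0) ?_ ?_
    · filter_upwards [Filter.eventually_gt_atTop 0] with t ht
      have := (h 0 t ht).1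
      linarith
    · exact Filter.tendsto_atTop_add_const_right _ _ (Filter.tendsto_id.const_mul_atTop hm)
  · refine Filter.tendsto_atBot_mono' _ (f₁ := fun t => m * t + F 0) ?_ ?_
    · filter_upwards [Filter.eventually_lt_atBot 0] with t ht
      have := (h t 0 ht).1
      linarith
    · exact Filter.tendsto_atBot_add_const_right _ _ (Filter.tendsto_id.const_mul_atBot hm)

theorem bijective_foot {g : ℝ → ℝ → ℝ} {a₀ : ℝ} (ha : 0 < a₀) (hg : HorizontalBound g a₀)
    (y : ℝ) : Function.Bijective (fun x => g x y) :=
  bijective_of_slope (m := 1 / a₀) (M := a₀) (by positivity) fun s t hst => by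
    have := hg s t y hst
    exact ⟨by rw [one_div_mul_eq_div]; exact this.1, this.2⟩

theorem bijective_height {g : ℝ → ℝ → ℝ} {b₀ c₀ s : ℝ} (hb : 0 < b₀) (hc : c₀ < 1)
    (hg : VerticalBound g b₀) (hs : |s| ≤ c₀ / b₀) (x : ℝ) :
    Function.Bijective (fun y => (rotated s (curve g x y)).2) := by
  have hcos := Real.cos_arctan_pos s
  have hsin : Real.sin (Real.arctan s) = s * Real.cos (Real.arctan s) := by
    rw [Real.sin_arctan, Real.cos_arctan]; ring
  refine bijective_of_slope (m := Real.cos (Real.arctan s) * (1 - c₀))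
    (M := Real.cos (Real.arctan s) * (1 + c₀)) (mul_pos hcos (by linarith)) fun y y' hy => ?_
  have h1 : |s * (g x y' - g x y)| ≤ c₀ * (y' - y) := by
    rw [abs_mul]
    have h2 := hg x y' y
    rw [abs_sub_comm y y', abs_of_pos (sub_pos.2 hy)] at h2
    calc |s| * |g x y' - g x y| ≤ c₀ / b₀ * (b₀ * (y' - y)) :=
          mul_le_mul hs h2 (abs_nonneg _) ((abs_nonneg _).trans hs)
      _ = c₀ * (y' - y) := by field_simp
  have h3 := abs_le.1 h1
  have e : (rotated s (curve g x y')).2 - (rotated s (curve g x y)).2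
      = Real.cos (Real.arctan s) * ((y' - y) - s * (g x y' - g x y)) := by
    simp only [rotated, curve, hsin]; ring
  simp only [e, mul_assoc]
  constructor <;> refine mul_le_mul_of_nonneg_left ?_ hcos.le <;> linarith [h3.1, h3.2]

end AdaptedLP

end

/-! The map taking a point of the plane to the parameter `x` of its curve and its rotated second
coordinate `y'` turns `P̃_k` into the ordinary projection `P_k` in the second variable. Fubini
therefore reduces the theorem to the Littlewood-Paley inequalities on the line, once this map is
known to distort measure by a bounded factor (`exists_adapted_chart`). The map is the inverse of
`curveMap`, bi-Lipschitz in `x` with constants from `a₀`, followed by `heightMap`, whose slope in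
`y` lies between `cos θ_x (1 - c₀)` and `cos θ_x (1 + c₀)` because `b₀ |u| ≤ c₀`. When `b₀` is small
`cos θ_x` may be arbitrarily small, so it is absorbed into the measure `dx / cos θ_x` on the
parameter line. The fibrewise estimates hold with one constant for every s-finite measure there
(`IsCutoff.exists_fiber_bounds`), which is why `b₀` does not enter.

For the adjoints, let `j` be the density of Lebesgue measure in the new coordinates. Then `P̃_k^* f
= j⁻¹ P_k^* (j f)`, where `P_k^*` is the projection of the conjugate cut-off. The factors `j` and
`j⁻¹` are bounded and do not depend on `k`, so the same fibrewise estimates apply.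

On the line, a finite family of projections is one convolution with a Hilbert space valued kernel.
Plancherel gives its `L²` bound, and dyadic scaling with a geometric series gives Hörmander's
condition, both uniformly in the family. The Calderón-Zygmund decomposition then yields `1 < p < 2`,
and duality yields `p > 2` (`exists_lpBound`). Allowing operator valued kernels brings the adjoint
`v ↦ ∑ P_k v_k` under the same theorem. The lower inequality follows from this dual bound and the
identity `P_k = ∑_{|m| ≤ 2} P_{k+m} P_k`. Passages to infinite families and to general `f` use
Fatou's lemma and density of Schwartz functions. -/

noncomputable section

namespace AdaptedLP

/-! ### Dyadic intervals and the Calderón-Zygmund stopping time. -/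

/-- The index of the dyadic interval of length `2^{-n}` that contains `x`. -/
def dyadicIdx (n : ℤ) (x : ℝ) : ℤ := ⌊(2 : ℝ) ^ n * x⌋

/-- The dyadic interval of length `2^{-n}` that contains `x`. -/
def dyadicCell (n : ℤ) (x : ℝ) : Set ℝ := {y | dyadicIdx n y = dyadicIdx n x}

theorem dyadicCell_eq_Ico (n : ℤ) (x : ℝ) :
    dyadicCell n x = Ico ((2 : ℝ) ^ (-n) * dyadicIdx n x)
      ((2 : ℝ) ^ (-n) * dyadicIdx n x + (2 : ℝ) ^ (-n)) := by
  ext y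
  have h2 : (0 : ℝ) < (2 : ℝ) ^ n := by positivity
  have e : (2 : ℝ) ^ (-n) * dyadicIdx n x + (2 : ℝ) ^ (-n)
      = (2 : ℝ) ^ (-n) * (dyadicIdx n x + 1) := by ring
  rw [dyadicCell, mem_ofPred_eq, mem_Ico, e, zpow_neg, inv_mul_le_iff₀ h2, lt_inv_mul_iff₀ h2,
    show dyadicIdx n y = ⌊(2 : ℝ) ^ n * y⌋ from rfl, Int.floor_eq_iff]

theorem measurableSet_dyadicCell (n : ℤ) (x : ℝ) : MeasurableSet (dyadicCell n x) := by
  rw [dyadicCell_eq_Ico]; exact measurableSet_Ico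

theorem volume_dyadicCell (n : ℤ) (x : ℝ) :
    volume (dyadicCell n x) = ENNReal.ofReal ((2 : ℝ) ^ (-n)) := by
  rw [dyadicCell_eq_Ico, Real.volume_Ico]; congr 1; ring

theorem mem_dyadicCell_self (n : ℤ) (x : ℝ) : x ∈ dyadicCell n x := rfl

/-- Nestedness of dyadic intervals: the coarser index is the integer quotient of the finer one by a
power of two. -/
theorem dyadicIdx_eq_of_le {n n' : ℤ} (h : n' ≤ n) {x y : ℝ}
    (hxy : dyadicIdx n x = dyadicIdx n y) : dyadicIdx n' x = dyadicIdx n' y := by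
  obtain ⟨k, rfl⟩ : ∃ k : ℕ, n = n' + k := ⟨(n - n').toNat, by omega⟩
  have key : ∀ z : ℝ, dyadicIdx n' z = dyadicIdx (n' + k) z / ((2 ^ k : ℕ) : ℤ) := fun z => by
    have e : (2 : ℝ) ^ n' * z = (2 : ℝ) ^ (n' + k) * z / ((2 ^ k : ℕ) : ℝ) := by
      rw [zpow_add₀ two_ne_zero]; push_cast; field_simp; simp
    rw [dyadicIdx, dyadicIdx, e, Int.floor_div_natCast]
  rw [key, key, hxy]

theorem dyadicCell_congr {n n' : ℤ} (h : n' ≤ n) {x y : ℝ} (hy : y ∈ dyadicCell n x) :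
    dyadicCell n' y = dyadicCell n' x := by
  have : dyadicIdx n' y = dyadicIdx n' x := dyadicIdx_eq_of_le h hy
  simp [dyadicCell, this]

theorem dyadicCell_subset_closedBall (n : ℤ) (x : ℝ) :
    dyadicCell n x ⊆ Metric.closedBall ((2 : ℝ) ^ (-n) * dyadicIdx n x + (2 : ℝ) ^ (-n) / 2)
      ((2 : ℝ) ^ (-n) / 2) := by
  rw [dyadicCell_eq_Ico, Real.closedBall_eq_Icc]
  intro y hy
  constructor <;> linarith [hy.1, hy.2]

/-- The mean value of `φ` over the dyadic interval of length `2^{-n}` that contains `x`. -/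
def dyadicAvg (φ : ℝ → ℝ≥0∞) (n : ℤ) (x : ℝ) : ℝ≥0∞ :=
  (∫⁻ y in dyadicCell n x, φ y) / ENNReal.ofReal ((2 : ℝ) ^ (-n))

theorem dyadicAvg_congr (φ : ℝ → ℝ≥0∞) {n n' : ℤ} (h : n' ≤ n) {x y : ℝ}
    (hy : y ∈ dyadicCell n x) : dyadicAvg φ n' y = dyadicAvg φ n' x := by
  rw [dyadicAvg, dyadicAvg, dyadicCell_congr h hy]

/-- The parent interval is twice as long. On a stopping interval this bounds the mean by `2 l`,
since the parent was not selected. -/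
theorem dyadicAvg_succ_le (φ : ℝ → ℝ≥0∞) (n : ℤ) (x : ℝ) :
    dyadicAvg φ n x ≤ 2 * dyadicAvg φ (n - 1) x := by
  have hs : dyadicCell n x ⊆ dyadicCell (n - 1) x := fun y hy =>
    dyadicIdx_eq_of_le (by omega) hy
  have e : ENNReal.ofReal ((2 : ℝ) ^ (-(n - 1))) = 2 * ENNReal.ofReal ((2 : ℝ) ^ (-n)) := by
    rw [show (2 : ℝ≥0∞) = ENNReal.ofReal 2 by simp, ← ENNReal.ofReal_mul (by norm_num)]
    congr 1
    rw [show -(n - 1) = 1 + -n by ring, zpow_add₀ two_ne_zero]; simp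
  have h0 : ENNReal.ofReal ((2 : ℝ) ^ (-n)) ≠ 0 := by
    simp only [ne_eq, ENNReal.ofReal_eq_zero, not_le]; positivity
  rw [dyadicAvg, dyadicAvg, e, ← mul_div_assoc, ENNReal.mul_div_mul_left _ _ (by simp) (by simp)]
  exact ENNReal.div_le_div_right (lintegral_mono_set hs) _

theorem exists_forall_lt_of_lt_dyadicAvg {φ : ℝ → ℝ≥0∞} (hφ : ∫⁻ y, φ y ≠ ∞) {l : ℝ≥0∞}
    (hl : l ≠ 0) (hl' : l ≠ ∞) : ∃ N : ℤ, ∀ n x, l < dyadicAvg φ n x → N ≤ n := by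
  -- A mean above `l` forces `l 2^{-n} < ‖φ‖₁`, and `-n ≤ 2^{-n}` turns this into a lower bound for
  -- `n`.
  refine ⟨-⌈(∫⁻ y, φ y).toReal / l.toReal⌉, fun n x h => ?_⟩
  have hl0 : 0 < l.toReal := ENNReal.toReal_pos hl hl'
  have h0 : ENNReal.ofReal ((2 : ℝ) ^ (-n)) ≠ 0 := by
    simp only [ne_eq, ENNReal.ofReal_eq_zero, not_le]; positivity
  rw [dyadicAvg, ENNReal.lt_div_iff_mul_lt (Or.inl h0) (Or.inl ENNReal.ofReal_ne_top)] at h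
  have h1 := h.trans_le (setLIntegral_le_lintegral _ φ)
  have h2 := (ENNReal.toReal_lt_toReal (by finiteness) hφ).2 h1
  rw [ENNReal.toReal_mul, ENNReal.toReal_ofReal (by positivity)] at h2
  by_contra hn
  push Not at hn
  have h3 : (-n : ℝ) ≤ (2 : ℝ) ^ (-n) := by
    rcases le_total n 0 with h0 | h0
    · obtain ⟨k, rfl⟩ : ∃ k : ℕ, n = -k := ⟨n.natAbs, by omega⟩
      simp only [neg_neg, zpow_natCast, Int.cast_neg, Int.cast_natCast]
      exact_mod_cast Nat.lt_two_pow_self.le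
    · have : (0 : ℝ) ≤ n := by exact_mod_cast h0
      have h4 : (0 : ℝ) < (2 : ℝ) ^ (-n) := by positivity
      linarith
  have h4 : (∫⁻ y, φ y).toReal / l.toReal < -n := by
    have h5 : ⌈(∫⁻ y, φ y).toReal / l.toReal⌉ < -n := by omega
    have := Int.le_ceil ((∫⁻ y, φ y).toReal / l.toReal)
    have h6 : (⌈(∫⁻ y, φ y).toReal / l.toReal⌉ : ℝ) < -n := by exact_mod_cast h5
    linarith
  rw [div_lt_iff₀ hl0] at h4
  nlinarith

/-- Dyadic Lebesgue differentiation, in the weak form needed for the stopping time. -/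
theorem ae_le_of_forall_dyadicAvg_le {φ : ℝ → ℝ≥0∞} (hφm : Measurable φ) (hφ : ∫⁻ y, φ y ≠ ∞)
    (l : ℝ≥0∞) : ∀ᵐ x : ℝ, (∀ n, dyadicAvg φ n x ≤ l) → φ x ≤ l := by
  -- Differentiation along balls that contain `x` without being centred there suffices: a dyadic
  -- interval is such a closed ball, up to one endpoint.
  have := (IsUnifLocDoublingMeasure.vitaliFamily (volume : Measure ℝ) 1).ae_tendsto_lintegral_div
    hφm.aemeasurable hφ
  filter_upwards [this] with x hx hle
  have ht : Filter.Tendsto (fun n : ℕ => ((2 : ℝ) ^ (-(n : ℤ)) / 2)) Filter.atTop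
      (nhdsWithin 0 (Ioi 0)) := by
    refine tendsto_nhdsWithin_iff.2 ⟨?_, Filter.Eventually.of_forall fun n => ?_⟩
    · have := (tendsto_pow_atTop_nhds_zero_of_lt_one (r := (1 / 2 : ℝ)) (by norm_num)
        (by norm_num)).div_const 2
      simpa [zpow_neg] using this
    · simp only [mem_Ioi]; positivity
  have h1 := IsUnifLocDoublingMeasure.tendsto_closedBall_filterAt (volume : Measure ℝ) (K := 1)
    (x := x) (fun n : ℕ => (2 : ℝ) ^ (-(n : ℤ)) * dyadicIdx n x + (2 : ℝ) ^ (-(n : ℤ)) / 2) _ ht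
    (Filter.Eventually.of_forall fun n => by
      rw [one_mul]
      exact dyadicCell_subset_closedBall n x (mem_dyadicCell_self _ _))
  refine le_of_tendsto (hx.comp h1) (Filter.Eventually.of_forall fun n => ?_)
  refine le_trans (le_of_eq ?_) (hle n)
  simp only [Function.comp_apply]
  have hae : (Metric.closedBall ((2 : ℝ) ^ (-(n : ℤ)) * dyadicIdx n x + (2 : ℝ) ^ (-(n : ℤ)) / 2)
      ((2 : ℝ) ^ (-(n : ℤ)) / 2)) =ᵐ[volume] dyadicCell n x := by
    rw [dyadicCell_eq_Ico, Real.closedBall_eq_Icc]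
    rw [add_sub_cancel_right, add_assoc, add_halves]
    exact Ico_ae_eq_Icc.symm
  rw [dyadicAvg, setLIntegral_congr hae, measure_congr hae, volume_dyadicCell]

/-- The Calderón-Zygmund stopping intervals of height `l`, coded by an index map: the fibres of `κ`
over `some i` are the stopping intervals (or empty), and `φ ≤ l` off their union. -/
theorem exists_stopping_index {φ : ℝ → ℝ≥0∞} (hφm : Measurable φ) (hφ : ∫⁻ y, φ y ≠ ∞)
    {l : ℝ≥0∞} (hl : l ≠ 0) (hl' : l ≠ ∞) :
    ∃ κ : ℝ → Option (ℤ × ℤ),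
      (∀ i, ∃ c r : ℝ, 0 ≤ r ∧ κ ⁻¹' {some i} ⊆ Metric.closedBall c r ∧
        MeasurableSet (κ ⁻¹' {some i}) ∧
        volume (κ ⁻¹' {some i}) = ENNReal.ofReal (2 * r) ∧
        l * volume (κ ⁻¹' {some i}) ≤ ∫⁻ y in κ ⁻¹' {some i}, φ y ∧
        ∫⁻ y in κ ⁻¹' {some i}, φ y ≤ 2 * l * volume (κ ⁻¹' {some i})) ∧
      ∀ᵐ x : ℝ, κ x = none → φ x ≤ l := by
  obtain ⟨N, hN⟩ := exists_forall_lt_of_lt_dyadicAvg hφ hl hl'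
  have key : ∀ x : ℝ, ∃ o : Option (ℤ × ℤ), (o = none ∧ ∀ n, dyadicAvg φ n x ≤ l) ∨
      ∃ n, o = some (n, dyadicIdx n x) ∧ l < dyadicAvg φ n x ∧
        ∀ n' < n, dyadicAvg φ n' x ≤ l := fun x => by
    by_cases hx : ∃ n, l < dyadicAvg φ n x
    · obtain ⟨n, hn, hmin⟩ := Int.exists_least_of_bdd ⟨N, fun z hz => hN z x hz⟩ hx
      exact ⟨_, Or.inr ⟨n, rfl, hn, fun n' hn' => not_lt.1 fun h => absurd (hmin n' h) (by omega)⟩⟩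
    · push Not at hx
      exact ⟨none, Or.inl ⟨rfl, hx⟩⟩
  choose κ hκ using key
  refine ⟨κ, fun i => ?_, ?_⟩
  · by_cases hne : (κ ⁻¹' {some i}).Nonempty
    · obtain ⟨x, hx⟩ := hne
      simp only [mem_preimage, mem_singleton_iff] at hx
      obtain ⟨h1, -⟩ | ⟨n, hn, hsel, hmin⟩ := hκ x
      · rw [hx] at h1; cases h1
      have hi : i = (n, dyadicIdx n x) := by rw [hx] at hn; exact Option.some.inj hn
      -- All means at scales up to `n` are constant on the cell, so every point of it stops at the
      -- same `n` and the fibre is the whole cell.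
      have hset : κ ⁻¹' {some i} = dyadicCell n x := by
        ext y
        simp only [mem_preimage, mem_singleton_iff, hi]
        constructor
        · intro hy
          obtain ⟨h1, -⟩ | ⟨m, hm, -, -⟩ := hκ y
          · rw [hy] at h1; cases h1
          · rw [hy] at hm
            have := Option.some.inj hm
            simp only [Prod.mk.injEq] at this
            obtain ⟨rfl, h⟩ := this
            exact h.symm
        · intro hy
          have hl1 : l < dyadicAvg φ n y := by rwa [dyadicAvg_congr φ le_rfl hy]
          have hl2 : ∀ n' < n, dyadicAvg φ n' y ≤ l := fun n' hn' => by
            rw [dyadicAvg_congr φ hn'.le hy]; exact hmin n' hn'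
          obtain ⟨-, h1⟩ | ⟨m, hm, hm1, hm2⟩ := hκ y
          · exact absurd hl1 (not_lt.2 (h1 n))
          · have : m = n := by
              rcases lt_trichotomy m n with h | h | h
              · exact absurd hm1 (not_lt.2 (hl2 m h))
              · exact h
              · exact absurd hl1 (not_lt.2 (hm2 n h))
            subst this
            rw [hm]
            have : dyadicIdx m y = dyadicIdx m x := hy
            rw [this]
      have h0 : ENNReal.ofReal ((2 : ℝ) ^ (-n)) ≠ 0 := by
        simp only [ne_eq, ENNReal.ofReal_eq_zero, not_le]; positivity
      rw [hset]
      refine ⟨_, _, by positivity, dyadicCell_subset_closedBall n x,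
        measurableSet_dyadicCell n x, ?_, ?_, ?_⟩
      · rw [volume_dyadicCell]; congr 1; ring
      · rw [volume_dyadicCell, ← ENNReal.le_div_iff_mul_le (Or.inl h0)
          (Or.inl ENNReal.ofReal_ne_top)]
        exact hsel.le
      · rw [volume_dyadicCell, ← ENNReal.div_le_iff_le_mul (Or.inl h0)
          (Or.inl ENNReal.ofReal_ne_top)]
        refine (dyadicAvg_succ_le φ n x).trans ?_
        gcongr
        exact hmin _ (by omega)
    · rw [not_nonempty_iff_eq_empty] at hne
      exact ⟨0, 0, le_rfl, by simp [hne], by simp [hne], by simp [hne], by simp [hne],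
        by simp [hne]⟩
  · filter_upwards [ae_le_of_forall_dyadicAvg_le hφm hφ l] with x hx hnone
    obtain ⟨-, h1⟩ | ⟨m, hm, -, -⟩ := hκ x
    · exact hx h1
    · rw [hnone] at hm; cases hm

/-! ### Convolution with operator valued kernels and the Calderón-Zygmund decomposition. -/

set_option linter.unusedSectionVars false

section Operators

variable {E F : Type*} [NormedAddCommGroup E] [NormedSpace ℂ E] [NormedAddCommGroup F]
  [NormedSpace ℂ F]

/-- The convolution operator with an operator valued kernel. -/
def convOp (K : ℝ → E →L[ℂ] F) (f : ℝ → E) (x : ℝ) : F := ∫ y, K (x - y) (f y)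

/-- Bounded integrable functions. -/
structure BddIntegrable (f : ℝ → E) : Prop where
  sm : StronglyMeasurable f
  int : Integrable f
  bdd : ∃ M : ℝ, ∀ x, ‖f x‖ ≤ M

/-- Continuous bounded integrable kernels. -/
structure NiceKernel (K : ℝ → E →L[ℂ] F) : Prop where
  cont : Continuous K
  int : Integrable K
  bdd : ∃ M : ℝ, ∀ x, ‖K x‖ ≤ M

variable {K : ℝ → E →L[ℂ] F} {f g : ℝ → E}

theorem BddIntegrable.sub (hf : BddIntegrable f) (hg : BddIntegrable g) :
    BddIntegrable (fun x => f x - g x) := by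
  obtain ⟨M, hM⟩ := hf.bdd
  obtain ⟨N, hN⟩ := hg.bdd
  exact ⟨hf.sm.sub hg.sm, hf.int.sub hg.int, M + N, fun x =>
    (norm_sub_le _ _).trans (add_le_add (hM x) (hN x))⟩

theorem BddIntegrable.lintegral_ne_top (hf : BddIntegrable f) : ∫⁻ x, ‖f x‖ₑ ≠ ∞ :=
  hf.int.2.ne

theorem NiceKernel.stronglyMeasurable_integrand (hK : NiceKernel K) (hf : StronglyMeasurable f) :
    StronglyMeasurable (Function.uncurry fun x y => K (x - y) (f y)) := by
  have h1 : StronglyMeasurable (fun p : ℝ × ℝ => K (p.1 - p.2)) :=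
    hK.cont.stronglyMeasurable.comp_measurable (measurable_fst.sub measurable_snd)
  have h2 : StronglyMeasurable (fun p : ℝ × ℝ => f p.2) := hf.comp_measurable measurable_snd
  exact (isBoundedBilinearMap_apply (𝕜 := ℂ) (E := E) (F := F)).continuous.comp_stronglyMeasurable
    (h1.prodMk h2)

theorem NiceKernel.stronglyMeasurable_integrand_right (hK : NiceKernel K)
    (hf : StronglyMeasurable f) (x : ℝ) : StronglyMeasurable (fun y => K (x - y) (f y)) :=
  (hK.stronglyMeasurable_integrand hf).comp_measurable measurable_prodMk_left

theorem NiceKernel.integrable_integrand (hK : NiceKernel K) (hf : BddIntegrable f) (x : ℝ) :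
    Integrable (fun y => K (x - y) (f y)) := by
  obtain ⟨M, hM⟩ := hK.bdd
  refine (hf.int.norm.const_mul M).mono'
    (hK.stronglyMeasurable_integrand_right hf.sm x).aestronglyMeasurable
    (Filter.Eventually.of_forall fun y => ?_)
  exact ((K (x - y)).le_opNorm _).trans (by gcongr; exact hM _)

theorem NiceKernel.integrable_prod (hK : NiceKernel K) (hf : Integrable f) :
    Integrable (fun p : ℝ × ℝ => K (p.1 - p.2) (f p.2)) (volume.prod volume) :=
  hf.convolution_integrand (ContinuousLinearMap.apply ℂ F : E →L[ℂ] (E →L[ℂ] F) →L[ℂ] F) hK.int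

theorem NiceKernel.bddIntegrable_convOp (hK : NiceKernel K) (hf : BddIntegrable f) :
    BddIntegrable (convOp K f) := by
  obtain ⟨M, hM⟩ := hK.bdd
  refine ⟨(hK.stronglyMeasurable_integrand hf.sm).integral_prod_right,
    (hK.integrable_prod hf.int).integral_prod_left, M * ∫ y, ‖f y‖, fun x => ?_⟩
  rw [← integral_const_mul]
  refine norm_integral_le_of_norm_le (hf.int.norm.const_mul M)
    (Filter.Eventually.of_forall fun y => ?_)
  exact ((K (x - y)).le_opNorm _).trans (by gcongr; exact hM _)

theorem NiceKernel.convOp_sub (hK : NiceKernel K) (hf : BddIntegrable f) (hg : BddIntegrable g)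
    (x : ℝ) : convOp K (fun y => f y - g y) x = convOp K f x - convOp K g x := by
  simp only [convOp, map_sub]
  exact integral_sub (hK.integrable_integrand hf x) (hK.integrable_integrand hg x)

/-- Hörmander's integral regularity condition. -/
def Hormander (K : ℝ → E →L[ℂ] F) (B : ℝ≥0) : Prop :=
  ∀ y : ℝ, ∫⁻ x in {x : ℝ | 2 * |y| ≤ |x|}, ‖K (x - y) - K x‖ₑ ≤ B

/-- Since `b` has mean zero on `I`, the constant operator `K (x - c)` can be subtracted under the
integral. Off the doubled ball `|x - c| ≥ 2 r ≥ 2 |y - c|`, which is the region of Hörmander's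
condition at the shift `y - c`. -/
theorem Hormander.lintegral_le [CompleteSpace E] [CompleteSpace F]
    (hK : NiceKernel K) {B : ℝ≥0} (hB : Hormander K B)
    {b : ℝ → E} (hb : BddIntegrable b) {I : Set ℝ} {c r : ℝ}
    (hIc : I ⊆ Metric.closedBall c r) (h0 : ∫ y in I, b y = 0) :
    ∫⁻ x in (Metric.ball c (2 * r))ᶜ, ‖∫ y in I, K (x - y) (b y)‖ₑ ≤ B * ∫⁻ y in I, ‖b y‖ₑ := by
  have h1 : ∀ x, ‖∫ y in I, K (x - y) (b y)‖ₑ ≤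
      ∫⁻ y in I, ‖K (x - y) - K (x - c)‖ₑ * ‖b y‖ₑ := fun x => by
    have e : ∫ y in I, K (x - y) (b y) = ∫ y in I, (K (x - y) - K (x - c)) (b y) := by
      simp only [sub_apply]
      rw [integral_sub (hK.integrable_integrand hb x).integrableOn
        ((K (x - c)).integrable_comp hb.int.integrableOn),
        ContinuousLinearMap.integral_comp_comm _ hb.int.integrableOn, h0, map_zero, sub_zero]
    rw [e]
    refine (enorm_integral_le_lintegral_enorm _).trans (lintegral_mono fun y => ?_)
    exact ContinuousLinearMap.le_opENorm _ _
  have hm : Measurable (Function.uncurry fun x y => ‖K (x - y) - K (x - c)‖ₑ * ‖b y‖ₑ) := by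
    have h2 : Continuous (fun p : ℝ × ℝ => ‖K (p.1 - p.2) - K (p.1 - c)‖ₑ) := by
      have := hK.cont
      fun_prop
    exact h2.measurable.mul (hb.sm.enorm.comp measurable_snd)
  calc ∫⁻ x in (Metric.ball c (2 * r))ᶜ, ‖∫ y in I, K (x - y) (b y)‖ₑ
      ≤ ∫⁻ x in (Metric.ball c (2 * r))ᶜ, ∫⁻ y in I, ‖K (x - y) - K (x - c)‖ₑ * ‖b y‖ₑ :=
        lintegral_mono fun x => h1 x
    _ = ∫⁻ y in I, ∫⁻ x in (Metric.ball c (2 * r))ᶜ, ‖K (x - y) - K (x - c)‖ₑ * ‖b y‖ₑ :=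
        lintegral_lintegral_swap hm.aemeasurable
    _ ≤ ∫⁻ y in I, B * ‖b y‖ₑ := by
        refine setLIntegral_mono (hb.sm.enorm.const_mul _) fun y hy => ?_
        have h2 : Continuous (fun x : ℝ => ‖K (x - y) - K (x - c)‖ₑ) := by
          have := hK.cont
          fun_prop
        rw [lintegral_mul_const _ h2.measurable]
        gcongr
        refine le_trans ?_ (hB (y - c))
        have hc : MeasurableSet {x : ℝ | 2 * |y - c| ≤ |x|} :=
          measurableSet_le measurable_const measurable_id.norm
        rw [← lintegral_indicator (Metric.isOpen_ball.measurableSet.compl),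
          ← lintegral_indicator hc, ← lintegral_sub_right_eq_self
            ({x : ℝ | 2 * |y - c| ≤ |x|}.indicator fun x => ‖K (x - (y - c)) - K x‖ₑ) c]
        refine lintegral_mono fun x => ?_
        by_cases hx : x ∈ (Metric.ball c (2 * r))ᶜ
        · have hx' : x - c ∈ {x : ℝ | 2 * |y - c| ≤ |x|} := by
            simp only [mem_compl_iff, Metric.mem_ball, not_lt, Real.dist_eq] at hx
            have := hIc hy
            rw [Metric.mem_closedBall, Real.dist_eq] at this
            change 2 * |y - c| ≤ |x - c|
            linarith
          rw [indicator_of_mem hx, indicator_of_mem hx', sub_sub_sub_cancel_right]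
        · rw [indicator_of_notMem hx]; exact zero_le
    _ = B * ∫⁻ y in I, ‖b y‖ₑ := lintegral_const_mul _ hb.sm.enorm

/-- The Calderón-Zygmund decomposition at height `l` of a bounded integrable function. -/
theorem exists_cz_decomposition [CompleteSpace E] (hf : BddIntegrable f) {l : ℝ≥0∞}
    (hl : l ≠ 0) (hl' : l ≠ ∞) :
    ∃ (g : ℝ → E) (I : ℤ × ℤ → Set ℝ) (c r : ℤ × ℤ → ℝ), BddIntegrable g ∧
      (∀ i, MeasurableSet (I i)) ∧ Pairwise (Function.onFun Disjoint I) ∧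
      (∀ i, 0 ≤ r i ∧ I i ⊆ Metric.closedBall (c i) (r i) ∧
        volume (I i) = ENNReal.ofReal (2 * r i)) ∧
      l * volume (⋃ i, I i) ≤ ∫⁻ x in ⋃ i, I i, ‖f x‖ₑ ∧
      (∀ i, ∫⁻ x in I i, ‖f x - g x‖ₑ ≤ 4 * l * volume (I i)) ∧
      (∀ i, ∫ x in I i, (f x - g x) = 0) ∧
      (∀ x ∉ ⋃ i, I i, f x - g x = 0) ∧
      (∀ x ∈ ⋃ i, I i, ‖g x‖ₑ ≤ 2 * l) ∧
      (∀ᵐ x, x ∉ ⋃ i, I i → ‖g x‖ₑ = ‖f x‖ₑ ∧ ‖f x‖ₑ ≤ l) := by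
  obtain ⟨κ, hκ, hnone⟩ := exists_stopping_index hf.sm.enorm hf.lintegral_ne_top hl hl'
  choose c r hr hsub hmeas hvol hlow hup using hκ
  set I : ℤ × ℤ → Set ℝ := fun i => κ ⁻¹' {some i} with hI
  have hfin : ∀ i, volume (I i) ≠ ∞ := fun i => by
    rw [hI]; simp only [hvol]; exact ENNReal.ofReal_ne_top
  have hdisj : Pairwise (Function.onFun Disjoint I) := fun i j hij =>
    disjoint_left.2 fun x hx hy => hij (Option.some.inj ((mem_singleton_iff.1 hx).symm.trans
      (mem_singleton_iff.1 hy)))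
  have hmem : ∀ x, x ∉ (⋃ i, I i) ↔ κ x = none := fun x => by
    simp [hI, Option.eq_none_iff_forall_ne_some]
  have hΩ : MeasurableSet (⋃ i, I i) := MeasurableSet.iUnion hmeas
  have hlΩ : l * volume (⋃ i, I i) ≤ ∫⁻ x in ⋃ i, I i, ‖f x‖ₑ := by
    rw [measure_iUnion hdisj hmeas, lintegral_iUnion hmeas hdisj, ← ENNReal.tsum_mul_left]
    exact ENNReal.tsum_le_tsum hlow
  have hΩfin : volume (⋃ i, I i) ≠ ∞ := fun h => by
    rw [h, ENNReal.mul_top hl, top_le_iff] at hlΩ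
    exact hf.lintegral_ne_top (top_le_iff.1 (hlΩ ▸ setLIntegral_le_lintegral _ _))
  let avg : Option (ℤ × ℤ) → E := fun o => o.elim 0 fun i => ⨍ x in I i, f x
  have havg : ∀ o, ‖avg o‖ₑ ≤ 2 * l := fun o => by
    rcases o with _ | i
    · simp [avg]
    · simp only [avg, Option.elim_some]
      rw [setAverage_eq, enorm_smul]
      rcases eq_or_ne (volume (I i)) 0 with h0 | h0
      · simp [Measure.real, h0]
      have hv : ‖(volume.real (I i))⁻¹‖ₑ = (volume (I i))⁻¹ := by
        rw [Real.enorm_eq_ofReal (by positivity), Measure.real,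
          ENNReal.ofReal_inv_of_pos (ENNReal.toReal_pos h0 (hfin i)), ENNReal.ofReal_toReal (hfin i)]
      rw [hv, mul_comm, ← div_eq_mul_inv]
      exact ENNReal.div_le_of_le_mul ((enorm_integral_le_lintegral_enorm _).trans (hup i))
  have hsing : ∀ o : Option (ℤ × ℤ), MeasurableSet (κ ⁻¹' {o}) := fun o => by
    rcases o with _ | i
    · convert hΩ.compl using 1
      ext x; rw [mem_compl_iff, hmem]; rfl
    · exact hmeas i
  -- The index set is countable, so measurability of the fibres makes `κ` measurable, and the good
  -- function is measurable as a function of `κ`.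
  let _ : MeasurableSpace (Option (ℤ × ℤ)) := ⊤
  have hκm : Measurable κ := measurable_to_countable' hsing
  classical
  let g : ℝ → E := fun x => if κ x = none then f x else avg (κ x)
  have hgsm : StronglyMeasurable g := by
    refine StronglyMeasurable.ite (hsing none) hf.sm ?_
    exact (StronglyMeasurable.of_discrete (f := avg)).comp_measurable hκm
  have hgI : ∀ i, ∀ x ∈ I i, g x = avg (some i) := fun i x hx => by
    have : κ x = some i := hx
    simp [g, this]
  have hgΩ : ∀ x ∈ ⋃ i, I i, ‖g x‖ₑ ≤ 2 * l := fun x hx => by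
    obtain ⟨i, hi⟩ := mem_iUnion.1 hx
    rw [hgI i x hi]; exact havg _
  have hgn : ∀ x ∉ ⋃ i, I i, g x = f x := fun x hx => by simp [g, (hmem x).1 hx]
  have hg : BddIntegrable g := by
    refine ⟨hgsm, ⟨hgsm.aestronglyMeasurable, ?_⟩, ?_⟩
    · rw [HasFiniteIntegral, ← lintegral_add_compl _ hΩ]
      refine ENNReal.add_lt_top.2 ⟨?_, ?_⟩
      · refine (setLIntegral_mono measurable_const hgΩ).trans_lt ?_
        rw [setLIntegral_const]
        exact ENNReal.mul_lt_top (by finiteness) hΩfin.lt_top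
      · rw [setLIntegral_congr_fun hΩ.compl (g := fun x => ‖f x‖ₑ)
          fun x hx => by simp only [hgn x hx]]
        exact (setLIntegral_le_lintegral _ _).trans_lt hf.lintegral_ne_top.lt_top
    · obtain ⟨M, hM⟩ := hf.bdd
      refine ⟨max M (2 * l).toReal, fun x => ?_⟩
      by_cases hx : x ∈ ⋃ i, I i
      · refine le_max_of_le_right ?_
        rw [← toReal_enorm]
        exact ENNReal.toReal_mono (by finiteness) (hgΩ x hx)
      · rw [hgn x hx]; exact le_max_of_le_left (hM x)
  refine ⟨g, I, c, r, hg, hmeas, hdisj, fun i => ⟨hr i, hsub i, hvol i⟩, hlΩ, fun i => ?_,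
    fun i => ?_, fun x hx => by rw [hgn x hx, sub_self], hgΩ, ?_⟩
  · calc ∫⁻ x in I i, ‖f x - g x‖ₑ ≤ ∫⁻ x in I i, (‖f x‖ₑ + 2 * l) := by
          refine setLIntegral_mono (hf.sm.enorm.add_const _) fun x hx => ?_
          exact enorm_sub_le.trans (by gcongr; exact hgΩ x (mem_iUnion_of_mem i hx))
      _ = (∫⁻ x in I i, ‖f x‖ₑ) + 2 * l * volume (I i) := by
          rw [lintegral_add_right _ measurable_const, setLIntegral_const]
      _ ≤ 2 * l * volume (I i) + 2 * l * volume (I i) := by gcongr; exact hup i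
      _ = 4 * l * volume (I i) := by ring
  · rw [integral_sub hf.int.integrableOn hg.int.integrableOn,
      setIntegral_congr_fun (hmeas i) (hgI i), setIntegral_const]
    simp only [avg, Option.elim_some]
    rw [← measure_smul_setAverage f (hfin i), sub_self]
  · filter_upwards [hnone] with x hx hx'
    rw [hgn x hx']
    exact ⟨rfl, hx ((hmem x).1 hx')⟩

end Operators

/-! ### Level set estimate for singular integrals. -/

set_option linter.unusedSectionVars false

section LevelSets

variable {E F : Type*} [NormedAddCommGroup E] [NormedSpace ℂ E] [NormedAddCommGroup F]
  [NormedSpace ℂ F] {K : ℝ → E →L[ℂ] F} {f : ℝ → E}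

/-- `L^2` boundedness of the convolution operator on bounded integrable functions. -/
def L2Bound (K : ℝ → E →L[ℂ] F) (A : ℝ≥0) : Prop :=
  ∀ f : ℝ → E, BddIntegrable f → ∫⁻ x, ‖convOp K f x‖ₑ ^ 2 ≤ A * ∫⁻ x, ‖f x‖ₑ ^ 2

/-- The part of `Ω` where `φ ≤ l / 2` contributes at most half of the left side and is absorbed.
This localises the bound on the stopping set to large values of `φ`, as the later integration in `l`
requires. -/
theorem mul_volume_le_lintegral_lt {φ : ℝ → ℝ≥0∞} (hφ : Measurable φ) {Ω : Set ℝ} {l : ℝ≥0∞}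
    (hl : l ≠ 0) (hl' : l ≠ ∞) (hfin : ∫⁻ x, φ x ≠ ∞)
    (h : l * volume Ω ≤ ∫⁻ x in Ω, φ x) :
    l / 2 * volume Ω ≤ ∫⁻ x in {x | l / 2 < φ x}, φ x := by
  have hv : volume Ω ≠ ∞ := fun hv => by
    rw [hv, ENNReal.mul_top hl, top_le_iff] at h
    exact hfin (top_le_iff.1 (h ▸ setLIntegral_le_lintegral _ _))
  have hm : MeasurableSet {x | l / 2 < φ x} := measurableSet_lt measurable_const hφ
  have h1 : ∫⁻ x in Ω, φ x ≤ (∫⁻ x in {x | l / 2 < φ x}, φ x) + l / 2 * volume Ω := by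
    rw [← lintegral_inter_add_sdiff φ Ω hm]
    gcongr
    · exact inter_subset_right
    · calc ∫⁻ x in Ω \ {x | l / 2 < φ x}, φ x ≤ ∫⁻ x in Ω \ {x | l / 2 < φ x}, l / 2 :=
            setLIntegral_mono measurable_const fun x hx => not_lt.1 hx.2
        _ ≤ l / 2 * volume Ω := by
            rw [setLIntegral_const]; gcongr; exact sdiff_subset
  have h2 : l / 2 * volume Ω + l / 2 * volume Ω = l * volume Ω := by
    rw [← add_mul, ENNReal.add_halves]
  have h3 := h.trans h1
  rw [← h2] at h3
  exact (ENNReal.add_le_add_iff_right (by finiteness)).1 h3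

/-- The bad part is handled by Hörmander's condition off the doubled intervals, the good part by the
`L²` bound. Restricting the two integrals to large and small values of `f` combines the weak `(1,1)`
and `L²` information in one inequality, ready to be integrated against `l^{p-1}`. -/
theorem volume_lt_enorm_convOp_le [CompleteSpace E] [CompleteSpace F] (hK : NiceKernel K)
    {A B : ℝ≥0} (hA : L2Bound K A) (hB : Hormander K B) (hf : BddIntegrable f) {l : ℝ≥0∞}
    (hl : l ≠ 0) (hl' : l ≠ ∞) :
    volume {x | l < ‖convOp K f x‖ₑ} ≤ (4 + 16 * B + 32 * A : ℝ≥0) *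
      (l⁻¹ * (∫⁻ x in {x | l / 2 < ‖f x‖ₑ}, ‖f x‖ₑ) +
        (l ^ 2)⁻¹ * ∫⁻ x in {x | ‖f x‖ₑ ≤ l}, ‖f x‖ₑ ^ 2) := by
  obtain ⟨g, I, c, r, hg, hm, hd, hI, hΩ, hb1, hb0, hbΩ, hgΩ, hgn⟩ :=
    exists_cz_decomposition hf hl hl'
  set Ω := ⋃ i, I i with hΩdef
  have hmΩ : MeasurableSet Ω := MeasurableSet.iUnion hm
  set b : ℝ → E := fun x => f x - g x with hbdef
  have hb : BddIntegrable b := hf.sub hg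
  set Ω' : Set ℝ := ⋃ i, Metric.ball (c i) (2 * r i) with hΩ'
  have hvol' : volume Ω' ≤ 2 * volume Ω := by
    rw [hΩdef, measure_iUnion hd hm, ← ENNReal.tsum_mul_left]
    refine (measure_iUnion_le _).trans (ENNReal.tsum_le_tsum fun i => ?_)
    rw [(hI i).2.2, Real.volume_ball, ← ENNReal.ofReal_ofNat, ← ENNReal.ofReal_mul (by norm_num)]
  have hTb : ∀ x, ‖convOp K b x‖ₑ ≤ ∑' i, ‖∫ y in I i, K (x - y) (b y)‖ₑ := fun x => by
    have h1 : convOp K b x = ∫ y in Ω, K (x - y) (b y) := by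
      refine (setIntegral_eq_integral_of_forall_compl_eq_zero fun y hy => ?_).symm
      rw [show b y = 0 from hbΩ y hy, map_zero]
    have h2 := hasSum_integral_iUnion hm hd (hK.integrable_integrand hb x).integrableOn
    rw [h1, ← h2.tsum_eq]
    exact enorm_tsum_le_tsum_enorm
  have hbad : ∫⁻ x in Ω'ᶜ, ‖convOp K b x‖ₑ ≤ B * (4 * l * volume Ω) := by
    calc ∫⁻ x in Ω'ᶜ, ‖convOp K b x‖ₑ
        ≤ ∫⁻ x in Ω'ᶜ, ∑' i, ‖∫ y in I i, K (x - y) (b y)‖ₑ := lintegral_mono fun x => hTb x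
      _ = ∑' i, ∫⁻ x in Ω'ᶜ, ‖∫ y in I i, K (x - y) (b y)‖ₑ :=
          lintegral_tsum fun i =>
            ((hK.stronglyMeasurable_integrand hb.sm).integral_prod_right).enorm.aemeasurable
      _ ≤ ∑' i, B * (4 * l * volume (I i)) := by
          refine ENNReal.tsum_le_tsum fun i => ?_
          refine (lintegral_mono_set (compl_subset_compl.2 (subset_iUnion
            (fun i => Metric.ball (c i) (2 * r i)) i))).trans ?_
          refine (hB.lintegral_le hK hb (hI i).2.1 (hb0 i)).trans ?_
          gcongr
          exact hb1 i
      _ = B * (4 * l * volume Ω) := by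
          rw [ENNReal.tsum_mul_left, ENNReal.tsum_mul_left, ← measure_iUnion hd hm]
  have hl2 : l / 2 ≠ 0 := by simp [hl]
  have hl2' : l / 2 ≠ ∞ := by finiteness
  have hsmb := (hK.bddIntegrable_convOp hb).sm
  have hsmg := (hK.bddIntegrable_convOp hg).sm
  have hsub : {x | l < ‖convOp K f x‖ₑ} ⊆ Ω' ∪ ({x | l / 2 ≤ ‖convOp K b x‖ₑ} ∩ Ω'ᶜ) ∪
      {x | (l / 2) ^ 2 ≤ ‖convOp K g x‖ₑ ^ 2} := fun x hx => by
    by_contra hcon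
    simp only [mem_union, mem_inter_iff, mem_compl_iff, not_or, not_and, not_not] at hcon
    obtain ⟨⟨h1, h2⟩, h3⟩ := hcon
    have h2' : ‖convOp K b x‖ₑ < l / 2 := not_le.1 fun h => h1 (h2 h)
    have h3' : ‖convOp K g x‖ₑ < l / 2 := not_le.1 fun h => h3 (pow_le_pow_left' h 2)
    have e : convOp K f x = convOp K b x + convOp K g x := by
      rw [hbdef, hK.convOp_sub hf hg, sub_add_cancel]
    have : ‖convOp K f x‖ₑ < l := by
      rw [e, ← ENNReal.add_halves l]
      exact (enorm_add_le _ _).trans_lt (ENNReal.add_lt_add h2' h3')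
    exact absurd hx (not_lt.2 this.le)
  -- Chebyshev at height `l / 2` applied to the total `4 l B |Ω|` gives the factor `8 B`.
  have hv1 : volume ({x | l / 2 ≤ ‖convOp K b x‖ₑ} ∩ Ω'ᶜ) ≤ 8 * B * volume Ω := by
    have h1 := mul_meas_ge_le_lintegral (μ := volume.restrict Ω'ᶜ) hsmb.enorm (l / 2)
    rw [Measure.restrict_apply (measurableSet_le measurable_const hsmb.enorm)] at h1
    have h2 := h1.trans hbad
    have h3 : B * (4 * l * volume Ω) = l / 2 * (8 * B * volume Ω) := by
      conv_lhs => rw [← ENNReal.add_halves l]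
      ring
    rw [h3] at h2
    exact (ENNReal.mul_le_mul_iff_right hl2 hl2').1 h2
  have hv2 : volume {x | (l / 2) ^ 2 ≤ ‖convOp K g x‖ₑ ^ 2} ≤
      4 * A * ((l ^ 2)⁻¹ * ∫⁻ x in {x | ‖f x‖ₑ ≤ l}, ‖f x‖ₑ ^ 2) + 16 * A * volume Ω := by
    have h1 := mul_meas_ge_le_lintegral (μ := volume) (hsmg.enorm.pow_const 2) ((l / 2) ^ 2)
    have h2 : ∫⁻ x, ‖g x‖ₑ ^ 2 ≤
        (∫⁻ x in {x | ‖f x‖ₑ ≤ l}, ‖f x‖ₑ ^ 2) + 4 * l ^ 2 * volume Ω := by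
      rw [← lintegral_add_compl _ hmΩ, add_comm]
      refine add_le_add ?_ ?_
      · calc ∫⁻ x in Ωᶜ, ‖g x‖ₑ ^ 2
            ≤ ∫⁻ x in Ωᶜ, {x | ‖f x‖ₑ ≤ l}.indicator (fun x => ‖f x‖ₑ ^ 2) x := by
              refine setLIntegral_mono_ae' hmΩ.compl ?_
              filter_upwards [hgn] with x hx hx'
              rw [indicator_of_mem (show x ∈ {x | ‖f x‖ₑ ≤ l} from (hx hx').2), (hx hx').1]
          _ ≤ ∫⁻ x, {x | ‖f x‖ₑ ≤ l}.indicator (fun x => ‖f x‖ₑ ^ 2) x :=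
              setLIntegral_le_lintegral _ _
          _ = _ := lintegral_indicator (measurableSet_le hf.sm.enorm measurable_const) _
      · calc ∫⁻ x in Ω, ‖g x‖ₑ ^ 2 ≤ ∫⁻ x in Ω, (2 * l) ^ 2 :=
              setLIntegral_mono measurable_const fun x hx => pow_le_pow_left' (hgΩ x hx) 2
          _ = 4 * l ^ 2 * volume Ω := by rw [setLIntegral_const]; ring
    have h3 := (h1.trans (hA g hg)).trans (mul_le_mul_right h2 (A : ℝ≥0∞))
    have e1 : l ^ 2 * (l ^ 2)⁻¹ = 1 :=
      ENNReal.mul_inv_cancel (by simp [hl]) (by finiteness)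
    have e2 : l ^ 2 = 4 * (l / 2) ^ 2 := by
      conv_lhs => rw [← ENNReal.add_halves l]
      ring
    have h4 : (A : ℝ≥0∞) * ((∫⁻ x in {x | ‖f x‖ₑ ≤ l}, ‖f x‖ₑ ^ 2) + 4 * l ^ 2 * volume Ω) =
        (l / 2) ^ 2 * (4 * A * ((l ^ 2)⁻¹ * ∫⁻ x in {x | ‖f x‖ₑ ≤ l}, ‖f x‖ₑ ^ 2) +
          16 * A * volume Ω) := by
      calc _ = A * ((l ^ 2 * (l ^ 2)⁻¹) * (∫⁻ x in {x | ‖f x‖ₑ ≤ l}, ‖f x‖ₑ ^ 2) +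
            4 * l ^ 2 * volume Ω) := by rw [e1, one_mul]
        _ = A * ((4 * (l / 2) ^ 2 * (l ^ 2)⁻¹) * (∫⁻ x in {x | ‖f x‖ₑ ≤ l}, ‖f x‖ₑ ^ 2) +
            4 * (4 * (l / 2) ^ 2) * volume Ω) := by rw [← e2]
        _ = _ := by ring
    rw [h4] at h3
    exact (ENNReal.mul_le_mul_iff_right (by simp [hl]) (by finiteness)).1 h3
  have hv3 : volume Ω ≤ 2 * (l⁻¹ * ∫⁻ x in {x | l / 2 < ‖f x‖ₑ}, ‖f x‖ₑ) := by
    have h1 := mul_volume_le_lintegral_lt hf.sm.enorm hl hl' hf.lintegral_ne_top hΩ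
    have e1 : l / 2 * (2 * l⁻¹) = 1 := by
      rw [← mul_assoc, ENNReal.div_mul_cancel (by simp) (by simp), ENNReal.mul_inv_cancel hl hl']
    rw [← mul_assoc]
    calc volume Ω = l / 2 * (2 * l⁻¹) * volume Ω := by rw [e1, one_mul]
      _ = 2 * l⁻¹ * (l / 2 * volume Ω) := by ring
      _ ≤ _ := by gcongr
  set X := l⁻¹ * ∫⁻ x in {x | l / 2 < ‖f x‖ₑ}, ‖f x‖ₑ
  set Y := (l ^ 2)⁻¹ * ∫⁻ x in {x | ‖f x‖ₑ ≤ l}, ‖f x‖ₑ ^ 2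
  calc volume {x | l < ‖convOp K f x‖ₑ}
      ≤ 2 * volume Ω + 8 * B * volume Ω + (4 * A * Y + 16 * A * volume Ω) := by
        refine (measure_mono hsub).trans ((measure_union_le _ _).trans ?_)
        gcongr
        exact (measure_union_le _ _).trans (by gcongr)
    _ = (2 + 8 * B + 16 * A) * volume Ω + 4 * A * Y := by ring
    _ ≤ (2 + 8 * B + 16 * A) * (2 * X) + (4 + 16 * B + 32 * A) * Y := by
        gcongr
        refine le_add_left ?_
        gcongr
        norm_num
    _ = (4 + 16 * B + 32 * A : ℝ≥0) * (X + Y) := by push_cast; ring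

end LevelSets

/-! ### Strong type bounds for exponents below two. -/

set_option linter.unusedSectionVars false

section Interpolation

variable {E F : Type*} [NormedAddCommGroup E] [NormedSpace ℂ E] [NormedAddCommGroup F]
  [NormedSpace ℂ F] {K : ℝ → E →L[ℂ] F} {f : ℝ → E}

/-- `L^p` boundedness of the convolution operator on bounded integrable functions. -/
def LpBound (K : ℝ → E →L[ℂ] F) (p : ℝ) (C : ℝ≥0) : Prop :=
  ∀ f : ℝ → E, BddIntegrable f → ∫⁻ x, ‖convOp K f x‖ₑ ^ p ≤ C * ∫⁻ x, ‖f x‖ₑ ^ p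

theorem lpBound_two_iff {A : ℝ≥0} : LpBound K 2 A ↔ L2Bound K A := by
  simp [LpBound, L2Bound]

/-- The weight left by the large values of `f` in the layer cake formula; convergence at `0` is
where `p > 1` enters. -/
theorem lintegral_Iio_rpow_le {p : ℝ} (hp : 1 < p) {r : ℝ} (hr : 0 ≤ r) :
    ∫⁻ t in Ioi (0 : ℝ), (if t < 2 * r then ENNReal.ofReal (t ^ (p - 2)) * ENNReal.ofReal r else 0)
      ≤ ENNReal.ofReal (2 ^ (p - 1) / (p - 1)) * ENNReal.ofReal r ^ p := by
  have h1 : IntegrableOn (fun t : ℝ => t ^ (p - 2)) (Ioc 0 (2 * r)) :=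
    (intervalIntegrable_iff_integrableOn_Ioc_of_le (by positivity)).1
      (intervalIntegral.intervalIntegrable_rpow' (by linarith))
  have h2 : ∫ t in Ioc 0 (2 * r), t ^ (p - 2) = (2 * r) ^ (p - 1) / (p - 1) := by
    rw [← intervalIntegral.integral_of_le (by positivity), integral_rpow (Or.inl (by linarith)),
      show p - 2 + 1 = p - 1 by ring, Real.zero_rpow (by linarith), sub_zero]
  calc _ ≤ ∫⁻ t in Ioi (0 : ℝ), (Iic (2 * r)).indicator
        (fun t => ENNReal.ofReal (t ^ (p - 2)) * ENNReal.ofReal r) t := by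
        refine lintegral_mono fun t => ?_
        dsimp only
        split_ifs with h
        · rw [indicator_of_mem (show t ∈ Iic (2 * r) from h.le)]
        · exact zero_le
    _ = (∫⁻ t in Ioc 0 (2 * r), ENNReal.ofReal (t ^ (p - 2))) * ENNReal.ofReal r := by
        rw [lintegral_indicator measurableSet_Iic, Measure.restrict_restrict measurableSet_Iic,
          Iic_inter_Ioi, lintegral_mul_const _ (by fun_prop)]
    _ = ENNReal.ofReal ((2 * r) ^ (p - 1) / (p - 1) * r) := by
        rw [← ofReal_integral_eq_lintegral_ofReal h1, h2, ← ENNReal.ofReal_mul]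
        · have : 0 < p - 1 := by linarith
          positivity
        · filter_upwards [ae_restrict_mem measurableSet_Ioc] with t ht
          exact Real.rpow_nonneg ht.1.le _
    _ = ENNReal.ofReal (2 ^ (p - 1) / (p - 1)) * ENNReal.ofReal r ^ p := by
        rw [ENNReal.ofReal_rpow_of_nonneg hr (by linarith), ← ENNReal.ofReal_mul]
        · congr 1
          rw [Real.mul_rpow (by norm_num) hr]
          have : r ^ (p - 1) * r = r ^ p := by
            rw [← Real.rpow_add_one' hr (by linarith), sub_add_cancel]
          rw [← this]; ring
        · have : 0 < p - 1 := by linarith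
          positivity

/-- The weight left by the small values of `f`; convergence at infinity is where `p < 2` enters. -/
theorem lintegral_Ici_rpow_le {p : ℝ} (hp : 0 < p) (hp2 : p < 2) {r : ℝ} (hr : 0 ≤ r) :
    ∫⁻ t in Ioi (0 : ℝ), (if r ≤ t then ENNReal.ofReal (t ^ (p - 3)) * ENNReal.ofReal r ^ 2 else 0)
      ≤ ENNReal.ofReal (1 / (2 - p)) * ENNReal.ofReal r ^ p := by
  rcases hr.eq_or_lt with rfl | hr0
  · simp
  have h1 : IntegrableOn (fun t : ℝ => t ^ (p - 3)) (Ioi r) :=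
    integrableOn_Ioi_rpow_of_lt (by linarith) hr0
  have h2 : ∫ t in Ioi r, t ^ (p - 3) = r ^ (p - 2) / (2 - p) := by
    rw [integral_Ioi_rpow_of_lt (by linarith) hr0, show p - 3 + 1 = p - 2 by ring,
      neg_div, ← div_neg, neg_sub]
  calc _ ≤ ∫⁻ t, (Ici r).indicator
        (fun t => ENNReal.ofReal (t ^ (p - 3)) * ENNReal.ofReal r ^ 2) t := by
        refine (setLIntegral_le_lintegral _ _).trans (lintegral_mono fun t => ?_)
        dsimp only
        split_ifs with h
        · rw [indicator_of_mem (show t ∈ Ici r from h)]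
        · exact zero_le
    _ = (∫⁻ t in Ioi r, ENNReal.ofReal (t ^ (p - 3))) * ENNReal.ofReal r ^ 2 := by
        rw [lintegral_indicator measurableSet_Ici, setLIntegral_congr Ioi_ae_eq_Ici.symm,
          lintegral_mul_const _ (by fun_prop)]
    _ = ENNReal.ofReal (r ^ (p - 2) / (2 - p) * r ^ 2) := by
        rw [← ofReal_integral_eq_lintegral_ofReal h1, h2, ← ENNReal.ofReal_pow hr,
          ← ENNReal.ofReal_mul]
        · have : 0 < 2 - p := by linarith
          positivity
        · filter_upwards [ae_restrict_mem measurableSet_Ioi] with t ht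
          exact Real.rpow_nonneg (hr.trans (le_of_lt ht)) _
    _ = ENNReal.ofReal (1 / (2 - p)) * ENNReal.ofReal r ^ p := by
        rw [ENNReal.ofReal_rpow_of_nonneg hr (by linarith), ← ENNReal.ofReal_mul]
        · congr 1
          have : r ^ (p - 2) * r ^ 2 = r ^ p := by
            rw [← Real.rpow_natCast r 2, ← Real.rpow_add hr0]; congr 1; push_cast; ring
          rw [← this]; ring
        · have : 0 < 2 - p := by linarith
          positivity

/-- The constant in the Calderón-Zygmund theorem for exponents below `2`. -/
def czConst (A B : ℝ≥0) (p : ℝ) : ℝ≥0 :=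
  p.toNNReal * ((4 + 16 * B + 32 * A) *
    ((2 ^ (p - 1) / (p - 1)).toNNReal + (1 / (2 - p)).toNNReal))

/-- The level set estimate is put into the layer cake formula and Tonelli moves the integral in the
height inside, leaving for each `x` the two elementary power integrals with `r = ‖f x‖`. -/
theorem lpBound_of_lt_two [CompleteSpace E] [CompleteSpace F] (hK : NiceKernel K)
    {A B : ℝ≥0} (hA : L2Bound K A) (hB : Hormander K B) {p : ℝ} (hp : 1 < p) (hp2 : p < 2) :
    LpBound K p (czConst A B p) := by
  intro f hf
  set C : ℝ≥0 := 4 + 16 * B + 32 * A with hC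
  have hsm := (hK.bddIntegrable_convOp hf).sm
  have hp0 : 0 < p := by linarith
  have h0 : ∫⁻ x, ‖convOp K f x‖ₑ ^ p = ENNReal.ofReal p * ∫⁻ t in Ioi (0 : ℝ),
      volume {x | t < ‖convOp K f x‖} * ENNReal.ofReal (t ^ (p - 1)) := by
    rw [← lintegral_rpow_eq_lintegral_meas_lt_mul volume
      (Filter.Eventually.of_forall fun x => norm_nonneg _) hsm.norm.measurable.aemeasurable hp0]
    refine lintegral_congr fun x => ?_
    rw [← ofReal_norm, ENNReal.ofReal_rpow_of_nonneg (norm_nonneg _) hp0.le]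
  have hfm : Measurable fun x => ‖f x‖ := hf.sm.norm.measurable
  have hm1 : Measurable (fun z : ℝ × ℝ => if z.1 < 2 * ‖f z.2‖ then
      ENNReal.ofReal (z.1 ^ (p - 2)) * ENNReal.ofReal ‖f z.2‖ else 0) := by
    refine Measurable.ite (measurableSet_lt measurable_fst
      ((hfm.comp measurable_snd).const_mul 2)) ?_ measurable_const
    exact (measurable_fst.pow_const _).ennreal_ofReal.mul
      (hfm.comp measurable_snd).ennreal_ofReal
  have hm2 : Measurable (fun z : ℝ × ℝ => if ‖f z.2‖ ≤ z.1 then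
      ENNReal.ofReal (z.1 ^ (p - 3)) * ENNReal.ofReal ‖f z.2‖ ^ 2 else 0) := by
    refine Measurable.ite (measurableSet_le (hfm.comp measurable_snd) measurable_fst)
      ?_ measurable_const
    exact (measurable_fst.pow_const _).ennreal_ofReal.mul
      ((hfm.comp measurable_snd).ennreal_ofReal.pow_const 2)
  have hlev : ∀ t ∈ Ioi (0 : ℝ),
      volume {x | t < ‖convOp K f x‖} * ENNReal.ofReal (t ^ (p - 1)) ≤
      C * ((∫⁻ x, if t < 2 * ‖f x‖ then
        ENNReal.ofReal (t ^ (p - 2)) * ENNReal.ofReal ‖f x‖ else 0) +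
        ∫⁻ x, if ‖f x‖ ≤ t then
          ENNReal.ofReal (t ^ (p - 3)) * ENNReal.ofReal ‖f x‖ ^ 2 else 0) := by
    intro t ht
    have ht0 : (0 : ℝ) < t := ht
    have hl : ENNReal.ofReal t ≠ 0 := by simpa using ht0
    have h1 := volume_lt_enorm_convOp_le hK hA hB hf hl ENNReal.ofReal_ne_top
    have e0 : {x | ENNReal.ofReal t < ‖convOp K f x‖ₑ} = {x | t < ‖convOp K f x‖} := by
      ext x
      simp only [mem_ofPred_eq]
      rw [← ofReal_norm, ENNReal.ofReal_lt_ofReal_iff_of_nonneg ht0.le]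
    have e1 : {x | ENNReal.ofReal t / 2 < ‖f x‖ₑ} = {x | t < 2 * ‖f x‖} := by
      ext x
      simp only [mem_ofPred_eq]
      rw [← ofReal_norm, ← ENNReal.ofReal_ofNat, ← ENNReal.ofReal_div_of_pos (by norm_num),
        ENNReal.ofReal_lt_ofReal_iff_of_nonneg (by positivity), div_lt_iff₀ (by norm_num), mul_comm]
    have e2 : {x | ‖f x‖ₑ ≤ ENNReal.ofReal t} = {x | ‖f x‖ ≤ t} := by
      ext x
      simp only [mem_ofPred_eq]
      rw [← ofReal_norm, ENNReal.ofReal_le_ofReal_iff ht0.le]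
    rw [e0, e1, e2] at h1
    have s1 : (ENNReal.ofReal t)⁻¹ * ENNReal.ofReal (t ^ (p - 1)) =
        ENNReal.ofReal (t ^ (p - 2)) := by
      rw [← ENNReal.ofReal_inv_of_pos ht0, ← ENNReal.ofReal_mul (by positivity)]
      congr 1
      rw [show p - 1 = p - 2 + 1 by ring, Real.rpow_add_one ht0.ne']; field_simp
    have s2 : (ENNReal.ofReal t ^ 2)⁻¹ * ENNReal.ofReal (t ^ (p - 1)) =
        ENNReal.ofReal (t ^ (p - 3)) := by
      rw [← ENNReal.ofReal_pow ht0.le, ← ENNReal.ofReal_inv_of_pos (by positivity),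
        ← ENNReal.ofReal_mul (by positivity)]
      congr 1
      rw [show p - 1 = p - 3 + 1 + 1 by ring, Real.rpow_add_one ht0.ne', Real.rpow_add_one ht0.ne']
      field_simp
    have i1 : (∫⁻ x, if t < 2 * ‖f x‖ then
        ENNReal.ofReal (t ^ (p - 2)) * ENNReal.ofReal ‖f x‖ else 0) =
        ENNReal.ofReal (t ^ (p - 2)) * ∫⁻ x in {x | t < 2 * ‖f x‖}, ‖f x‖ₑ := by
      rw [← lintegral_const_mul _ hf.sm.enorm, ← lintegral_indicator
        (measurableSet_lt measurable_const (hfm.const_mul 2))]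
      refine lintegral_congr fun x => ?_
      simp only [indicator, mem_ofPred_eq, ofReal_norm]
    have i2 : (∫⁻ x, if ‖f x‖ ≤ t then
        ENNReal.ofReal (t ^ (p - 3)) * ENNReal.ofReal ‖f x‖ ^ 2 else 0) =
        ENNReal.ofReal (t ^ (p - 3)) * ∫⁻ x in {x | ‖f x‖ ≤ t}, ‖f x‖ₑ ^ 2 := by
      rw [← lintegral_const_mul _ (hf.sm.enorm.pow_const 2), ← lintegral_indicator
        (measurableSet_le hfm measurable_const)]
      refine lintegral_congr fun x => ?_
      simp only [indicator, mem_ofPred_eq, ofReal_norm]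
    rw [i1, i2, ← s1, ← s2]
    refine (mul_le_mul_left h1 _).trans (le_of_eq ?_)
    ring
  rw [h0]
  calc ENNReal.ofReal p * ∫⁻ t in Ioi (0 : ℝ),
        volume {x | t < ‖convOp K f x‖} * ENNReal.ofReal (t ^ (p - 1))
      ≤ ENNReal.ofReal p * ∫⁻ t in Ioi (0 : ℝ), C * ((∫⁻ x, if t < 2 * ‖f x‖ then
        ENNReal.ofReal (t ^ (p - 2)) * ENNReal.ofReal ‖f x‖ else 0) +
        ∫⁻ x, if ‖f x‖ ≤ t then
          ENNReal.ofReal (t ^ (p - 3)) * ENNReal.ofReal ‖f x‖ ^ 2 else 0) := by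
        exact mul_le_mul_right (setLIntegral_mono' measurableSet_Ioi hlev) _
    _ = ENNReal.ofReal p * (C * ((∫⁻ x, ∫⁻ t in Ioi (0 : ℝ), if t < 2 * ‖f x‖ then
        ENNReal.ofReal (t ^ (p - 2)) * ENNReal.ofReal ‖f x‖ else 0) +
        ∫⁻ x, ∫⁻ t in Ioi (0 : ℝ), if ‖f x‖ ≤ t then
          ENNReal.ofReal (t ^ (p - 3)) * ENNReal.ofReal ‖f x‖ ^ 2 else 0)) := by
        rw [lintegral_const_mul' _ _ (by simp), lintegral_add_left hm1.lintegral_prod_right',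
          lintegral_lintegral_swap (f := fun t x => if t < 2 * ‖f x‖ then
            ENNReal.ofReal (t ^ (p - 2)) * ENNReal.ofReal ‖f x‖ else 0) hm1.aemeasurable,
          lintegral_lintegral_swap (f := fun t x => if ‖f x‖ ≤ t then
            ENNReal.ofReal (t ^ (p - 3)) * ENNReal.ofReal ‖f x‖ ^ 2 else 0) hm2.aemeasurable]
    _ ≤ ENNReal.ofReal p * (C * ((∫⁻ x, ENNReal.ofReal (2 ^ (p - 1) / (p - 1)) * ‖f x‖ₑ ^ p) +
        ∫⁻ x, ENNReal.ofReal (1 / (2 - p)) * ‖f x‖ₑ ^ p)) := by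
        gcongr with x x
        · rw [← ofReal_norm]; exact lintegral_Iio_rpow_le hp (norm_nonneg _)
        · rw [← ofReal_norm]; exact lintegral_Ici_rpow_le hp0 hp2 (norm_nonneg _)
    _ = czConst A B p * ∫⁻ x, ‖f x‖ₑ ^ p := by
        rw [lintegral_const_mul' _ _ (by simp), lintegral_const_mul' _ _ (by simp), czConst]
        push_cast
        simp only [ENNReal.ofReal, hC]
        push_cast
        ring

end Interpolation

/-! ### Adjoint kernels and duality. -/

section Duality

variable {E F : Type*} [NormedAddCommGroup E] [InnerProductSpace ℂ E] [CompleteSpace E]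
  [NormedAddCommGroup F] [InnerProductSpace ℂ F] [CompleteSpace F]
  {K : ℝ → E →L[ℂ] F} {f : ℝ → E}

/-- The kernel of the adjoint convolution operator. -/
def adjKernel (K : ℝ → E →L[ℂ] F) (t : ℝ) : F →L[ℂ] E := ContinuousLinearMap.adjoint (K (-t))

theorem adjKernel_adjKernel : adjKernel (adjKernel K) = K := by
  ext1 t; simp [adjKernel]

theorem NiceKernel.adj (hK : NiceKernel K) : NiceKernel (adjKernel K) := by
  have hc : Continuous (adjKernel K) :=
    (ContinuousLinearMap.adjoint (𝕜 := ℂ) (E := E) (F := F)).continuous.comp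
      (hK.cont.comp continuous_neg)
  refine ⟨hc, ?_, ?_⟩
  · refine hK.int.comp_neg.norm.mono' hc.aestronglyMeasurable
      (Filter.Eventually.of_forall fun x => ?_)
    simp [adjKernel]
  · obtain ⟨M, hM⟩ := hK.bdd
    exact ⟨M, fun x => by simpa [adjKernel] using hM (-x)⟩

theorem Hormander.adj {B : ℝ≥0} (hB : Hormander K B) : Hormander (adjKernel K) B := by
  intro y
  refine le_trans (le_of_eq ?_) (hB (-y))
  have hm : ∀ y : ℝ, MeasurableSet {x : ℝ | 2 * |y| ≤ |x|} := fun y =>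
    measurableSet_le measurable_const measurable_id.norm
  rw [← lintegral_indicator (hm y), ← lintegral_indicator (hm (-y)), ← lintegral_neg_eq_self]
  refine lintegral_congr fun x => ?_
  simp only [indicator, mem_ofPred_eq, abs_neg]
  congr 1
  rw [adjKernel, adjKernel, ← map_sub, ← ofReal_norm, ← ofReal_norm, LinearIsometryEquiv.norm_map]
  congr 3
  · ring_nf
  · ring_nf

/-- Fubini applies because `φ` is bounded and `K (x - y) (f y)` is integrable on the plane. -/
theorem integral_inner_convOp (hK : NiceKernel K) (hf : BddIntegrable f) {φ : ℝ → F}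
    (hφ : BddIntegrable φ) :
    ∫ x, inner ℂ (φ x) (convOp K f x) = ∫ y, inner ℂ (convOp (adjKernel K) φ y) (f y) := by
  have h1 : ∀ x, inner ℂ (φ x) (convOp K f x) = ∫ y, inner ℂ (φ x) (K (x - y) (f y)) := fun x =>
    (integral_inner (hK.integrable_integrand hf x) _).symm
  have h2 : ∀ y, inner ℂ (convOp (adjKernel K) φ y) (f y) =
      ∫ x, inner ℂ (φ x) (K (x - y) (f y)) := fun y => by
    rw [← inner_conj_symm, convOp, ← integral_inner (hK.adj.integrable_integrand hφ y),
      ← integral_conj]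
    refine integral_congr_ae (Filter.Eventually.of_forall fun x => ?_)
    simp only [inner_conj_symm, adjKernel]
    rw [ContinuousLinearMap.adjoint_inner_left, neg_sub]
  simp only [h1, h2]
  refine integral_integral_swap ?_
  obtain ⟨M, hM⟩ := hφ.bdd
  refine ((hK.integrable_prod hf.int).norm.const_mul M).mono' ?_
    (Filter.Eventually.of_forall fun z => ?_)
  · exact ((hφ.sm.comp_measurable measurable_fst).inner
      (hK.stronglyMeasurable_integrand hf.sm)).aestronglyMeasurable
  · exact (norm_inner_le_norm _ _).trans (by gcongr; exact hM _)

theorem BddIntegrable.lintegral_rpow_ne_top (hf : BddIntegrable f) {p : ℝ} (hp : 1 ≤ p) :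
    ∫⁻ x, ‖f x‖ₑ ^ p ≠ ∞ := by
  obtain ⟨M, hM⟩ := hf.bdd
  have h : ∀ x, ‖f x‖ₑ ^ p ≤ ENNReal.ofReal M ^ (p - 1) * ‖f x‖ₑ := fun x => by
    calc ‖f x‖ₑ ^ p = ‖f x‖ₑ ^ (p - 1) * ‖f x‖ₑ := by
          rw [← ENNReal.rpow_one ‖f x‖ₑ, ← ENNReal.rpow_mul, ← ENNReal.rpow_mul,
            ← ENNReal.rpow_add_of_nonneg _ _ (by linarith) (by norm_num)]
          congr 1; ring
      _ ≤ _ := by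
          refine mul_le_mul_left (ENNReal.rpow_le_rpow ?_ (by linarith)) _
          rw [← ofReal_norm]; exact ENNReal.ofReal_le_ofReal (hM x)
  refine ne_top_of_le_ne_top ?_ (lintegral_mono h)
  rw [lintegral_const_mul _ hf.sm.enorm]
  exact ENNReal.mul_ne_top (ENNReal.rpow_ne_top_of_nonneg (by linarith) ENNReal.ofReal_ne_top)
    hf.lintegral_ne_top

/-- The converse of Hölder, made explicit: pair `T f` with its own dual function, move the operator
to the other side and cancel the common power of `‖T f‖_p`. -/
theorem lpBound_of_adj (hK : NiceKernel K) {p q : ℝ} (hpq : p.HolderConjugate q) (hp : 2 ≤ p)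
    {C : ℝ≥0} (hC : LpBound (adjKernel K) q C) : LpBound K p (C ^ (p / q)) := by
  intro f hf
  have hT := hK.bddIntegrable_convOp hf
  set T := convOp K f with hTdef
  have hp1 : 1 < p := by linarith
  have hq1 := hpq.symm.lt
  -- The extremiser in Hölder: `⟨φ, T⟩ = ‖T‖^p` and `‖φ‖^q = ‖T‖^p`. As `p ≥ 2` the exponent is
  -- nonnegative, so `φ` is again bounded and integrable.
  let φ : ℝ → F := fun x => ((‖T x‖ ^ (p - 2) : ℝ) : ℂ) • T x
  have hφn : ∀ x, ‖φ x‖ = ‖T x‖ ^ (p - 1) := fun x => by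
    simp only [φ, norm_smul, Complex.norm_real, Real.norm_eq_abs]
    rw [abs_of_nonneg (by positivity), ← Real.rpow_add_one' (norm_nonneg _) (by linarith)]
    congr 1; ring
  have hφ : BddIntegrable φ := by
    have hsm : StronglyMeasurable φ := by
      refine StronglyMeasurable.smul ?_ hT.sm
      exact (Complex.continuous_ofReal.measurable.comp
        (hT.sm.norm.measurable.pow_const _)).stronglyMeasurable
    obtain ⟨M, hM⟩ := hT.bdd
    have hM0 : 0 ≤ M := (norm_nonneg _).trans (hM 0)
    refine ⟨hsm, ?_, M ^ (p - 1), fun x => ?_⟩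
    · refine (hT.int.norm.const_mul (M ^ (p - 2))).mono' hsm.aestronglyMeasurable
        (Filter.Eventually.of_forall fun x => ?_)
      rw [hφn, show p - 1 = p - 2 + 1 by ring, Real.rpow_add_one' (norm_nonneg _) (by linarith)]
      exact mul_le_mul_of_nonneg_right
        (Real.rpow_le_rpow (norm_nonneg _) (hM x) (by linarith)) (norm_nonneg _)
    · rw [hφn]; exact Real.rpow_le_rpow (norm_nonneg _) (hM x) (by linarith)
  have hin : ∀ x, inner ℂ (φ x) (T x) = ((‖T x‖ ^ p : ℝ) : ℂ) := fun x => by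
    simp only [φ, inner_smul_left, Complex.conj_ofReal, inner_self_eq_norm_sq_to_K]
    change _ * ((‖T x‖ : ℝ) : ℂ) ^ 2 = _
    rw [← Complex.ofReal_pow, ← Complex.ofReal_mul]
    congr 1
    rw [← Real.rpow_natCast, ← Real.rpow_add_of_nonneg (norm_nonneg _) (by linarith) (by norm_num)]
    congr 1; push_cast; ring
  set X := ∫⁻ x, ‖T x‖ₑ ^ p with hX
  set Y := ∫⁻ x, ‖f x‖ₑ ^ p with hY
  have hXtop : X ≠ ∞ := hT.lintegral_rpow_ne_top hp1.le
  have e1 : X = ‖∫ x, inner ℂ (φ x) (T x)‖ₑ := by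
    simp only [hin]
    rw [integral_complex_ofReal, ← ofReal_norm, Complex.norm_real, Real.norm_eq_abs,
      abs_of_nonneg (integral_nonneg fun x => by positivity), ofReal_integral_eq_lintegral_ofReal]
    · refine lintegral_congr fun x => ?_
      rw [← ofReal_norm, ENNReal.ofReal_rpow_of_nonneg (norm_nonneg _) (by linarith)]
    · refine ⟨(hT.sm.norm.measurable.pow_const _).aestronglyMeasurable, ?_⟩
      rw [HasFiniteIntegral]
      refine lt_of_eq_of_lt (lintegral_congr fun x => ?_) hXtop.lt_top
      rw [← ofReal_norm, ← ofReal_norm, ENNReal.ofReal_rpow_of_nonneg (norm_nonneg _) (by linarith),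
        Real.norm_eq_abs, abs_of_nonneg (by positivity)]
    · exact Filter.Eventually.of_forall fun x => by positivity
  have e2 : ∫⁻ x, ‖φ x‖ₑ ^ q = X := lintegral_congr fun x => by
    rw [← ofReal_norm, hφn, ← ENNReal.ofReal_rpow_of_nonneg (norm_nonneg _) (by linarith),
      ofReal_norm, ← ENNReal.rpow_mul, hpq.sub_one_mul_conj]
  have hS := hK.adj.bddIntegrable_convOp hφ
  have h1 : X ≤ (C * X) ^ (1 / q) * Y ^ (1 / p) := by
    calc X = ‖∫ y, inner ℂ (convOp (adjKernel K) φ y) (f y)‖ₑ := by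
          rw [e1, hTdef, integral_inner_convOp hK hf hφ]
      _ ≤ ∫⁻ y, ‖convOp (adjKernel K) φ y‖ₑ * ‖f y‖ₑ := by
          refine (enorm_integral_le_lintegral_enorm _).trans (lintegral_mono fun y => ?_)
          rw [← ofReal_norm, ← ofReal_norm, ← ofReal_norm, ← ENNReal.ofReal_mul (norm_nonneg _)]
          exact ENNReal.ofReal_le_ofReal (norm_inner_le_norm _ _)
      _ ≤ (∫⁻ y, ‖convOp (adjKernel K) φ y‖ₑ ^ q) ^ (1 / q) * Y ^ (1 / p) :=
          ENNReal.lintegral_mul_le_Lp_mul_Lq volume hpq.symm hS.sm.enorm.aemeasurable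
            hf.sm.enorm.aemeasurable
      _ ≤ (C * X) ^ (1 / q) * Y ^ (1 / p) := by
          have hq0 : (0 : ℝ) < 1 / q := by have := hpq.symm.pos; positivity
          have := hC φ hφ
          rw [e2] at this
          gcongr
  rcases eq_or_ne X 0 with h0 | h0
  · rw [h0]; exact zero_le
  have hq0 := hpq.symm.pos
  have hp0 := hpq.pos
  have hsum : 1 / p + 1 / q = 1 := by rw [one_div, one_div]; exact hpq.inv_add_inv_eq_one
  -- Cancelling `X ^ (1 / q)` is legitimate only because `X` is nonzero and finite; finiteness comes
  -- from `T f` being bounded and integrable.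
  have h2 : X ^ (1 / p) ≤ (C : ℝ≥0∞) ^ (1 / q) * Y ^ (1 / p) := by
    have h3 : X ^ (1 / p) * X ^ (1 / q) = X := by
      rw [← ENNReal.rpow_add _ _ h0 hXtop, hsum, ENNReal.rpow_one]
    have h4 : X ^ (1 / p) * X ^ (1 / q) ≤ (C : ℝ≥0∞) ^ (1 / q) * Y ^ (1 / p) * X ^ (1 / q) := by
      rw [h3]
      refine h1.trans (le_of_eq ?_)
      rw [ENNReal.mul_rpow_of_nonneg _ _ (by positivity)]; ring
    refine (ENNReal.mul_le_mul_iff_left ?_ ?_).1 h4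
    · exact (ENNReal.rpow_pos (pos_iff_ne_zero.2 h0) hXtop).ne'
    · exact ENNReal.rpow_ne_top_of_nonneg (by positivity) hXtop
  have h5 := ENNReal.rpow_le_rpow h2 hp0.le
  rw [ENNReal.mul_rpow_of_nonneg _ _ hp0.le, ← ENNReal.rpow_mul, ← ENNReal.rpow_mul,
    ← ENNReal.rpow_mul, one_div_mul_cancel hp0.ne', ENNReal.rpow_one, ENNReal.rpow_one] at h5
  rw [ENNReal.coe_rpow_of_nonneg _ (by positivity)]
  convert h5 using 3
  ring

end Duality

/-- The Calderón-Zygmund theorem, for a kernel and its adjoint, on bounded integrable functions. -/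
theorem exists_lpBound (A B : ℝ≥0) {p : ℝ} (hp : 1 < p) :
    ∃ C : ℝ≥0, ∀ (E F : Type) [NormedAddCommGroup E] [InnerProductSpace ℂ E] [CompleteSpace E]
      [NormedAddCommGroup F] [InnerProductSpace ℂ F] [CompleteSpace F] (K : ℝ → E →L[ℂ] F),
      NiceKernel K → L2Bound K A → Hormander K B →
        LpBound K p C ∧ LpBound (adjKernel K) p C := by
  -- Duality at `p = q = 2`, applied to the adjoint kernel, keeps the constant `A`, since `A ^ (2 /
  -- 2) = A`.
  have hdual : ∀ (E F : Type) [NormedAddCommGroup E] [InnerProductSpace ℂ E] [CompleteSpace E]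
      [NormedAddCommGroup F] [InnerProductSpace ℂ F] [CompleteSpace F] (K : ℝ → E →L[ℂ] F),
      NiceKernel K → L2Bound K A → L2Bound (adjKernel K) A := by
    intro E F _ _ _ _ _ _ K hK hA
    have := lpBound_of_adj hK.adj (p := 2) (q := 2)
      (Real.holderConjugate_iff.2 ⟨by norm_num, by norm_num⟩) le_rfl (C := A)
      (by rw [adjKernel_adjKernel]; exact lpBound_two_iff.2 hA)
    rw [div_self (by norm_num), NNReal.rpow_one] at this
    exact lpBound_two_iff.1 this
  rcases lt_trichotomy p 2 with h | h | h
  · exact ⟨czConst A B p, fun E F _ _ _ _ _ _ K hK hA hB =>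
      ⟨lpBound_of_lt_two hK hA hB hp h, lpBound_of_lt_two hK.adj (hdual E F K hK hA) hB.adj hp h⟩⟩
  · subst h
    exact ⟨A, fun E F _ _ _ _ _ _ K hK hA hB =>
      ⟨lpBound_two_iff.2 hA, lpBound_two_iff.2 (hdual E F K hK hA)⟩⟩
  · have hpq : p.HolderConjugate (Real.conjExponent p) := Real.HolderConjugate.conjExponent hp
    have hq2 : Real.conjExponent p < 2 := by
      rw [Real.conjExponent, div_lt_iff₀ (by linarith)]; linarith
    refine ⟨_, fun E F _ _ _ _ _ _ K hK hA hB => ⟨lpBound_of_adj hK hpq h.le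
      (lpBound_of_lt_two hK.adj (hdual E F K hK hA) hB.adj hpq.symm.lt hq2),
      lpBound_of_adj hK.adj hpq h.le ?_⟩⟩
    rw [adjKernel_adjKernel]
    exact lpBound_of_lt_two hK hA hB hpq.symm.lt hq2

/-! ### The kernels `ψ̌_k`: dyadic sums, scaling and smoothness. -/

/-- With `2^n ≤ r < 2^{n+1}` the term of index `k` is at most `2 · 2^{-|k + n|}`, a two-sided
geometric series whose sum does not see `r`. It serves both the multipliers (for `L²`) and the
kernels (for Hörmander's condition). -/
theorem exists_tsum_min_le : ∃ A : ℝ≥0, ∀ r : ℝ, 0 < r →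
    ∑' k : ℤ, ENNReal.ofReal (min ((2 : ℝ) ^ k * r) ((2 : ℝ) ^ k * r)⁻¹) ≤ A := by
  have hs : Summable fun j : ℤ => 2 * (1 / 2 : ℝ) ^ j.natAbs := by
    rw [summable_int_iff_summable_nat_and_neg]
    have := (summable_geometric_of_lt_one (r := (1 / 2 : ℝ)) (by norm_num) (by norm_num)).mul_left 2
    exact ⟨by simpa using this, by simpa using this⟩
  refine ⟨(∑' j : ℤ, ENNReal.ofReal (2 * (1 / 2 : ℝ) ^ j.natAbs)).toNNReal, fun r hr => ?_⟩
  rw [ENNReal.coe_toNNReal hs.tsum_ofReal_ne_top]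
  obtain ⟨n, hn1, hn2⟩ := exists_mem_Ico_zpow hr (one_lt_two (α := ℝ))
  rw [← (Equiv.addRight n).tsum_eq (fun j : ℤ => ENNReal.ofReal (2 * (1 / 2 : ℝ) ^ j.natAbs))]
  refine ENNReal.tsum_le_tsum fun k => ENNReal.ofReal_le_ofReal ?_
  simp only [Equiv.coe_addRight]
  have hk : (0 : ℝ) < 2 ^ k := by positivity
  rcases le_total 0 (k + n) with h | h
  · refine (min_le_right _ _).trans ?_
    obtain ⟨m, hm⟩ := Int.eq_ofNat_of_zero_le h
    have h1 : (2 : ℝ) ^ m ≤ 2 ^ k * r := by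
      calc (2 : ℝ) ^ m = 2 ^ (k + n) := by rw [hm]; simp
        _ = 2 ^ k * 2 ^ n := zpow_add₀ two_ne_zero _ _
        _ ≤ _ := by gcongr
    rw [hm, Int.natAbs_natCast, one_div, inv_pow]
    have h2 : ((2 : ℝ) ^ k * r)⁻¹ ≤ ((2 : ℝ) ^ m)⁻¹ := inv_anti₀ (by positivity) h1
    have : (0 : ℝ) ≤ ((2 : ℝ) ^ m)⁻¹ := by positivity
    linarith
  · refine (min_le_left _ _).trans ?_
    obtain ⟨m, hm⟩ : ∃ m : ℕ, k + n = -m := ⟨(k + n).natAbs, by omega⟩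
    rw [hm, Int.natAbs_neg, Int.natAbs_natCast]
    calc (2 : ℝ) ^ k * r ≤ 2 ^ k * 2 ^ (n + 1) := by gcongr
      _ = 2 * 2 ^ (k + n) := by rw [zpow_add₀ two_ne_zero, zpow_add₀ two_ne_zero]; ring
      _ = 2 * (1 / 2) ^ m := by rw [hm]; simp

/-- The dilate `ψ(2^{-k} ·)` of a Schwartz function. -/
def dilate (ψ : 𝓢(ℝ, ℂ)) (k : ℤ) : 𝓢(ℝ, ℂ) :=
  SchwartzMap.compCLMOfContinuousLinearEquiv ℂ (ContinuousLinearEquiv.unitsEquivAut ℝ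
    (Units.mk0 ((2 : ℝ) ^ (-k)) (by positivity))) ψ

theorem dilate_apply (ψ : 𝓢(ℝ, ℂ)) (k : ℤ) (t : ℝ) :
    dilate ψ k t = ψ ((2 : ℝ) ^ (-k) * t) := by
  simp [dilate, mul_comm]

/-- The kernel `ψ̌_k` as a Schwartz function. -/
def kernelS (ψ : 𝓢(ℝ, ℂ)) (k : ℤ) : 𝓢(ℝ, ℂ) := 𝓕⁻ (dilate ψ k)

theorem coe_kernelS (ψ : 𝓢(ℝ, ℂ)) (k : ℤ) : ⇑(kernelS ψ k) = kernel ψ k := by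
  rw [kernelS, SchwartzMap.fourierInv_coe, kernel]
  congr 1
  ext t
  exact dilate_apply ψ k t

theorem continuous_kernel (ψ : 𝓢(ℝ, ℂ)) (k : ℤ) : Continuous (kernel ψ k) := by
  rw [← coe_kernelS]; exact (kernelS ψ k).continuous

theorem integrable_kernel (ψ : 𝓢(ℝ, ℂ)) (k : ℤ) : Integrable (kernel ψ k) := by
  rw [← coe_kernelS]; exact (kernelS ψ k).integrable

theorem memLp_kernel (ψ : 𝓢(ℝ, ℂ)) (k : ℤ) (p : ℝ≥0∞) : MemLp (kernel ψ k) p := by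
  rw [← coe_kernelS]; exact (kernelS ψ k).memLp p

theorem bddIntegrable_coe (h : 𝓢(ℝ, ℂ)) : BddIntegrable h :=
  ⟨h.continuous.stronglyMeasurable, h.integrable, _, h.norm_le_seminorm ℝ⟩

theorem kernel_scaling (ψ : 𝓢(ℝ, ℂ)) (k : ℤ) (t : ℝ) :
    kernel ψ k t = (2 : ℝ) ^ k * kernelS ψ 0 ((2 : ℝ) ^ k * t) := by
  have h2 : (0 : ℝ) < 2 ^ k := by positivity
  rw [coe_kernelS, kernel, kernel, Real.fourierInv_eq', Real.fourierInv_eq']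
  simp only [neg_zero, zpow_zero, one_mul]
  have := Measure.integral_comp_mul_left (fun v : ℝ => Complex.exp
    (↑(2 * Real.pi * inner ℝ v ((2 : ℝ) ^ k * t)) * Complex.I) • ψ v) ((2 : ℝ) ^ (-k))
  rw [zpow_neg, inv_inv, abs_of_pos h2, Complex.real_smul] at this
  push_cast at this ⊢
  rw [← this]
  refine integral_congr_ae (Filter.Eventually.of_forall fun v => ?_)
  simp only [zpow_neg]
  congr 3
  simp only [RCLike.inner_apply, conj_trivial]
  push_cast
  have : (2 : ℂ) ^ k ≠ 0 := zpow_ne_zero _ two_ne_zero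
  field_simp

/-- The reflected conjugate cut-off. -/
def conjCutoff (ψ : 𝓢(ℝ, ℂ)) : 𝓢(ℝ, ℂ) :=
  SchwartzMap.postcompCLM (𝕜 := ℝ) (Complex.conjCLE : ℂ →L[ℝ] ℂ) ψ

theorem conjCutoff_apply (ψ : 𝓢(ℝ, ℂ)) (t : ℝ) : conjCutoff ψ t = conj (ψ t) := by
  simp [conjCutoff]

/-- The right side is the kernel of the adjoint of `P_k`, so the adjoint is again a projection of
the same type, with `conjCutoff ψ` in place of `ψ`. -/
theorem kernel_conjCutoff (ψ : 𝓢(ℝ, ℂ)) (k : ℤ) (t : ℝ) :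
    kernel (conjCutoff ψ) k t = conj (kernel ψ k (-t)) := by
  rw [kernel, kernel, Real.fourierInv_eq', Real.fourierInv_eq', ← integral_conj]
  refine integral_congr_ae (Filter.Eventually.of_forall fun v => ?_)
  simp only [conjCutoff_apply, smul_eq_mul, map_mul, ← Complex.exp_conj, Complex.conj_ofReal,
    Complex.conj_I, inner_neg_right]
  push_cast
  congr 2
  ring

theorem IsCutoff.conjCutoff {ψ : 𝓢(ℝ, ℂ)} (hψ : IsCutoff ψ) : IsCutoff (conjCutoff ψ) := by
  refine ⟨fun t ht => hψ.1 ?_, fun t ht => ?_⟩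
  · rw [Function.mem_support, conjCutoff_apply] at ht
    rw [Function.mem_support]
    exact fun h => ht (by rw [h, map_zero])
  · have := (hψ.2 t ht).map (starRingEnd ℂ) Complex.continuous_conj
    simpa [Function.comp_def, conjCutoff_apply] using this

theorem IsCutoff.abs_mem {ψ : 𝓢(ℝ, ℂ)} (hψ : IsCutoff ψ) {t : ℝ} (ht : ψ t ≠ 0) :
    1 / 2 ≤ |t| ∧ |t| ≤ 5 / 2 := by
  rcases hψ.1 ht with h | h
  · rw [abs_of_pos (by linarith [h.1])]; exact h
  · rw [abs_of_neg (by linarith [h.2])]; exact ⟨by linarith [h.2], by linarith [h.1]⟩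

theorem IsCutoff.norm_le_min {ψ : 𝓢(ℝ, ℂ)} (hψ : IsCutoff ψ) :
    ∃ M : ℝ, 0 ≤ M ∧ ∀ t, ‖ψ t‖ ≤ M * min |t| |t|⁻¹ := by
  -- On the support `1/2 ≤ |t| ≤ 5/2`, so `min |t| |t|⁻¹ ≥ 2/5`.
  refine ⟨5 / 2 * SchwartzMap.seminorm ℝ 0 0 ψ, by positivity, fun t => ?_⟩
  have hN := ψ.norm_le_seminorm ℝ t
  by_cases h0 : ψ t = 0
  · rw [h0, norm_zero]; positivity
  · obtain ⟨h1, h2⟩ := hψ.abs_mem h0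
    have h3 : 2 / 5 ≤ min |t| |t|⁻¹ := by
      refine le_min (by linarith) ?_
      rw [le_inv_comm₀ (by norm_num) (by linarith)]
      norm_num; exact h2
    have := mul_le_mul_of_nonneg_left h3
      (show 0 ≤ 5 / 2 * SchwartzMap.seminorm ℝ 0 0 ψ by positivity)
    linarith

theorem IsCutoff.exists_tsum_enorm_le {ψ : 𝓢(ℝ, ℂ)} (hψ : IsCutoff ψ) :
    ∃ A : ℝ≥0, ∀ t : ℝ, ∑' k : ℤ, ‖dilate ψ k t‖ₑ ≤ A := by
  obtain ⟨A, hA⟩ := exists_tsum_min_le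
  obtain ⟨M, hM0, hM⟩ := hψ.norm_le_min
  refine ⟨M.toNNReal * A, fun t => ?_⟩
  by_cases ht : t = 0
  · subst ht
    have : ψ 0 = 0 := by
      by_contra h
      have := (hψ.abs_mem h).1
      norm_num at this
    simp [dilate_apply, this]
  · have h1 : ∀ k : ℤ, ‖dilate ψ k t‖ₑ ≤
        M.toNNReal * ENNReal.ofReal (min ((2 : ℝ) ^ (-k) * |t|) ((2 : ℝ) ^ (-k) * |t|)⁻¹) :=
      fun k => by
        rw [dilate_apply, ← ofReal_norm]
        change _ ≤ ENNReal.ofReal M * _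
        rw [← ENNReal.ofReal_mul hM0]
        refine ENNReal.ofReal_le_ofReal ((hM _).trans (le_of_eq ?_))
        rw [abs_mul, abs_of_pos (show (0 : ℝ) < (2 : ℝ) ^ (-k) by positivity)]
    refine (ENNReal.tsum_le_tsum h1).trans ?_
    rw [ENNReal.tsum_mul_left, ENNReal.coe_mul]
    gcongr
    have h2 := (Equiv.neg ℤ).tsum_eq
      (fun k : ℤ => ENNReal.ofReal (min ((2 : ℝ) ^ k * |t|) ((2 : ℝ) ^ k * |t|)⁻¹))
    simp only [Equiv.neg_apply] at h2
    rw [h2]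
    exact hA _ (abs_pos.2 ht)

/-- The quantity controlled by Hörmander's condition, for a scalar kernel. -/
def shiftDefect (κ : ℝ → ℂ) (y : ℝ) : ℝ≥0∞ :=
  ∫⁻ x in {x : ℝ | 2 * |y| ≤ |x|}, ‖κ (x - y) - κ x‖ₑ

theorem measurableSet_le_abs (a : ℝ) : MeasurableSet {x : ℝ | a ≤ |x|} :=
  measurableSet_le measurable_const measurable_id.norm

/-- The bound for small `y`: by the fundamental theorem of calculus the difference is `-y` times the
mean of `κ'` over the segment, and integration in `x` is translation invariant. -/
theorem shiftDefect_le_deriv (κ : 𝓢(ℝ, ℂ)) (y : ℝ) :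
    shiftDefect κ y ≤ ENNReal.ofReal |y| * ∫⁻ x, ‖deriv κ x‖ₑ := by
  have hd : Continuous (deriv κ) := (SchwartzMap.derivCLM ℂ ℂ κ).continuous
  have h1 : ∀ x, ‖κ (x - y) - κ x‖ₑ ≤
      ENNReal.ofReal |y| * ∫⁻ t in Ioc (0 : ℝ) 1, ‖deriv κ (x - t * y)‖ₑ := fun x => by
    have h2 : ∀ t ∈ uIcc (0 : ℝ) 1, HasDerivAt (fun t : ℝ => κ (x - t * y))
        ((-y) • deriv κ (x - t * y)) t := fun t _ => by
      have h3 : HasDerivAt (fun t : ℝ => x - t * y) (-y) t := by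
        simpa using ((hasDerivAt_id t).mul_const y).const_sub x
      exact (κ.hasDerivAt (x - t * y)).scomp t h3
    have hc : Continuous fun t : ℝ => (-y) • deriv κ (x - t * y) := by fun_prop
    have h4 := intervalIntegral.integral_eq_sub_of_hasDerivAt h2 (hc.intervalIntegrable 0 1)
    simp only [one_mul, zero_mul, sub_zero] at h4
    rw [← h4, intervalIntegral.integral_of_le zero_le_one]
    refine (enorm_integral_le_lintegral_enorm _).trans (le_of_eq ?_)
    rw [← lintegral_const_mul' _ _ ENNReal.ofReal_ne_top]
    refine lintegral_congr fun t => ?_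
    rw [enorm_smul, enorm_neg, Real.enorm_eq_ofReal_abs]
  calc shiftDefect κ y ≤ ∫⁻ x, ‖κ (x - y) - κ x‖ₑ := setLIntegral_le_lintegral _ _
    _ ≤ ∫⁻ x, ENNReal.ofReal |y| * ∫⁻ t in Ioc (0 : ℝ) 1, ‖deriv κ (x - t * y)‖ₑ :=
        lintegral_mono h1
    _ = ENNReal.ofReal |y| * ∫⁻ t in Ioc (0 : ℝ) 1, ∫⁻ x, ‖deriv κ (x - t * y)‖ₑ := by
        rw [lintegral_const_mul' _ _ ENNReal.ofReal_ne_top, lintegral_lintegral_swap]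
        have : Continuous (Function.uncurry fun (x t : ℝ) => ‖deriv κ (x - t * y)‖ₑ) := by
          unfold Function.uncurry; fun_prop
        exact this.measurable.aemeasurable
    _ = ENNReal.ofReal |y| * ∫⁻ x, ‖deriv κ x‖ₑ := by
        simp only [lintegral_sub_right_eq_self (fun x => ‖deriv κ x‖ₑ)]
        simp

/-- The bound for large `y`: where `|x| ≥ 2 |y|`, both `x` and `x - y` have modulus at least `|y|`,
so each term is a tail of `κ`, controlled by its first moment. -/
theorem mul_shiftDefect_le (κ : 𝓢(ℝ, ℂ)) (y : ℝ) :
    ENNReal.ofReal |y| * shiftDefect κ y ≤ 2 * ∫⁻ x, ‖x‖ₑ * ‖κ x‖ₑ := by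
  have hκ : Continuous κ := κ.continuous
  have hm : Measurable fun x => ‖κ x‖ₑ := hκ.enorm.measurable
  have hA : shiftDefect κ y ≤ 2 * ∫⁻ x in {x : ℝ | |y| ≤ |x|}, ‖κ x‖ₑ := by
    have h1 : ∫⁻ x in {x : ℝ | 2 * |y| ≤ |x|}, ‖κ (x - y)‖ₑ ≤
        ∫⁻ x in {x : ℝ | |y| ≤ |x|}, ‖κ x‖ₑ := by
      rw [← lintegral_indicator (measurableSet_le_abs _),
        ← lintegral_indicator (measurableSet_le_abs _),
        ← lintegral_sub_right_eq_self ({x : ℝ | |y| ≤ |x|}.indicator fun x => ‖κ x‖ₑ) y]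
      refine lintegral_mono fun x => ?_
      by_cases hx : 2 * |y| ≤ |x|
      · have hx' : |y| ≤ |x - y| := by
          have := abs_sub_abs_le_abs_sub x y
          linarith
        rw [indicator_of_mem (show x ∈ {x : ℝ | 2 * |y| ≤ |x|} from hx),
          indicator_of_mem (show x - y ∈ {x : ℝ | |y| ≤ |x|} from hx')]
      · rw [indicator_of_notMem (show x ∉ {x : ℝ | 2 * |y| ≤ |x|} from hx)]
        exact zero_le
    have h2 : ∫⁻ x in {x : ℝ | 2 * |y| ≤ |x|}, ‖κ x‖ₑ ≤ ∫⁻ x in {x : ℝ | |y| ≤ |x|}, ‖κ x‖ₑ := by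
      refine lintegral_mono_set fun x (hx : 2 * |y| ≤ |x|) => ?_
      have := abs_nonneg y
      change |y| ≤ |x|
      linarith
    calc shiftDefect κ y ≤ ∫⁻ x in {x : ℝ | 2 * |y| ≤ |x|}, (‖κ (x - y)‖ₑ + ‖κ x‖ₑ) :=
          lintegral_mono fun x => enorm_sub_le
      _ ≤ _ := by
          rw [lintegral_add_right _ hm, two_mul (lintegral _ _)]
          exact add_le_add h1 h2
  calc ENNReal.ofReal |y| * shiftDefect κ y
      ≤ ENNReal.ofReal |y| * (2 * ∫⁻ x in {x : ℝ | |y| ≤ |x|}, ‖κ x‖ₑ) := by gcongr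
    _ = 2 * ∫⁻ x in {x : ℝ | |y| ≤ |x|}, ENNReal.ofReal |y| * ‖κ x‖ₑ := by
        rw [lintegral_const_mul _ hm]; ring
    _ ≤ 2 * ∫⁻ x in {x : ℝ | |y| ≤ |x|}, ‖x‖ₑ * ‖κ x‖ₑ := by
        refine mul_le_mul_right (setLIntegral_mono (measurable_enorm.mul hm) fun x hx => ?_) _
        refine mul_le_mul_left ?_ _
        rw [Real.enorm_eq_ofReal_abs]
        exact ENNReal.ofReal_le_ofReal hx
    _ ≤ _ := mul_le_mul_right (setLIntegral_le_lintegral _ _) _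

theorem exists_shiftDefect_le (κ : 𝓢(ℝ, ℂ)) : ∃ M : ℝ≥0, ∀ y : ℝ, y ≠ 0 →
    shiftDefect κ y ≤ M * ENNReal.ofReal (min |y| |y|⁻¹) := by
  have hf1 : ∫⁻ x, ‖deriv κ x‖ₑ ≠ ∞ := (SchwartzMap.derivCLM ℂ ℂ κ).integrable.2.ne
  have hf2 : 2 * ∫⁻ x, ‖x‖ₑ * ‖κ x‖ₑ ≠ ∞ := by
    have := (κ.integrable_pow_mul volume 1).2.ne
    simp only [pow_one, enorm_mul, enorm_norm] at this
    exact ENNReal.mul_ne_top (by simp) this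
  refine ⟨max (∫⁻ x, ‖deriv κ x‖ₑ).toNNReal (2 * ∫⁻ x, ‖x‖ₑ * ‖κ x‖ₑ).toNNReal, fun y hy => ?_⟩
  have hy' : 0 < |y| := abs_pos.2 hy
  rw [ENNReal.coe_max, ENNReal.coe_toNNReal hf1, ENNReal.coe_toNNReal hf2]
  rcases min_choice |y| |y|⁻¹ with h | h
  · rw [h]
    refine (shiftDefect_le_deriv κ y).trans ?_
    rw [mul_comm]; gcongr; exact le_max_left _ _
  · rw [h, ENNReal.ofReal_inv_of_pos hy', ← div_eq_mul_inv,
      ENNReal.le_div_iff_mul_le (Or.inl (by simpa using hy)) (Or.inl ENNReal.ofReal_ne_top), mul_comm]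
    exact (mul_shiftDefect_le κ y).trans (le_max_right _ _)

theorem lintegral_comp_mul_left_of_pos {φ : ℝ → ℝ≥0∞} (hφ : Measurable φ) {a : ℝ} (ha : 0 < a) :
    ENNReal.ofReal a * ∫⁻ x, φ (a * x) = ∫⁻ x, φ x := by
  conv_rhs => rw [← Real.smul_map_volume_mul_left ha.ne']
  rw [lintegral_smul_measure, lintegral_map hφ (by fun_prop), abs_of_pos ha, smul_eq_mul]

/-- The kernels are `L¹`-normalised dilates of one function and the region `2 |y| ≤ |x|` is dilation
invariant, so the sum over `k` becomes a sum over dyadic multiples of `y`. -/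
theorem shiftDefect_kernel (ψ : 𝓢(ℝ, ℂ)) (k : ℤ) (y : ℝ) :
    shiftDefect (kernel ψ k) y = shiftDefect (kernelS ψ 0) ((2 : ℝ) ^ k * y) := by
  have h2 : (0 : ℝ) < 2 ^ k := by positivity
  have hc := (kernelS ψ 0).continuous
  have hm : Measurable ({x : ℝ | 2 * |(2 : ℝ) ^ k * y| ≤ |x|}.indicator
      fun x => ‖kernelS ψ 0 (x - 2 ^ k * y) - kernelS ψ 0 x‖ₑ) :=
    Measurable.indicator (by fun_prop) (measurableSet_le_abs _)
  rw [shiftDefect, shiftDefect, ← lintegral_indicator (measurableSet_le_abs _),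
    ← lintegral_indicator (measurableSet_le_abs _), ← lintegral_comp_mul_left_of_pos hm h2,
    ← lintegral_const_mul' _ _ ENNReal.ofReal_ne_top]
  refine lintegral_congr fun x => ?_
  have hiff : 2 * |(2 : ℝ) ^ k * y| ≤ |2 ^ k * x| ↔ 2 * |y| ≤ |x| := by
    rw [abs_mul, abs_mul, abs_of_pos h2, mul_left_comm]
    exact mul_le_mul_iff_right₀ h2
  simp only [indicator, mem_ofPred_eq, hiff]
  split_ifs
  · rw [kernel_scaling, kernel_scaling, ← mul_sub, enorm_mul, mul_sub]
    congr 1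
    rw [← ofReal_norm, norm_zpow, Complex.norm_real, Real.norm_ofNat]
  · simp

theorem exists_tsum_shiftDefect_le (ψ : 𝓢(ℝ, ℂ)) : ∃ B : ℝ≥0, ∀ y : ℝ,
    ∑' k : ℤ, shiftDefect (kernel ψ k) y ≤ B := by
  obtain ⟨A, hA⟩ := exists_tsum_min_le
  obtain ⟨M, hM⟩ := exists_shiftDefect_le (kernelS ψ 0)
  refine ⟨M * A, fun y => ?_⟩
  by_cases hy : y = 0
  · simp [hy, shiftDefect]
  · have h1 : ∀ k : ℤ, shiftDefect (kernel ψ k) y ≤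
        M * ENNReal.ofReal (min ((2 : ℝ) ^ k * |y|) ((2 : ℝ) ^ k * |y|)⁻¹) := fun k => by
      have h2 : (0 : ℝ) < 2 ^ k := by positivity
      rw [shiftDefect_kernel]
      have := hM ((2 : ℝ) ^ k * y) (mul_ne_zero h2.ne' hy)
      rwa [abs_mul, abs_of_pos h2] at this
    refine (ENNReal.tsum_le_tsum h1).trans ?_
    rw [ENNReal.tsum_mul_left, ENNReal.coe_mul]
    gcongr
    exact hA _ (abs_pos.2 hy)

/-! ### Finite families of projections as one vector valued kernel. -/

section VectorKernel

variable {ι : Type} [Fintype ι]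

/-- The kernel of `f ↦ (P_{e i} f)_i`. -/
def vecKernel (ψ : 𝓢(ℝ, ℂ)) (e : ι → ℤ) (t : ℝ) : ℂ →L[ℂ] EuclideanSpace ℂ ι :=
  ContinuousLinearMap.toSpanSingleton ℂ (WithLp.toLp 2 fun i => kernel ψ (e i) t)

theorem enorm_sq_euclideanSpace (v : EuclideanSpace ℂ ι) : ‖v‖ₑ ^ 2 = ∑ i, ‖v i‖ₑ ^ 2 := by
  simp only [← ofReal_norm]
  rw [← ENNReal.ofReal_pow (norm_nonneg _), EuclideanSpace.norm_sq_eq,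
    ENNReal.ofReal_sum_of_nonneg fun i _ => by positivity]
  exact Finset.sum_congr rfl fun i _ => ENNReal.ofReal_pow (norm_nonneg _) 2

theorem norm_euclideanSpace_le_sum (v : EuclideanSpace ℂ ι) : ‖v‖ ≤ ∑ i, ‖v i‖ := by
  refine le_of_sq_le_sq ?_ (by positivity)
  rw [EuclideanSpace.norm_sq_eq, sq (∑ i, ‖v i‖), Finset.sum_mul]
  refine Finset.sum_le_sum fun i _ => ?_
  rw [sq]
  exact mul_le_mul_of_nonneg_left
    (Finset.single_le_sum (f := fun i => ‖v i‖) (fun i _ => norm_nonneg _) (Finset.mem_univ i))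
    (norm_nonneg _)

theorem enorm_euclideanSpace_le_sum (v : EuclideanSpace ℂ ι) : ‖v‖ₑ ≤ ∑ i, ‖v i‖ₑ := by
  simp only [← ofReal_norm]
  rw [← ENNReal.ofReal_sum_of_nonneg fun i _ => norm_nonneg _]
  exact ENNReal.ofReal_le_ofReal (norm_euclideanSpace_le_sum v)

theorem norm_vecKernel_le (ψ : 𝓢(ℝ, ℂ)) (e : ι → ℤ) (t : ℝ) :
    ‖vecKernel ψ e t‖ ≤ ∑ i, ‖kernel ψ (e i) t‖ := by
  rw [vecKernel, ContinuousLinearMap.norm_toSpanSingleton]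
  exact norm_euclideanSpace_le_sum _

theorem niceKernel_vecKernel (ψ : 𝓢(ℝ, ℂ)) (e : ι → ℤ) : NiceKernel (vecKernel ψ e) := by
  have hc : Continuous (vecKernel ψ e) := by
    have h1 : Continuous fun t : ℝ => (WithLp.toLp 2 fun i => kernel ψ (e i) t :
        EuclideanSpace ℂ ι) :=
      (PiLp.continuous_toLp 2 _).comp (continuous_pi fun i => continuous_kernel ψ (e i))
    exact (ContinuousLinearMap.toSpanSingletonCLE (𝕜 := ℂ) (E := EuclideanSpace ℂ ι)).continuous.comp
      h1
  refine ⟨hc, ?_, ?_⟩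
  · exact (integrable_finsetSum _ fun i _ => (integrable_kernel ψ (e i)).norm).mono'
      hc.aestronglyMeasurable (Filter.Eventually.of_forall fun t => norm_vecKernel_le ψ e t)
  · refine ⟨∑ i, SchwartzMap.seminorm ℝ 0 0 (kernelS ψ (e i)), fun t =>
      (norm_vecKernel_le ψ e t).trans (Finset.sum_le_sum fun i _ => ?_)⟩
    rw [← coe_kernelS]
    exact (kernelS ψ (e i)).norm_le_seminorm ℝ t

/-- The Euclidean norm is at most the sum of the components, and injectivity of `e` bounds that by
the sum over all `k`. Hence `B` is the same for every finite family. -/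
theorem hormander_vecKernel (ψ : 𝓢(ℝ, ℂ)) : ∃ B : ℝ≥0, ∀ (ι : Type) [Fintype ι] (e : ι → ℤ),
    Function.Injective e → Hormander (vecKernel ψ e) B := by
  obtain ⟨B, hB⟩ := exists_tsum_shiftDefect_le ψ
  refine ⟨B, fun ι _ e he y => ?_⟩
  calc ∫⁻ x in {x : ℝ | 2 * |y| ≤ |x|}, ‖vecKernel ψ e (x - y) - vecKernel ψ e x‖ₑ
      ≤ ∫⁻ x in {x : ℝ | 2 * |y| ≤ |x|}, ∑ i, ‖kernel ψ (e i) (x - y) - kernel ψ (e i) x‖ₑ := by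
        refine lintegral_mono fun x => ?_
        have h1 : vecKernel ψ e (x - y) - vecKernel ψ e x =
            ContinuousLinearMap.toSpanSingleton ℂ (WithLp.toLp 2 fun i =>
              kernel ψ (e i) (x - y) - kernel ψ (e i) x : EuclideanSpace ℂ ι) := by
          ext z; simp [vecKernel]
        rw [h1, ← ofReal_norm, ContinuousLinearMap.norm_toSpanSingleton, ofReal_norm]
        exact enorm_euclideanSpace_le_sum _
    _ = ∑ i, shiftDefect (kernel ψ (e i)) y := by
        refine lintegral_finsetSum _ fun i _ => ?_
        have := continuous_kernel ψ (e i)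
        fun_prop
    _ = ∑' i, shiftDefect (kernel ψ (e i)) y := (tsum_fintype _).symm
    _ ≤ ∑' k : ℤ, shiftDefect (kernel ψ k) y :=
        ENNReal.tsum_comp_le_tsum_of_injective he fun k => shiftDefect (kernel ψ k) y
    _ ≤ B := hB y

theorem convOp_vecKernel_apply (ψ : 𝓢(ℝ, ℂ)) (e : ι → ℤ) {f : ℝ → ℂ} (hf : BddIntegrable f)
    (x : ℝ) (i : ι) : convOp (vecKernel ψ e) f x i = proj ψ (e i) f x := by
  have h := (EuclideanSpace.proj i : EuclideanSpace ℂ ι →L[ℂ] ℂ).integral_comp_comm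
    ((niceKernel_vecKernel ψ e).integrable_integrand hf x)
  rw [convOp, proj]
  refine Eq.trans h.symm ?_
  simp [vecKernel]

theorem enorm_convOp_vecKernel_sq (ψ : 𝓢(ℝ, ℂ)) (e : ι → ℤ) {f : ℝ → ℂ} (hf : BddIntegrable f)
    (x : ℝ) : ‖convOp (vecKernel ψ e) f x‖ₑ ^ 2 = ∑ i, ‖proj ψ (e i) f x‖ₑ ^ 2 := by
  rw [enorm_sq_euclideanSpace]
  exact Finset.sum_congr rfl fun i _ => by rw [convOp_vecKernel_apply ψ e hf]

end VectorKernel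

/-! ### Projections of `L^p` functions and approximation by Schwartz functions. -/

theorem memLp_kernel_sub (ψ : 𝓢(ℝ, ℂ)) (k : ℤ) (y : ℝ) (q : ℝ≥0∞) :
    MemLp (fun z => kernel ψ k (y - z)) q :=
  (memLp_kernel ψ k q).comp_measurePreserving (Measure.measurePreserving_sub_left volume y)

theorem integrable_mul_kernel (ψ : 𝓢(ℝ, ℂ)) (k : ℤ) {p : ℝ≥0∞} (hp : 1 ≤ p) {f : ℝ → ℂ}
    (hf : MemLp f p) (y : ℝ) : Integrable fun z => f z * kernel ψ k (y - z) := by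
  have := ENNReal.HolderConjugate.conjExponent hp
  exact hf.integrable_mul (memLp_kernel_sub ψ k y (ENNReal.conjExponent p))

theorem proj_sub (ψ : 𝓢(ℝ, ℂ)) (k : ℤ) {p : ℝ≥0∞} (hp : 1 ≤ p) {f g : ℝ → ℂ}
    (hf : MemLp f p) (hg : MemLp g p) (y : ℝ) :
    proj ψ k (fun z => f z - g z) y = proj ψ k f y - proj ψ k g y := by
  simp only [proj, sub_mul]
  exact integral_sub (integrable_mul_kernel ψ k hp hf y) (integrable_mul_kernel ψ k hp hg y)

/-- Hölder, uniformly in `y`. Consequently `L^p` convergence implies convergence of the projections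
at every point, which is what Fatou's lemma needs. -/
theorem enorm_proj_le (ψ : 𝓢(ℝ, ℂ)) (k : ℤ) {p : ℝ≥0∞} (hp : 1 ≤ p) {f : ℝ → ℂ}
    (hf : MemLp f p) (y : ℝ) :
    ‖proj ψ k f y‖ₑ ≤ eLpNorm f p volume * eLpNorm (kernel ψ k) (ENNReal.conjExponent p) volume := by
  have := ENNReal.HolderConjugate.conjExponent hp
  have hK := memLp_kernel_sub ψ k y (ENNReal.conjExponent p)
  have e : eLpNorm (fun z => kernel ψ k (y - z)) (ENNReal.conjExponent p) volume =
      eLpNorm (kernel ψ k) (ENNReal.conjExponent p) volume :=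
    eLpNorm_comp_measurePreserving (continuous_kernel ψ k).aestronglyMeasurable
      (Measure.measurePreserving_sub_left volume y)
  have h1 := eLpNorm_smul_le_mul_eLpNorm (r := 1) (p := p) (q := ENNReal.conjExponent p)
    hK.1 hf.1
  rw [e, eLpNorm_one_eq_lintegral_enorm] at h1
  rw [proj]
  exact (enorm_integral_le_lintegral_enorm _).trans h1

theorem tendsto_proj (ψ : 𝓢(ℝ, ℂ)) (k : ℤ) {p : ℝ≥0∞} (hp : 1 ≤ p) {f : ℝ → ℂ}
    (hf : MemLp f p) {h : ℕ → 𝓢(ℝ, ℂ)}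
    (hh : Filter.Tendsto (fun n => eLpNorm (fun x => h n x - f x) p volume) Filter.atTop (nhds 0))
    (y : ℝ) : Filter.Tendsto (fun n => proj ψ k (h n) y) Filter.atTop (nhds (proj ψ k f y)) := by
  have hC : eLpNorm (kernel ψ k) (ENNReal.conjExponent p) volume ≠ ∞ := (memLp_kernel ψ k _).2.ne
  rw [tendsto_iff_edist_tendsto_0]
  have h1 := ENNReal.Tendsto.mul_const (b := eLpNorm (kernel ψ k) (ENNReal.conjExponent p) volume)
    hh (Or.inr hC)
  rw [zero_mul] at h1
  refine tendsto_of_tendsto_of_tendsto_of_le_of_le tendsto_const_nhds h1 (fun n => zero_le)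
    fun n => ?_
  change edist _ _ ≤ _
  rw [edist_eq_enorm_sub, ← proj_sub ψ k hp ((h n).memLp p) hf]
  exact enorm_proj_le ψ k hp (((h n).memLp p).sub hf) y

theorem lintegral_enorm_rpow_eq {α F : Type*} [MeasurableSpace α] [ENorm F] {μ : Measure α}
    {p : ℝ≥0∞} (hp : 1 ≤ p) (hp' : p ≠ ∞) (f : α → F) :
    ∫⁻ x, ‖f x‖ₑ ^ p.toReal ∂μ = eLpNorm f p μ ^ p.toReal := by
  have h0 : 0 < p.toReal := ENNReal.toReal_pos (by positivity) hp'
  rw [eLpNorm_eq_lintegral_rpow_enorm_toReal (by positivity) hp', ← ENNReal.rpow_mul,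
    one_div_mul_cancel h0.ne', ENNReal.rpow_one]

theorem exists_schwartz_tendsto {p : ℝ≥0∞} (hp : 1 ≤ p) (hp' : p ≠ ∞) {f : ℝ → ℂ}
    (hf : MemLp f p) : ∃ h : ℕ → 𝓢(ℝ, ℂ),
      Filter.Tendsto (fun n => eLpNorm (fun x => h n x - f x) p volume) Filter.atTop (nhds 0) ∧
      Filter.Tendsto (fun n => eLpNorm (h n) p volume) Filter.atTop
        (nhds (eLpNorm f p volume)) := by
  have := Fact.mk hp
  have hd := (SchwartzMap.denseRange_toLpCLM (E := ℝ) (F := ℂ) (μ := volume) hp') (hf.toLp f)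
  obtain ⟨x, hx, hlim⟩ := mem_closure_iff_seq_limit.1 hd
  choose h hh using hx
  simp only [SchwartzMap.toLpCLM_apply] at hh
  have hae : ∀ n, (x n : ℝ → ℂ) =ᵐ[volume] h n := fun n => by
    rw [← hh n]; exact (h n).coeFn_toLp p volume
  refine ⟨h, ?_, ?_⟩
  · refine (((Lp.tendsto_Lp_iff_tendsto_eLpNorm _ f hf).1 hlim)).congr fun n => ?_
    refine eLpNorm_congr_ae ?_
    filter_upwards [hae n] with y hy
    simp [hy]
  · have h1 := (continuous_enorm.tendsto _).comp hlim
    rw [Lp.enorm_def, eLpNorm_congr_ae hf.coeFn_toLp] at h1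
    refine h1.congr fun n => ?_
    simp only [Function.comp_apply]
    rw [Lp.enorm_def, eLpNorm_congr_ae (hae n)]

/-- `P_k h` as a Schwartz function, for `h` Schwartz. -/
def projS (ψ : 𝓢(ℝ, ℂ)) (k : ℤ) (h : 𝓢(ℝ, ℂ)) : 𝓢(ℝ, ℂ) :=
  SchwartzMap.convolution (ContinuousLinearMap.mul ℂ ℂ) h (kernelS ψ k)

theorem coe_projS (ψ : 𝓢(ℝ, ℂ)) (k : ℤ) (h : 𝓢(ℝ, ℂ)) : ⇑(projS ψ k h) = proj ψ k h := by
  ext y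
  rw [projS, SchwartzMap.convolution_apply, proj, coe_kernelS]
  rfl

theorem fourier_projS (ψ : 𝓢(ℝ, ℂ)) (k : ℤ) (h : 𝓢(ℝ, ℂ)) (t : ℝ) :
    𝓕 (projS ψ k h) t = 𝓕 h t * dilate ψ k t := by
  rw [projS, SchwartzMap.fourier_convolution, kernelS]
  simp

theorem lintegral_enorm_sq_fourier (h : 𝓢(ℝ, ℂ)) :
    ∫⁻ t, ‖𝓕 h t‖ₑ ^ 2 = ∫⁻ x, ‖h x‖ₑ ^ 2 := by
  have hi : ∀ f : 𝓢(ℝ, ℂ), Integrable (fun x => ‖f x‖ ^ 2) := fun f =>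
    MemLp.integrable_norm_pow (p := 2) (f.memLp _) two_ne_zero
  have key : ∀ f : 𝓢(ℝ, ℂ), ∫⁻ x, ‖f x‖ₑ ^ 2 = ENNReal.ofReal (∫ x, ‖f x‖ ^ 2) := fun f => by
    rw [ofReal_integral_eq_lintegral_ofReal (hi f)
      (Filter.Eventually.of_forall fun x => by positivity)]
    refine lintegral_congr fun x => ?_
    rw [ENNReal.ofReal_pow (norm_nonneg _), ofReal_norm]
  rw [key, key, SchwartzMap.integral_norm_sq_fourier]

theorem measurable_proj_schwartz (ψ : 𝓢(ℝ, ℂ)) (k : ℤ) (h : 𝓢(ℝ, ℂ)) :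
    Measurable (proj ψ k h) := by
  rw [← coe_projS]; exact (projS ψ k h).continuous.measurable

theorem sum_enorm_sq_le {ι : Type} [Fintype ι] {e : ι → ℤ} (he : Function.Injective e)
    {a : ℤ → ℂ} {A : ℝ≥0∞} (hA : ∑' k, ‖a k‖ₑ ≤ A) : ∑ i, ‖a (e i)‖ₑ ^ 2 ≤ A ^ 2 := by
  have h1 : ∑ i, ‖a (e i)‖ₑ ≤ A := by
    rw [← tsum_fintype (L := .unconditional ι)]
    exact (ENNReal.tsum_comp_le_tsum_of_injective he fun k => ‖a k‖ₑ).trans hA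
  calc ∑ i, ‖a (e i)‖ₑ ^ 2 ≤ ∑ i, A * ‖a (e i)‖ₑ := by
        refine Finset.sum_le_sum fun i _ => ?_
        rw [pow_two]
        gcongr
        exact (ENNReal.le_tsum (f := fun k => ‖a k‖ₑ) (e i)).trans hA
    _ ≤ A ^ 2 := by rw [← Finset.mul_sum, pow_two]; gcongr

/-- Fatou's lemma: an estimate for the square function on Schwartz functions extends to `L^p`. -/
theorem squareFunction_bound_of_schwartz (ψ : 𝓢(ℝ, ℂ)) {ι : Type} [Fintype ι] (e : ι → ℤ)
    {p : ℝ≥0∞} (hp : 1 ≤ p) (hp' : p ≠ ∞) {C : ℝ≥0}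
    (hC : ∀ h : 𝓢(ℝ, ℂ), ∫⁻ x, (∑ i, ‖proj ψ (e i) h x‖ₑ ^ 2) ^ (p.toReal / 2) ≤
      C * eLpNorm h p volume ^ p.toReal) {f : ℝ → ℂ} (hf : MemLp f p) :
    ∫⁻ x, (∑ i, ‖proj ψ (e i) f x‖ₑ ^ 2) ^ (p.toReal / 2) ≤
      C * eLpNorm f p volume ^ p.toReal := by
  obtain ⟨h, h1, h2⟩ := exists_schwartz_tendsto hp hp' hf
  have hlim : ∀ x, Filter.Tendsto (fun n => (∑ i, ‖proj ψ (e i) (h n) x‖ₑ ^ 2) ^ (p.toReal / 2))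
      Filter.atTop (nhds ((∑ i, ‖proj ψ (e i) f x‖ₑ ^ 2) ^ (p.toReal / 2))) := fun x => by
    refine (ENNReal.continuous_rpow_const.tendsto _).comp (tendsto_finsetSum _ fun i _ => ?_)
    exact ((ENNReal.continuous_pow 2).tendsto _).comp
      ((continuous_enorm.tendsto _).comp (tendsto_proj ψ (e i) hp hf h1 x))
  have hrhs : Filter.Tendsto (fun n => C * eLpNorm (h n) p volume ^ p.toReal)
      Filter.atTop (nhds (C * eLpNorm f p volume ^ p.toReal)) :=
    ENNReal.Tendsto.const_mul ((ENNReal.continuous_rpow_const.tendsto _).comp h2)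
      (Or.inr ENNReal.coe_ne_top)
  calc ∫⁻ x, (∑ i, ‖proj ψ (e i) f x‖ₑ ^ 2) ^ (p.toReal / 2)
      = ∫⁻ x, Filter.liminf (fun n => (∑ i, ‖proj ψ (e i) (h n) x‖ₑ ^ 2) ^ (p.toReal / 2))
          Filter.atTop := lintegral_congr fun x => ((hlim x).liminf_eq).symm
    _ ≤ Filter.liminf (fun n => ∫⁻ x, (∑ i, ‖proj ψ (e i) (h n) x‖ₑ ^ 2) ^ (p.toReal / 2))
          Filter.atTop := lintegral_liminf_le fun n =>
            (Finset.measurable_sum _ fun i _ =>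
              (measurable_proj_schwartz ψ (e i) (h n)).enorm.pow_const 2).pow_const _
    _ ≤ Filter.liminf (fun n => C * eLpNorm (h n) p volume ^ p.toReal) Filter.atTop :=
        Filter.liminf_le_liminf (Filter.Eventually.of_forall fun n => hC (h n))
    _ = _ := hrhs.liminf_eq

theorem BddIntegrable.memLp {f : ℝ → ℂ} (hf : BddIntegrable f) {p : ℝ≥0∞} (hp : 1 ≤ p)
    (hp' : p ≠ ∞) : MemLp f p := by
  refine ⟨hf.sm.aestronglyMeasurable, ?_⟩
  have h0 : 1 ≤ p.toReal := by
    rw [← ENNReal.toReal_one]; exact ENNReal.toReal_mono hp' hp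
  rw [eLpNorm_lt_top_iff_lintegral_rpow_enorm_lt_top (by positivity) hp']
  exact (hf.lintegral_rpow_ne_top h0).lt_top

/-! ### The upper Littlewood-Paley inequality on the line. -/

/-- By Plancherel the square function has the multiplier `∑ |ψ_k|²`, which is at most `(∑ |ψ_k|)² ≤
A²`. The computation is done for Schwartz functions and extended by Fatou. -/
theorem IsCutoff.l2Bound_vecKernel {ψ : 𝓢(ℝ, ℂ)} (hψ : IsCutoff ψ) :
    ∃ A : ℝ≥0, ∀ (ι : Type) [Fintype ι] (e : ι → ℤ), Function.Injective e →
      L2Bound (vecKernel ψ e) A := by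
  obtain ⟨A, hA⟩ := hψ.exists_tsum_enorm_le
  refine ⟨A ^ 2, fun ι _ e he f hf => ?_⟩
  have key : ∀ h : 𝓢(ℝ, ℂ), ∫⁻ x, ∑ i, ‖proj ψ (e i) h x‖ₑ ^ 2 ≤
      (A ^ 2 : ℝ≥0) * ∫⁻ x, ‖h x‖ₑ ^ 2 := fun h => by
    have hmF : Measurable fun t => ‖𝓕 h t‖ₑ ^ 2 := ((𝓕 h).continuous.enorm.measurable).pow_const 2
    calc ∫⁻ x, ∑ i, ‖proj ψ (e i) h x‖ₑ ^ 2
        = ∑ i, ∫⁻ x, ‖proj ψ (e i) h x‖ₑ ^ 2 := lintegral_finsetSum _ fun i _ =>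
          (measurable_proj_schwartz ψ (e i) h).enorm.pow_const 2
      _ = ∑ i, ∫⁻ t, ‖𝓕 h t‖ₑ ^ 2 * ‖dilate ψ (e i) t‖ₑ ^ 2 := by
          refine Finset.sum_congr rfl fun i _ => ?_
          rw [← coe_projS, ← lintegral_enorm_sq_fourier]
          refine lintegral_congr fun t => ?_
          rw [fourier_projS, enorm_mul, mul_pow]
      _ = ∫⁻ t, ‖𝓕 h t‖ₑ ^ 2 * ∑ i, ‖dilate ψ (e i) t‖ₑ ^ 2 := by
          simp only [Finset.mul_sum]
          exact (lintegral_finsetSum _ fun i _ => hmF.mul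
            ((dilate ψ (e i)).continuous.enorm.measurable.pow_const 2)).symm
      _ ≤ ∫⁻ t, ‖𝓕 h t‖ₑ ^ 2 * (A ^ 2 : ℝ≥0) := by
          gcongr with t
          push_cast
          exact sum_enorm_sq_le he (a := fun k => dilate ψ k t) (hA t)
      _ = _ := by rw [lintegral_mul_const _ hmF, lintegral_enorm_sq_fourier, mul_comm]
  have := squareFunction_bound_of_schwartz ψ e (p := 2) one_le_two (by simp) (C := A ^ 2)
    (fun h => by
      rw [← lintegral_enorm_rpow_eq one_le_two (by simp)]
      simpa using key h) (hf.memLp one_le_two (by simp))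
  rw [← lintegral_enorm_rpow_eq one_le_two (by simp)] at this
  simp only [enorm_convOp_vecKernel_sq ψ e hf]
  simpa using this

/-- The upper Littlewood-Paley bound for finitely many projections, together with the dual bound. -/
theorem IsCutoff.exists_bounds {ψ : 𝓢(ℝ, ℂ)} (hψ : IsCutoff ψ) {p : ℝ} (hp : 1 < p) :
    ∃ C : ℝ≥0, ∀ (ι : Type) [Fintype ι] (e : ι → ℤ), Function.Injective e →
      LpBound (vecKernel ψ e) p C ∧ LpBound (adjKernel (vecKernel ψ e)) p C := by
  obtain ⟨A, hA⟩ := hψ.l2Bound_vecKernel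
  obtain ⟨B, hB⟩ := hormander_vecKernel ψ
  obtain ⟨C, hC⟩ := exists_lpBound A B hp
  exact ⟨C, fun ι _ e he => hC _ _ _ (niceKernel_vecKernel ψ e) (hA ι e he) (hB ι e he)⟩

theorem measurable_proj (ψ : 𝓢(ℝ, ℂ)) (k : ℤ) {p : ℝ≥0∞} (hp : 1 ≤ p) (hp' : p ≠ ∞)
    {f : ℝ → ℂ} (hf : MemLp f p) : Measurable (proj ψ k f) := by
  obtain ⟨h, h1, -⟩ := exists_schwartz_tendsto hp hp' hf
  exact measurable_of_tendsto_metrizable (fun n => measurable_proj_schwartz ψ k (h n))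
    (tendsto_pi_nhds.2 fun y => tendsto_proj ψ k hp hf h1 y)

theorem measurable_tsum_proj (ψ : 𝓢(ℝ, ℂ)) {p : ℝ≥0∞} (hp : 1 ≤ p) (hp' : p ≠ ∞)
    {f : ℝ → ℂ} (hf : MemLp f p) : Measurable fun y => ∑' k : ℤ, ‖proj ψ k f y‖ₑ ^ 2 :=
  Measurable.tsum fun k => (measurable_proj ψ k hp hp' hf).enorm.pow_const 2

/-- The upper Littlewood-Paley estimate on the line. -/
theorem IsCutoff.exists_lintegral_tsum_le {ψ : 𝓢(ℝ, ℂ)} (hψ : IsCutoff ψ) {p : ℝ≥0∞}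
    (hp : 1 < p) (hp' : p ≠ ∞) : ∃ C : ℝ≥0, ∀ f : ℝ → ℂ, MemLp f p →
      ∫⁻ y, (∑' k : ℤ, ‖proj ψ k f y‖ₑ ^ 2) ^ (p.toReal / 2) ≤
        C * ∫⁻ y, ‖f y‖ₑ ^ p.toReal := by
  have hP : 1 < p.toReal := by
    rw [← ENNReal.toReal_one]; exact (ENNReal.toReal_lt_toReal ENNReal.one_ne_top hp').2 hp
  obtain ⟨C, hC⟩ := hψ.exists_bounds hP
  refine ⟨C, fun f hf => ?_⟩
  -- The constant is the same for all finite sets of indices, so Fatou along an exhaustion of `ℤ`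
  -- gives the full square function.
  obtain ⟨s, hs⟩ := Filter.exists_seq_tendsto (Filter.atTop : Filter (Finset ℤ))
  have hfin : ∀ n, ∫⁻ y, (∑ k ∈ s n, ‖proj ψ k f y‖ₑ ^ 2) ^ (p.toReal / 2) ≤
      C * ∫⁻ y, ‖f y‖ₑ ^ p.toReal := fun n => by
    rw [lintegral_enorm_rpow_eq hp.le hp']
    have := squareFunction_bound_of_schwartz ψ (Subtype.val : s n → ℤ) hp.le hp' (C := C)
      (fun h => by
        rw [← lintegral_enorm_rpow_eq hp.le hp']
        refine le_trans (le_of_eq (lintegral_congr fun x => ?_))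
          ((hC (s n) _ Subtype.val_injective).1 h (bddIntegrable_coe h))
        rw [← enorm_convOp_vecKernel_sq ψ _ (bddIntegrable_coe h), ← ENNReal.rpow_natCast,
          ← ENNReal.rpow_mul]
        congr 1; push_cast; ring) hf
    refine le_trans (le_of_eq (lintegral_congr fun x => ?_)) this
    rw [← Finset.sum_coe_sort (s n) fun k => ‖proj ψ k f x‖ₑ ^ 2]
  have hlim : ∀ y, Filter.Tendsto (fun n => (∑ k ∈ s n, ‖proj ψ k f y‖ₑ ^ 2) ^ (p.toReal / 2))
      Filter.atTop (nhds ((∑' k : ℤ, ‖proj ψ k f y‖ₑ ^ 2) ^ (p.toReal / 2))) := fun y =>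
    (ENNReal.continuous_rpow_const.tendsto _).comp (ENNReal.summable.hasSum.comp hs)
  calc ∫⁻ y, (∑' k : ℤ, ‖proj ψ k f y‖ₑ ^ 2) ^ (p.toReal / 2)
      = ∫⁻ y, Filter.liminf (fun n => (∑ k ∈ s n, ‖proj ψ k f y‖ₑ ^ 2) ^ (p.toReal / 2))
          Filter.atTop := lintegral_congr fun y => (hlim y).liminf_eq.symm
    _ ≤ Filter.liminf (fun n => ∫⁻ y, (∑ k ∈ s n, ‖proj ψ k f y‖ₑ ^ 2) ^ (p.toReal / 2))
          Filter.atTop := lintegral_liminf_le fun n =>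
            (Finset.measurable_sum _ fun k _ =>
              (measurable_proj ψ k hp.le hp' hf).enorm.pow_const 2).pow_const _
    _ ≤ _ := Filter.liminf_le_of_le (by isBoundedDefault) fun b hb => by
        obtain ⟨n, hn⟩ := hb.exists
        exact hn.trans (hfin n)

/-! ### The lower Littlewood-Paley inequality on the line. -/

/-- Arguments in the support differ in modulus by a factor of at most `5 < 2³`, so two dilates meet
only if their indices differ by at most two. -/
theorem IsCutoff.dilate_mul_dilate {ψ : 𝓢(ℝ, ℂ)} (hψ : IsCutoff ψ) {j k : ℤ} (t : ℝ)
    (hjk : j ∉ Finset.Icc (k - 2) (k + 2)) : dilate ψ j t * dilate ψ k t = 0 := by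
  have key : ∀ {a b : ℤ}, a + 2 < b → ψ ((2 : ℝ) ^ (-a) * t) ≠ 0 → ψ ((2 : ℝ) ^ (-b) * t) = 0 := by
    intro a b hab ha
    by_contra hb
    have h1 := (hψ.abs_mem ha).2
    have h2 := (hψ.abs_mem hb).1
    have h3 : (2 : ℝ) ^ (-a) * t = (2 : ℝ) ^ (b - a) * ((2 : ℝ) ^ (-b) * t) := by
      rw [← mul_assoc, ← zpow_add₀ two_ne_zero]; congr 2; ring
    have h4 : (8 : ℝ) ≤ (2 : ℝ) ^ (b - a) := by
      calc (8 : ℝ) = (2 : ℝ) ^ (3 : ℤ) := by norm_num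
        _ ≤ _ := zpow_le_zpow_right₀ one_le_two (by omega)
    rw [h3, abs_mul, abs_of_pos (by positivity)] at h1
    nlinarith
  rw [dilate_apply, dilate_apply]
  by_contra h
  obtain ⟨h1, h2⟩ := mul_ne_zero_iff.1 h
  simp only [Finset.mem_Icc, not_and_or, not_le] at hjk
  rcases hjk with hjk | hjk
  · exact h2 (key (by omega) h1)
  · exact h1 (key (by omega) h2)

theorem IsCutoff.dilate_zero {ψ : 𝓢(ℝ, ℂ)} (hψ : IsCutoff ψ) (k : ℤ) : dilate ψ k 0 = 0 := by
  rw [dilate_apply, mul_zero]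
  by_contra h
  have := (hψ.abs_mem h).1
  norm_num at this

theorem IsCutoff.sum_dilate_mul {ψ : 𝓢(ℝ, ℂ)} (hψ : IsCutoff ψ) (k : ℤ) (t : ℝ) :
    ∑ m ∈ Finset.Icc (-2 : ℤ) 2, dilate ψ (k + m) t * dilate ψ k t = dilate ψ k t := by
  rcases eq_or_ne t 0 with rfl | ht
  · simp [hψ.dilate_zero]
  have h1 : HasSum (fun j : ℤ => dilate ψ j t * dilate ψ k t) (1 * dilate ψ k t) := by
    simp only [dilate_apply]
    exact (hψ.2 t ht).mul_right _
  have h2 := h1.unique (hasSum_sum_of_ne_finset_zero fun j hj => hψ.dilate_mul_dilate t hj)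
  rw [one_mul] at h2
  conv_rhs => rw [h2]
  refine Finset.sum_bij (fun m _ => k + m) ?_ ?_ ?_ ?_
  · intro m hm; simp only [Finset.mem_Icc] at hm ⊢; omega
  · intro m _ m' _ h; simpa using h
  · intro j hj
    simp only [Finset.mem_Icc] at hj
    exact ⟨j - k, by simp only [Finset.mem_Icc]; omega, by ring⟩
  · intro m _; rfl

/-- On the Fourier side, the dilates neighbouring `ψ_k` sum to one on its support. This replaces the
usual fattened cut-off by the projections themselves, so that the dual bound applies. -/
theorem IsCutoff.projS_eq_sum {ψ : 𝓢(ℝ, ℂ)} (hψ : IsCutoff ψ) (k : ℤ) (h : 𝓢(ℝ, ℂ)) :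
    projS ψ k h = ∑ m ∈ Finset.Icc (-2 : ℤ) 2, projS ψ (k + m) (projS ψ k h) := by
  apply (FourierTransform.fourierCLE ℂ 𝓢(ℝ, ℂ)).injective
  rw [map_sum]
  ext t
  simp only [FourierTransform.fourierCLE_apply, sum_apply, fourier_projS]
  conv_lhs => rw [← hψ.sum_dilate_mul k t, Finset.mul_sum]
  exact Finset.sum_congr rfl fun m _ => by ring

/-- The estimate dual to the upper Littlewood-Paley bound. -/
theorem IsCutoff.exists_dual_bound {ψ : 𝓢(ℝ, ℂ)} (hψ : IsCutoff ψ) {p : ℝ} (hp : 1 < p) :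
    ∃ C : ℝ≥0, ∀ (ι : Type) [Fintype ι] (e : ι → ℤ), Function.Injective e →
      ∀ v : ι → 𝓢(ℝ, ℂ), ∫⁻ x, ‖∑ i, proj ψ (e i) (v i) x‖ₑ ^ p ≤
        C * ∫⁻ x, (∑ i, ‖v i x‖ₑ ^ 2) ^ (p / 2) := by
  -- Starting from the conjugate cut-off, the adjoint kernel is conjugated twice and becomes the row
  -- of kernels of `ψ` itself.
  obtain ⟨C, hC⟩ := hψ.conjCutoff.exists_bounds hp
  refine ⟨C, fun ι _ e he v => ?_⟩
  set V : ℝ → EuclideanSpace ℂ ι := fun x => WithLp.toLp 2 fun i => v i x with hV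
  have hcont : Continuous V := (PiLp.continuous_toLp 2 _).comp
    (continuous_pi fun i => (v i).continuous)
  have hle : ∀ x, ‖V x‖ ≤ ∑ i, ‖v i x‖ := fun x => norm_euclideanSpace_le_sum (V x)
  have hVb : BddIntegrable V := by
    refine ⟨hcont.stronglyMeasurable, ?_, ∑ i, SchwartzMap.seminorm ℝ 0 0 (v i), fun x =>
      (hle x).trans (Finset.sum_le_sum fun i _ => (v i).norm_le_seminorm ℝ x)⟩
    exact (integrable_finsetSum _ fun i _ => (v i).integrable.norm).mono'
      hcont.aestronglyMeasurable (Filter.Eventually.of_forall hle)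
  have h1 := (hC ι e he).2 V hVb
  have h2 : ∀ x, convOp (adjKernel (vecKernel (AdaptedLP.conjCutoff ψ) e)) V x =
      ∑ i, proj ψ (e i) (v i) x := fun x => by
    simp only [convOp, proj]
    rw [← integral_finsetSum _ fun i _ => integrable_mul_kernel ψ (e i) le_rfl ((v i).memLp 1) x]
    refine integral_congr_ae (Filter.Eventually.of_forall fun y => ?_)
    simp only [adjKernel, vecKernel, ContinuousLinearMap.adjoint_toSpanSingleton,
      innerSL_apply_apply, PiLp.inner_apply, hV, RCLike.inner_apply, kernel_conjCutoff,
      Complex.conj_conj, neg_neg]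
  have h3 : ∀ x, ‖V x‖ₑ ^ p = (∑ i, ‖v i x‖ₑ ^ 2) ^ (p / 2) := fun x => by
    have : ∑ i, ‖v i x‖ₑ ^ 2 = ‖V x‖ₑ ^ 2 := (enorm_sq_euclideanSpace (V x)).symm
    rw [this, ← ENNReal.rpow_natCast, ← ENNReal.rpow_mul]
    congr 1; push_cast; ring
  simpa only [h2, h3] using h1

/-- The partial sums of `∑ P_k h` converge to `h` in `L²`. -/
theorem IsCutoff.tendsto_sum_projS {ψ : 𝓢(ℝ, ℂ)} (hψ : IsCutoff ψ) (h : 𝓢(ℝ, ℂ))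
    {s : ℕ → Finset ℤ} (hs : Filter.Tendsto s Filter.atTop Filter.atTop) :
    Filter.Tendsto (fun n => ∫⁻ x, ‖(∑ k ∈ s n, projS ψ k h - h) x‖ₑ ^ 2) Filter.atTop
      (nhds 0) := by
  obtain ⟨A, hA⟩ := hψ.exists_tsum_enorm_le
  have hF : ∀ n t, 𝓕 (∑ k ∈ s n, projS ψ k h - h) t =
      𝓕 h t * (∑ k ∈ s n, dilate ψ k t - 1) := fun n t => by
    have h0 := map_sub (FourierTransform.fourierCLE ℂ 𝓢(ℝ, ℂ)) (∑ k ∈ s n, projS ψ k h) h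
    rw [map_sum] at h0
    simp only [FourierTransform.fourierCLE_apply] at h0
    rw [h0, sub_apply, sum_apply, mul_sub, mul_one, Finset.mul_sum]
    simp only [fourier_projS]
  simp only [← lintegral_enorm_sq_fourier, hF, enorm_mul, mul_pow]
  have hm : Measurable fun t => ‖𝓕 h t‖ₑ ^ 2 := (𝓕 h).continuous.enorm.measurable.pow_const 2
  have h0 : ∫⁻ t, ‖𝓕 h t‖ₑ ^ 2 * ((A : ℝ≥0∞) + 1) ^ 2 ≠ ∞ := by
    rw [lintegral_mul_const _ hm]
    refine ENNReal.mul_ne_top ?_ (by finiteness)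
    have := (bddIntegrable_coe (𝓕 h)).lintegral_rpow_ne_top one_le_two
    simpa using this
  -- The multiplier `∑ ψ_k - 1` of the error is bounded by `A + 1` and tends to zero off the null
  -- set `{0}`.
  have := tendsto_lintegral_of_dominated_convergence (μ := volume) (f := fun _ => 0)
    (F := fun n t => ‖𝓕 h t‖ₑ ^ 2 * ‖∑ k ∈ s n, dilate ψ k t - 1‖ₑ ^ 2) _
    (fun n => hm.mul ((((continuous_finsetSum _ fun k _ =>
      (dilate ψ k).continuous).sub continuous_const).enorm.measurable).pow_const 2))
    (fun n => Filter.Eventually.of_forall fun t => ?_) h0 ?_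
  · simpa using this
  · simp only
    gcongr
    refine enorm_sub_le.trans (add_le_add ?_ (by simp))
    refine (enorm_sum_le _ _).trans ((ENNReal.sum_le_tsum _).trans (hA t))
  · have h1 : ∀ᵐ t : ℝ, t ≠ 0 := by simp [ae_iff]
    filter_upwards [h1] with t ht
    have h2 : Filter.Tendsto (fun n => ∑ k ∈ s n, dilate ψ k t - 1) Filter.atTop (nhds 0) := by
      have h3 := ((hψ.2 t ht).comp hs).sub_const 1
      simp only [dilate_apply]
      simpa using h3
    have h4 := ENNReal.Tendsto.const_mul (a := ‖𝓕 h t‖ₑ ^ 2)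
      (((ENNReal.continuous_pow 2).tendsto _).comp ((continuous_enorm.tendsto _).comp h2))
      (Or.inr (by finiteness))
    simpa using h4

/-- The lower Littlewood-Paley estimate for Schwartz functions. -/
theorem IsCutoff.exists_lintegral_le_schwartz {ψ : 𝓢(ℝ, ℂ)} (hψ : IsCutoff ψ) {p : ℝ}
    (hp : 1 < p) : ∃ C : ℝ≥0, ∀ h : 𝓢(ℝ, ℂ),
      ∫⁻ x, ‖h x‖ₑ ^ p ≤ C * ∫⁻ x, (∑' k : ℤ, ‖proj ψ k h x‖ₑ ^ 2) ^ (p / 2) := by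
  obtain ⟨C, hC⟩ := hψ.exists_dual_bound hp
  have h5 : (Finset.Icc (-2 : ℤ) 2).card = 5 := rfl
  refine ⟨5 ^ (p - 1) * (5 * C), fun h => ?_⟩
  set I := ∫⁻ x, (∑' k : ℤ, ‖proj ψ k h x‖ₑ ^ 2) ^ (p / 2) with hI
  have hfin : ∀ s : Finset ℤ, ∫⁻ x, ‖(∑ k ∈ s, projS ψ k h) x‖ₑ ^ p ≤
      (5 ^ (p - 1) * (5 * C) : ℝ≥0) * I := fun s => by
    -- For fixed `m` the shift `k ↦ k + m` is injective, so the dual bound applies with `v_k = P_k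
    -- h`, whose square function is that of `h`.
    have hm : ∀ m ∈ Finset.Icc (-2 : ℤ) 2,
        ∫⁻ x, ‖∑ k ∈ s, proj ψ (k + m) (projS ψ k h) x‖ₑ ^ p ≤ C * I := fun m _ => by
      have h1 := hC s (fun k => (k : ℤ) + m) (fun a b hab => by simpa using hab)
        fun k => projS ψ k h
      have h2 : ∀ x, ∑ i : s, proj ψ (i + m) (projS ψ i h) x =
          ∑ k ∈ s, proj ψ (k + m) (projS ψ k h) x := fun x =>
        Finset.sum_coe_sort s fun k => proj ψ (k + m) (projS ψ k h) x
      simp only [h2] at h1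
      refine h1.trans (mul_le_mul_right (lintegral_mono fun x => ?_) _)
      refine ENNReal.rpow_le_rpow ?_ (by linarith)
      rw [Finset.sum_coe_sort s fun k => ‖projS ψ k h x‖ₑ ^ 2]
      simp only [coe_projS]
      exact ENNReal.sum_le_tsum _
    have hx : ∀ x, (∑ k ∈ s, projS ψ k h) x =
        ∑ m ∈ Finset.Icc (-2 : ℤ) 2, ∑ k ∈ s, proj ψ (k + m) (projS ψ k h) x := fun x => by
      rw [Finset.sum_comm, sum_apply]
      refine Finset.sum_congr rfl fun k _ => ?_
      conv_lhs => rw [hψ.projS_eq_sum k h]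
      rw [sum_apply]
      simp only [coe_projS]
    have hmeas : ∀ m, Measurable fun x => ‖∑ k ∈ s, proj ψ (k + m) (projS ψ k h) x‖ₑ ^ p :=
      fun m => (Finset.measurable_sum _ fun k _ =>
        measurable_proj_schwartz ψ (k + m) (projS ψ k h)).enorm.pow_const _
    calc ∫⁻ x, ‖(∑ k ∈ s, projS ψ k h) x‖ₑ ^ p
        ≤ ∫⁻ x, (5 : ℝ≥0∞) ^ (p - 1) * ∑ m ∈ Finset.Icc (-2 : ℤ) 2,
            ‖∑ k ∈ s, proj ψ (k + m) (projS ψ k h) x‖ₑ ^ p := by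
          refine lintegral_mono fun x => ?_
          simp only [hx]
          refine (ENNReal.rpow_le_rpow (enorm_sum_le _ _) (by linarith)).trans ?_
          have := ENNReal.rpow_sum_le_const_mul_sum_rpow (Finset.Icc (-2 : ℤ) 2)
            (fun m => ‖∑ k ∈ s, proj ψ (k + m) (projS ψ k h) x‖ₑ) hp.le
          rw [h5] at this
          exact_mod_cast this
      _ = 5 ^ (p - 1) * ∑ m ∈ Finset.Icc (-2 : ℤ) 2,
            ∫⁻ x, ‖∑ k ∈ s, proj ψ (k + m) (projS ψ k h) x‖ₑ ^ p := by
          rw [lintegral_const_mul _ (Finset.measurable_sum _ fun m _ => hmeas m),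
            lintegral_finsetSum _ fun m _ => hmeas m]
      _ ≤ 5 ^ (p - 1) * ∑ m ∈ Finset.Icc (-2 : ℤ) 2, C * I :=
          mul_le_mul_right (Finset.sum_le_sum hm) _
      _ = (5 ^ (p - 1) * (5 * C) : ℝ≥0) * I := by
          rw [Finset.sum_const, h5, ENNReal.coe_mul, ENNReal.coe_mul,
            ENNReal.coe_rpow_of_nonneg _ (by linarith)]
          simp [mul_assoc]
  obtain ⟨s, hs⟩ := Filter.exists_seq_tendsto (Filter.atTop : Filter (Finset ℤ))
  have h1 : Filter.Tendsto (fun n => eLpNorm (⇑(∑ k ∈ s n, projS ψ k h) - ⇑h) 2 volume)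
      Filter.atTop (nhds 0) := by
    have h2 := ((ENNReal.continuous_rpow_const (y := (1 / 2 : ℝ))).tendsto _).comp
      (hψ.tendsto_sum_projS h hs)
    rw [ENNReal.zero_rpow_of_pos (by norm_num)] at h2
    refine h2.congr fun n => ?_
    rw [eLpNorm_eq_lintegral_rpow_enorm_toReal two_ne_zero (by simp)]
    simp
  -- `L²` convergence is used only to extract an almost everywhere convergent subsequence; Fatou
  -- then carries the uniform `L^p` bound to `h`.
  obtain ⟨ns, -, hns⟩ := (tendstoInMeasure_of_tendsto_eLpNorm two_ne_zero
    (fun n => (∑ k ∈ s n, projS ψ k h).continuous.aestronglyMeasurable)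
    h.continuous.aestronglyMeasurable h1).exists_seq_tendsto_ae
  calc ∫⁻ x, ‖h x‖ₑ ^ p
      = ∫⁻ x, Filter.liminf (fun i => ‖(∑ k ∈ s (ns i), projS ψ k h) x‖ₑ ^ p) Filter.atTop := by
        refine lintegral_congr_ae ?_
        filter_upwards [hns] with x hx
        exact (((ENNReal.continuous_rpow_const.tendsto _).comp
          ((continuous_enorm.tendsto _).comp hx)).liminf_eq).symm
    _ ≤ Filter.liminf (fun i => ∫⁻ x, ‖(∑ k ∈ s (ns i), projS ψ k h) x‖ₑ ^ p) Filter.atTop :=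
        lintegral_liminf_le fun i =>
          (∑ k ∈ s (ns i), projS ψ k h).continuous.enorm.measurable.pow_const _
    _ ≤ _ := Filter.liminf_le_of_le (by isBoundedDefault) fun b hb => by
        obtain ⟨n, hn⟩ := hb.exists
        exact hn.trans (hfin _)

/-- The one dimensional square function. -/
def lineSquare (ψ : 𝓢(ℝ, ℂ)) (f : ℝ → ℂ) (y : ℝ) : ℝ≥0∞ :=
  (∑' k : ℤ, ‖proj ψ k f y‖ₑ ^ 2) ^ (1 / 2 : ℝ)

theorem lineSquare_rpow (ψ : 𝓢(ℝ, ℂ)) (f : ℝ → ℂ) (y p : ℝ) :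
    lineSquare ψ f y ^ p = (∑' k : ℤ, ‖proj ψ k f y‖ₑ ^ 2) ^ (p / 2) := by
  rw [lineSquare, ← ENNReal.rpow_mul]; congr 1; ring

/-- Reading the square function as an `L²` norm for counting measure makes Minkowski's inequality
available. -/
theorem lineSquare_eq_eLpNorm (ψ : 𝓢(ℝ, ℂ)) (f : ℝ → ℂ) (y : ℝ) :
    lineSquare ψ f y = eLpNorm (fun k : ℤ => proj ψ k f y) 2 Measure.count := by
  rw [eLpNorm_eq_lintegral_rpow_enorm_toReal two_ne_zero (by simp), lintegral_count, lineSquare]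
  simp

theorem lineSquare_le_add (ψ : 𝓢(ℝ, ℂ)) {p : ℝ≥0∞} (hp : 1 ≤ p) {f g : ℝ → ℂ}
    (hf : MemLp f p) (hg : MemLp g p) (y : ℝ) :
    lineSquare ψ g y ≤ lineSquare ψ f y + lineSquare ψ (fun x => g x - f x) y := by
  have h1 : (fun k : ℤ => proj ψ k g y) = (fun k : ℤ => proj ψ k f y) +
      fun k : ℤ => proj ψ k (fun x => g x - f x) y := by
    ext k
    simp [proj_sub ψ k hp hg hf]
  rw [lineSquare_eq_eLpNorm, lineSquare_eq_eLpNorm, lineSquare_eq_eLpNorm, h1]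
  exact eLpNorm_add_le (measurable_of_countable _).aestronglyMeasurable
    (measurable_of_countable _).aestronglyMeasurable one_le_two

theorem measurable_lineSquare (ψ : 𝓢(ℝ, ℂ)) {p : ℝ≥0∞} (hp : 1 ≤ p) (hp' : p ≠ ∞)
    {f : ℝ → ℂ} (hf : MemLp f p) : Measurable (lineSquare ψ f) :=
  (measurable_tsum_proj ψ hp hp' hf).pow_const _

theorem lintegral_rpow_le_iff_eLpNorm_le {α F G : Type*} [MeasurableSpace α] [ENorm F] [ENorm G]
    {μ : Measure α} {p : ℝ≥0∞} (hp : 1 ≤ p) (hp' : p ≠ ∞) {C : ℝ≥0} (f : α → F) (g : α → G) :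
    ∫⁻ x, ‖f x‖ₑ ^ p.toReal ∂μ ≤ (C ^ p.toReal : ℝ≥0) * ∫⁻ x, ‖g x‖ₑ ^ p.toReal ∂μ ↔
      eLpNorm f p μ ≤ C * eLpNorm g p μ := by
  have h0 : 0 < p.toReal := ENNReal.toReal_pos (by positivity) hp'
  rw [lintegral_enorm_rpow_eq hp hp', lintegral_enorm_rpow_eq hp hp',
    ENNReal.coe_rpow_of_nonneg _ h0.le, ← ENNReal.mul_rpow_of_nonneg _ _ h0.le,
    ENNReal.rpow_le_rpow_iff h0]

theorem exists_rpow_eq (C : ℝ≥0) {p : ℝ} (hp : 0 < p) : ∃ D : ℝ≥0, D ^ p = C :=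
  ⟨C ^ p⁻¹, by rw [← NNReal.rpow_mul, inv_mul_cancel₀ hp.ne', NNReal.rpow_one]⟩

/-- The Littlewood-Paley estimates on the line. -/
theorem IsCutoff.exists_line_bounds {ψ : 𝓢(ℝ, ℂ)} (hψ : IsCutoff ψ) {p : ℝ≥0∞}
    (hp : 1 < p) (hp' : p ≠ ∞) : ∃ C : ℝ≥0, ∀ f : ℝ → ℂ, MemLp f p →
      ∫⁻ y, lineSquare ψ f y ^ p.toReal ≤ C * ∫⁻ y, ‖f y‖ₑ ^ p.toReal ∧
      ∫⁻ y, ‖f y‖ₑ ^ p.toReal ≤ C * ∫⁻ y, lineSquare ψ f y ^ p.toReal := by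
  have hP : 1 < p.toReal := by
    rw [← ENNReal.toReal_one]; exact (ENNReal.toReal_lt_toReal ENNReal.one_ne_top hp').2 hp
  have hP0 : 0 < p.toReal := by linarith
  obtain ⟨C₁, hC₁⟩ := hψ.exists_lintegral_tsum_le hp hp'
  obtain ⟨C₂, hC₂⟩ := hψ.exists_lintegral_le_schwartz hP
  simp only [← lineSquare_rpow] at hC₁ hC₂
  obtain ⟨D₁, rfl⟩ := exists_rpow_eq C₁ hP0
  obtain ⟨D₂, rfl⟩ := exists_rpow_eq C₂ hP0
  have h1 : ∀ f : ℝ → ℂ, MemLp f p →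
      eLpNorm (lineSquare ψ f) p volume ≤ D₁ * eLpNorm f p volume := fun f hf =>
    (lintegral_rpow_le_iff_eLpNorm_le hp.le hp' _ _).1 (by simpa using hC₁ f hf)
  have h2 : ∀ h : 𝓢(ℝ, ℂ), eLpNorm h p volume ≤ D₂ * eLpNorm (lineSquare ψ h) p volume := fun h =>
    (lintegral_rpow_le_iff_eLpNorm_le hp.le hp' _ _).1 (by simpa using hC₂ h)
  have h3 : ∀ f : ℝ → ℂ, MemLp f p →
      eLpNorm f p volume ≤ D₂ * eLpNorm (lineSquare ψ f) p volume := fun f hf => by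
    obtain ⟨h, hlim, hlim'⟩ := exists_schwartz_tendsto hp.le hp' hf
    -- Subadditivity compares the square function of `h n` with that of `f`; the upper inequality
    -- makes the error `h n - f` disappear in the limit.
    have h4 : ∀ n, eLpNorm (h n) p volume ≤ D₂ * (eLpNorm (lineSquare ψ f) p volume +
        D₁ * eLpNorm (fun x => h n x - f x) p volume) := fun n => by
      refine (h2 (h n)).trans (mul_le_mul_right ?_ _)
      refine le_trans ?_ (add_le_add_right (h1 _ (((h n).memLp p).sub hf)) _)
      refine le_trans ?_ (eLpNorm_add_le
        (measurable_lineSquare ψ hp.le hp' hf).aestronglyMeasurable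
        (measurable_lineSquare ψ hp.le hp'
          (((h n).memLp p).sub hf)).aestronglyMeasurable hp.le)
      exact eLpNorm_mono_enorm fun y => by
        simpa using lineSquare_le_add ψ hp.le hf ((h n).memLp p) y
    have h5 := ENNReal.Tendsto.const_mul (a := (D₂ : ℝ≥0∞))
      ((ENNReal.Tendsto.const_mul (a := (D₁ : ℝ≥0∞)) hlim
        (Or.inr ENNReal.coe_ne_top)).const_add (eLpNorm (lineSquare ψ f) p volume))
        (Or.inr ENNReal.coe_ne_top)
    have h6 := le_of_tendsto_of_tendsto' hlim' h5 h4
    simpa using h6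
  refine ⟨D₁ ^ p.toReal + D₂ ^ p.toReal, fun f hf => ⟨?_, ?_⟩⟩
  · refine (hC₁ f hf).trans (mul_le_mul_left ?_ _)
    exact_mod_cast le_self_add
  · have := (lintegral_rpow_le_iff_eLpNorm_le hp.le hp' _ _).2 (h3 f hf)
    simp only [enorm_eq_self] at this
    refine this.trans (mul_le_mul_left ?_ _)
    exact_mod_cast le_add_self

/-! ### Adjoints on the line, and projections along the fibres of a product. -/

theorem proj_congr_ae (ψ : 𝓢(ℝ, ℂ)) (k : ℤ) {f g : ℝ → ℂ} (h : f =ᵐ[volume] g) :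
    proj ψ k f = proj ψ k g := by
  ext y
  refine integral_congr_ae ?_
  filter_upwards [h] with z hz
  rw [hz]

theorem enorm_proj_le_lineSquare (ψ : 𝓢(ℝ, ℂ)) (k : ℤ) (f : ℝ → ℂ) (y : ℝ) :
    ‖proj ψ k f y‖ₑ ≤ lineSquare ψ f y := by
  rw [lineSquare, one_div, ENNReal.le_rpow_inv_iff two_pos]
  have := ENNReal.le_tsum (f := fun k : ℤ => ‖proj ψ k f y‖ₑ ^ 2) k
  exact_mod_cast this

/-- Young's inequality in dual form: integrability of `(y, z) ↦ a(z) K(y - z) b(y)`. -/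
theorem integrable_mul_mul_sub {a b K : ℝ → ℂ} (ha : Measurable a) (hb : Measurable b)
    (hK : Continuous K) (hK1 : Integrable K) {p q : ℝ≥0∞} [p.HolderConjugate q]
    (hap : MemLp a q) (hbp : MemLp b p) :
    Integrable (fun w : ℝ × ℝ => a w.2 * K (w.1 - w.2) * b w.1) := by
  have hm : Measurable fun w : ℝ × ℝ => a w.2 * K (w.1 - w.2) * b w.1 := by
    have := hK.measurable
    fun_prop
  refine ⟨hm.aestronglyMeasurable, ?_⟩
  rw [hasFiniteIntegral_iff_enorm, Measure.volume_eq_prod, lintegral_prod _ hm.enorm.aemeasurable]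
  have h1 : ∀ y, ∫⁻ z, ‖a z * K (y - z) * b y‖ₑ = ∫⁻ t, ‖a (y - t) * K t * b y‖ₑ := fun y => by
    rw [← lintegral_sub_left_eq_self _ y]
    simp
  have h2 : Measurable fun w : ℝ × ℝ => ‖a (w.1 - w.2) * K w.2 * b w.1‖ₑ := by
    have := hK.measurable
    fun_prop
  have h3 : ∀ t, ∫⁻ y, ‖a (y - t) * K t * b y‖ₑ ≤
      ‖K t‖ₑ * (eLpNorm a q volume * eLpNorm b p volume) := fun t => by
    have h4 : ∀ y, ‖a (y - t) * K t * b y‖ₑ = ‖K t‖ₑ * ‖a (y - t) * b y‖ₑ := fun y => by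
      simp only [enorm_mul]; ring
    simp only [h4]
    rw [lintegral_const_mul _ (by fun_prop)]
    refine mul_le_mul_right ?_ _
    have h5 := eLpNorm_smul_le_mul_eLpNorm (r := 1) (p := q) (q := p) (μ := volume)
      (φ := fun y => a (y - t)) (f := b) hb.aestronglyMeasurable
      (ha.comp (measurable_id.sub_const t)).aestronglyMeasurable
    rw [eLpNorm_one_eq_lintegral_enorm] at h5
    have h6 : eLpNorm (fun y => a (y - t)) q volume = eLpNorm a q volume :=
      eLpNorm_comp_measurePreserving ha.aestronglyMeasurable (measurePreserving_sub_right volume t)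
    rw [h6] at h5
    exact h5
  simp only [h1]
  rw [lintegral_lintegral_swap h2.aemeasurable]
  refine (lintegral_mono h3).trans_lt ?_
  rw [lintegral_mul_const _ hK.measurable.enorm]
  exact ENNReal.mul_lt_top hK1.2 (ENNReal.mul_lt_top hap.2 hbp.2)

/-- The adjoint of `P_k` on the line is the projection attached to the conjugate cut-off. -/
theorem integral_conj_proj_mul (ψ : 𝓢(ℝ, ℂ)) (k : ℤ) {p q : ℝ≥0∞} [p.HolderConjugate q]
    {a b : ℝ → ℂ} (ha : MemLp a q) (hb : MemLp b p) :
    ∫ y, conj (proj ψ k a y) * b y = ∫ z, conj (a z) * proj (conjCutoff ψ) k b z := by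
  -- Both sides depend only on almost everywhere classes; measurable representatives give the joint
  -- measurability that Fubini needs.
  wlog hm : Measurable a ∧ Measurable b generalizing a b
  · obtain ⟨a', ha', haa⟩ := ha.1
    obtain ⟨b', hb', hbb⟩ := hb.1
    have := this (ha.ae_eq haa) (hb.ae_eq hbb) ⟨ha'.measurable, hb'.measurable⟩
    rw [proj_congr_ae ψ k haa, proj_congr_ae _ k hbb]
    refine Eq.trans (integral_congr_ae ?_) (this.trans (integral_congr_ae ?_))
    · filter_upwards [hbb] with y hy; rw [hy]
    · filter_upwards [haa] with y hy; rw [hy]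
  have hi := integrable_mul_mul_sub (K := fun t => kernel (conjCutoff ψ) k (-t))
    (a := fun z => conj (a z)) (Complex.continuous_conj.measurable.comp hm.1) hm.2
    ((continuous_kernel _ k).comp continuous_neg) (integrable_kernel _ k).comp_neg ha.star hb
  have h1 := integral_integral_swap (μ := volume) (ν := volume)
    (f := fun y z => conj (a z) * kernel (conjCutoff ψ) k (-(y - z)) * b y) hi
  refine Eq.trans ?_ (h1.trans ?_)
  · refine integral_congr_ae (Filter.Eventually.of_forall fun y => ?_)
    simp only [proj]
    rw [← integral_conj, ← integral_mul_const]
    refine integral_congr_ae (Filter.Eventually.of_forall fun z => ?_)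
    simp only [kernel_conjCutoff, map_mul, neg_neg]
  · refine integral_congr_ae (Filter.Eventually.of_forall fun z => ?_)
    simp only [proj]
    rw [← integral_const_mul]
    refine integral_congr_ae (Filter.Eventually.of_forall fun y => ?_)
    simp only [neg_sub]
    ring

section Fibre

set_option linter.unusedSectionVars false

/-- The projection `P_k` in the second variable. -/
def fiberProj (ψ : 𝓢(ℝ, ℂ)) (k : ℤ) (H : ℝ × ℝ → ℂ) (w : ℝ × ℝ) : ℂ :=
  proj ψ k (fun t => H (w.1, t)) w.2

/-- The square function in the second variable. -/
def fiberSquare (ψ : 𝓢(ℝ, ℂ)) (H : ℝ × ℝ → ℂ) (w : ℝ × ℝ) : ℝ≥0∞ :=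
  lineSquare ψ (fun t => H (w.1, t)) w.2

theorem fiberSquare_eq (ψ : 𝓢(ℝ, ℂ)) (H : ℝ × ℝ → ℂ) (w : ℝ × ℝ) :
    fiberSquare ψ H w = (∑' k : ℤ, ‖fiberProj ψ k H w‖ₑ ^ 2) ^ (1 / 2 : ℝ) := rfl

variable {ρ : Measure ℝ} [SFinite ρ]

theorem memLp_fiber {p : ℝ≥0∞} (hp : 1 ≤ p) (hp' : p ≠ ∞) {H : ℝ × ℝ → ℂ}
    (hH : MemLp H p (ρ.prod volume)) : ∀ᵐ x ∂ρ, MemLp (fun t => H (x, t)) p := by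
  have h1 : ∫⁻ w, ‖H w‖ₑ ^ p.toReal ∂ρ.prod volume ≠ ∞ :=
    (lintegral_rpow_enorm_lt_top_of_eLpNorm_lt_top (by positivity) hp' hH.2).ne
  have hm : AEMeasurable (fun w => ‖H w‖ₑ ^ p.toReal) (ρ.prod volume) := hH.1.enorm.pow_const _
  rw [lintegral_prod _ hm] at h1
  filter_upwards [hH.1.prodMk_left, ae_lt_top' hm.lintegral_prod_right' h1] with x hx hx'
  exact ⟨hx, (eLpNorm_lt_top_iff_lintegral_rpow_enorm_lt_top (by positivity) hp').2 hx'⟩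

theorem ae_fiber {P : ℝ → Prop} (h : ∀ᵐ x ∂ρ, P x) :
    ∀ᵐ w ∂ρ.prod (volume : Measure ℝ), P w.1 :=
  Measure.quasiMeasurePreserving_fst.ae h

theorem aestronglyMeasurable_fiberProj (ψ : 𝓢(ℝ, ℂ)) (k : ℤ) {H : ℝ × ℝ → ℂ}
    (hH : AEStronglyMeasurable H (ρ.prod volume)) :
    AEStronglyMeasurable (fiberProj ψ k H) (ρ.prod volume) := by
  obtain ⟨H', hH', h⟩ := hH
  have hc := (continuous_kernel ψ k).measurable
  have hm : StronglyMeasurable (fiberProj ψ k H') := by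
    have h1 : StronglyMeasurable fun v : (ℝ × ℝ) × ℝ =>
        H' (v.1.1, v.2) * kernel ψ k (v.1.2 - v.2) := by
      have := hH'.measurable
      exact Measurable.stronglyMeasurable (by fun_prop)
    exact h1.integral_prod_right'
  refine ⟨_, hm, ?_⟩
  filter_upwards [ae_fiber (Measure.ae_ae_of_ae_prod h)] with w hw
  exact congrFun (proj_congr_ae ψ k hw) w.2

theorem aemeasurable_fiberSquare (ψ : 𝓢(ℝ, ℂ)) {H : ℝ × ℝ → ℂ}
    (hH : AEStronglyMeasurable H (ρ.prod volume)) :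
    AEMeasurable (fiberSquare ψ H) (ρ.prod volume) := by
  have : AEMeasurable (fun w => ∑' k : ℤ, ‖fiberProj ψ k H w‖ₑ ^ 2) (ρ.prod volume) :=
    AEMeasurable.tsum fun k => (aestronglyMeasurable_fiberProj ψ k hH).enorm.pow_const 2
  exact this.pow_const _

/-- Almost every fibre of `H` lies in `L^p` of the line, so the estimates there integrate against
`ρ`; the constant does not involve `ρ`. -/
theorem IsCutoff.exists_fiber_bounds {ψ : 𝓢(ℝ, ℂ)} (hψ : IsCutoff ψ) {p : ℝ≥0∞}
    (hp : 1 < p) (hp' : p ≠ ∞) : ∃ C : ℝ≥0, ∀ (ρ : Measure ℝ) [SFinite ρ] (H : ℝ × ℝ → ℂ),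
      MemLp H p (ρ.prod volume) →
        eLpNorm (fiberSquare ψ H) p (ρ.prod volume) ≤ C * eLpNorm H p (ρ.prod volume) ∧
        eLpNorm H p (ρ.prod volume) ≤ C * eLpNorm (fiberSquare ψ H) p (ρ.prod volume) := by
  obtain ⟨C, hC⟩ := hψ.exists_line_bounds hp hp'
  obtain ⟨D, rfl⟩ := exists_rpow_eq C (ENNReal.toReal_pos (by positivity) hp' : 0 < p.toReal)
  refine ⟨D, fun ρ _ H hH => ?_⟩
  have hm1 : AEMeasurable (fun w => ‖fiberSquare ψ H w‖ₑ ^ p.toReal) (ρ.prod volume) :=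
    (aemeasurable_fiberSquare ψ hH.1).enorm.pow_const _
  have hm2 : AEMeasurable (fun w => ‖H w‖ₑ ^ p.toReal) (ρ.prod volume) := hH.1.enorm.pow_const _
  rw [← lintegral_rpow_le_iff_eLpNorm_le hp.le hp', ← lintegral_rpow_le_iff_eLpNorm_le hp.le hp',
    lintegral_prod _ hm1, lintegral_prod _ hm2, ← lintegral_const_mul' _ _ ENNReal.coe_ne_top,
    ← lintegral_const_mul' _ _ ENNReal.coe_ne_top]
  constructor <;> refine lintegral_mono_ae ?_ <;>
    filter_upwards [memLp_fiber hp.le hp' hH] with x hx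
  · exact (hC _ hx).1
  · exact (hC _ hx).2

theorem IsCutoff.memLp_fiberProj {ψ : 𝓢(ℝ, ℂ)} (hψ : IsCutoff ψ) (k : ℤ) {p : ℝ≥0∞}
    (hp : 1 < p) (hp' : p ≠ ∞) {H : ℝ × ℝ → ℂ} (hH : MemLp H p (ρ.prod volume)) :
    MemLp (fiberProj ψ k H) p (ρ.prod volume) := by
  obtain ⟨C, hC⟩ := hψ.exists_fiber_bounds hp hp'
  refine ⟨aestronglyMeasurable_fiberProj ψ k hH.1, lt_of_le_of_lt ?_
    ((hC ρ H hH).1.trans_lt (ENNReal.mul_lt_top ENNReal.coe_lt_top hH.2))⟩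
  exact eLpNorm_mono_enorm fun w => enorm_proj_le_lineSquare ψ k (fun t => H (w.1, t)) w.2

theorem ae_integrable_fiber (ψ : 𝓢(ℝ, ℂ)) (k : ℤ) {p : ℝ≥0∞} (hp : 1 ≤ p) (hp' : p ≠ ∞)
    {H : ℝ × ℝ → ℂ} (hH : MemLp H p (ρ.prod volume)) :
    ∀ᵐ w ∂ρ.prod volume, Integrable fun t => H (w.1, t) * kernel ψ k (w.2 - t) := by
  filter_upwards [ae_fiber (memLp_fiber hp hp' hH)] with w hw
  exact integrable_mul_kernel ψ k hp hw w.2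

/-- The adjoint of the fibrewise projection. -/
theorem IsCutoff.integral_conj_fiberProj_mul {ψ : 𝓢(ℝ, ℂ)} (hψ : IsCutoff ψ) (k : ℤ)
    {p q : ℝ≥0∞} [p.HolderConjugate q] (hp : 1 < p) (hp' : p ≠ ∞) (hq : 1 < q) (hq' : q ≠ ∞)
    {A B : ℝ × ℝ → ℂ} (hA : MemLp A q (ρ.prod volume)) (hB : MemLp B p (ρ.prod volume)) :
    ∫ w, conj (fiberProj ψ k A w) * B w ∂ρ.prod volume =
      ∫ w, conj (A w) * fiberProj (AdaptedLP.conjCutoff ψ) k B w ∂ρ.prod volume := by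
  have i1 : Integrable (fun w => conj (fiberProj ψ k A w) * B w) (ρ.prod volume) :=
    hB.integrable_mul (hψ.memLp_fiberProj k hq hq' hA).star |>.congr
      (Filter.Eventually.of_forall fun w => mul_comm _ _)
  have i2 : Integrable (fun w => conj (A w) * fiberProj (AdaptedLP.conjCutoff ψ) k B w)
      (ρ.prod volume) :=
    (hψ.conjCutoff.memLp_fiberProj k hp hp' hB).integrable_mul hA.star |>.congr
      (Filter.Eventually.of_forall fun w => mul_comm _ _)
  rw [integral_prod _ i1, integral_prod _ i2]
  refine integral_congr_ae ?_
  filter_upwards [memLp_fiber hq.le hq' hA, memLp_fiber hp.le hp' hB] with x hx hx'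
  exact integral_conj_proj_mul ψ k (p := p) (q := q) hx hx'

end Fibre

/-! ### Transport to the plane through coordinates of bounded distortion. -/

theorem enorm_nnreal_smul (c : ℝ≥0) (z : ℂ) : ‖c • z‖ₑ = c * ‖z‖ₑ := by
  rw [NNReal.smul_def, enorm_smul, Real.enorm_of_nonneg (NNReal.coe_nonneg c)]
  simp

theorem eLpNorm_le_of_measure_le_smul {α F : Type*} [MeasurableSpace α] [TopologicalSpace F]
    [ContinuousENorm F] {μ ν : Measure α} {M : ℝ≥0} (h : ν ≤ (M : ℝ≥0∞) • μ) {p : ℝ≥0∞}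
    (hp' : p ≠ ∞) (f : α → F) :
    eLpNorm f p ν ≤ (M ^ (1 / p).toReal : ℝ≥0) * eLpNorm f p μ := by
  refine (eLpNorm_mono_measure f h).trans ?_
  rw [eLpNorm_smul_measure_of_ne_top hp', smul_eq_mul,
    ENNReal.coe_rpow_of_nonneg _ ENNReal.toReal_nonneg]

/-- Two σ-finite measures that dominate each other have a density bounded above and below. -/
theorem exists_bounded_density {α : Type*} [MeasurableSpace α] {μ ν : Measure α} [SigmaFinite μ]
    [SigmaFinite ν] {M : ℝ≥0} (hM : 1 ≤ M) (h₁ : ν ≤ (M : ℝ≥0∞) • μ)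
    (h₂ : μ ≤ (M : ℝ≥0∞) • ν) : ∃ j : α → ℝ≥0, Measurable j ∧
      ν = μ.withDensity (fun w => (j w : ℝ≥0∞)) ∧ ∀ w, j w ≤ M ∧ M⁻¹ ≤ j w := by
  have hac : ν ≪ μ := Measure.absolutelyContinuous_of_le_smul h₁
  have hd := Measure.withDensity_rnDeriv_eq ν μ hac
  have hJ := Measure.measurable_rnDeriv ν μ
  have hs : ∀ s, MeasurableSet s → ∫⁻ x in s, ν.rnDeriv μ x ∂μ = ν s := fun s hs => by
    rw [← withDensity_apply _ hs, hd]
  have hle : ν.rnDeriv μ ≤ᵐ[μ] fun _ => (M : ℝ≥0∞) :=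
    ae_le_of_forall_setLIntegral_le_of_sigmaFinite hJ fun s hms _ => by
      rw [hs s hms, setLIntegral_const]
      simpa using h₁ s
  have hge : (fun _ => (1 : ℝ≥0∞)) ≤ᵐ[μ] fun w => M * ν.rnDeriv μ w :=
    ae_le_of_forall_setLIntegral_le_of_sigmaFinite measurable_const fun s hms _ => by
      rw [lintegral_const_mul _ hJ, hs s hms, setLIntegral_const, one_mul]
      simpa using h₂ s
  have hM0 : M ≠ 0 := (zero_lt_one.trans_le hM).ne'
  -- Truncation changes the derivative only on a null set and makes both bounds hold everywhere.
  refine ⟨fun w => max M⁻¹ (min (ν.rnDeriv μ w).toNNReal M), by fun_prop, ?_, fun w => ⟨?_, ?_⟩⟩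
  · conv_lhs => rw [← hd]
    refine withDensity_congr_ae ?_
    filter_upwards [hle, hge] with w hw hw'
    have ht : ν.rnDeriv μ w ≠ ∞ := ne_top_of_le_ne_top ENNReal.coe_ne_top hw
    lift ν.rnDeriv μ w to ℝ≥0 using ht with a ha
    have h3 : a ≤ M := by exact_mod_cast hw
    have h4 : 1 ≤ M * a := by exact_mod_cast hw'
    have h5 : M⁻¹ ≤ a := by
      rw [inv_le_iff_one_le_mul₀ (by positivity), mul_comm]; exact h4
    simp [h3, h5]
  · exact max_le ((inv_le_one_of_one_le₀ hM).trans hM) (min_le_right _ _)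
  · exact le_max_left _ _

/-- Coordinates in which Lebesgue measure on the plane is comparable to a product measure whose
second factor is Lebesgue measure. -/
structure FiberChart (M : ℝ≥0) (e : ℝ × ℝ ≃ᵐ ℝ × ℝ) (ρ : Measure ℝ) : Prop where
  one_le : 1 ≤ M
  map_le : (volume : Measure (ℝ × ℝ)).map e ≤ (M : ℝ≥0∞) • ρ.prod volume
  le_map : ρ.prod volume ≤ (M : ℝ≥0∞) • (volume : Measure (ℝ × ℝ)).map e

/-- The fibrewise projection transported to the plane. -/
def chartProj (ψ : 𝓢(ℝ, ℂ)) (e : ℝ × ℝ ≃ᵐ ℝ × ℝ) (k : ℤ) (f : ℝ × ℝ → ℂ) (q : ℝ × ℝ) : ℂ :=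
  fiberProj ψ k (f ∘ e.symm) (e q)

theorem eLpNorm_comp_chart {F : Type*} [TopologicalSpace F] [ContinuousENorm F]
    (e : ℝ × ℝ ≃ᵐ ℝ × ℝ) (G : ℝ × ℝ → F) (p : ℝ≥0∞) :
    eLpNorm (fun q => G (e q)) p volume = eLpNorm G p ((volume : Measure (ℝ × ℝ)).map e) :=
  (e.measurableEmbedding.eLpNorm_map_measure).symm

theorem eLpNorm_eq_chart {F : Type*} [TopologicalSpace F] [ContinuousENorm F]
    (e : ℝ × ℝ ≃ᵐ ℝ × ℝ) (f : ℝ × ℝ → F) (p : ℝ≥0∞) :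
    eLpNorm f p volume = eLpNorm (f ∘ e.symm) p ((volume : Measure (ℝ × ℝ)).map e) := by
  rw [← eLpNorm_comp_chart]; simp

theorem squareFunction_chartProj (ψ : 𝓢(ℝ, ℂ)) (e : ℝ × ℝ ≃ᵐ ℝ × ℝ) (f : ℝ × ℝ → ℂ) :
    squareFunction (fun k => chartProj ψ e k f) = fun q => fiberSquare ψ (f ∘ e.symm) (e q) := rfl

/-- Indicators of sets of finite measure are admissible test functions and determine a function of
`L^p`. Thus estimates for one explicit adjoint value hold for any other. -/
theorem isAdjointValue_ae_eq {T : (ℝ × ℝ → ℂ) → ℝ × ℝ → ℂ} {p : ℝ≥0∞} (hp : 1 ≤ p)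
    {f h₁ h₂ : ℝ × ℝ → ℂ} (h1 : IsAdjointValue T p f h₁) (h2 : IsAdjointValue T p f h₂) :
    h₁ =ᵐ[volume] h₂ := by
  refine ae_eq_of_forall_setIntegral_eq_of_sigmaFinite
    (fun s hs hs' => ?_) (fun s hs hs' => ?_) fun s hs hs' => ?_
  · have := Fact.mk hs'
    exact (h1.1.restrict s).integrable hp
  · have := Fact.mk hs'
    exact (h2.1.restrict s).integrable hp
  · have hφ : MemLp (s.indicator fun _ => (1 : ℂ)) (ENNReal.conjExponent p)
        (volume : Measure (ℝ × ℝ)) := memLp_indicator_const _ hs 1 (Or.inr hs'.ne)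
    have h3 := (h1.2 _ hφ).trans (h2.2 _ hφ).symm
    have h4 : ∀ h : ℝ × ℝ → ℂ, ∫ q, conj (s.indicator (fun _ => (1 : ℂ)) q) * h q =
        ∫ q in s, h q := fun h => by
      rw [← integral_indicator hs]
      refine integral_congr_ae (Filter.Eventually.of_forall fun q => ?_)
      by_cases hq : q ∈ s <;> simp [hq]
    rwa [h4, h4] at h3

namespace FiberChart

variable {M : ℝ≥0} {e : ℝ × ℝ ≃ᵐ ℝ × ℝ} {ρ : Measure ℝ}

theorem map_ac (hc : FiberChart M e ρ) :
    (volume : Measure (ℝ × ℝ)).map e ≪ ρ.prod volume :=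
  Measure.absolutelyContinuous_of_le_smul hc.map_le

theorem memLp_symm (hc : FiberChart M e ρ) {p : ℝ≥0∞} {f : ℝ × ℝ → ℂ} (hf : MemLp f p) :
    MemLp (f ∘ e.symm) p (ρ.prod volume) := by
  refine MemLp.of_measure_le_smul ENNReal.coe_ne_top hc.le_map ?_
  rw [e.measurableEmbedding.memLp_map_measure_iff]
  have : (f ∘ e.symm) ∘ e = f := by ext q; simp
  rwa [this]

theorem memLp_comp (hc : FiberChart M e ρ) {p : ℝ≥0∞} {H : ℝ × ℝ → ℂ}
    (hH : MemLp H p (ρ.prod volume)) : MemLp (fun q => H (e q)) p :=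
  e.measurableEmbedding.memLp_map_measure_iff.1
    (hH.of_measure_le_smul ENNReal.coe_ne_top hc.map_le)

theorem ae_integrable (hc : FiberChart M e ρ) [SFinite ρ] (ψ : 𝓢(ℝ, ℂ)) (k : ℤ) {p : ℝ≥0∞}
    (hp : 1 ≤ p) (hp' : p ≠ ∞) {f : ℝ × ℝ → ℂ} (hf : MemLp f p) :
    ∀ᵐ q : ℝ × ℝ, Integrable fun t => f (e.symm ((e q).1, t)) * kernel ψ k ((e q).2 - t) :=
  e.measurableEmbedding.ae_map_iff.1
    (hc.map_ac.ae_le (ae_integrable_fiber ψ k hp hp' (hc.memLp_symm hf)))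

theorem exists_square_bounds {ψ : 𝓢(ℝ, ℂ)} (hψ : IsCutoff ψ) {p : ℝ≥0∞} (hp : 1 < p)
    (hp' : p ≠ ∞) (M : ℝ≥0) : ∃ C : ℝ≥0, ∀ (e : ℝ × ℝ ≃ᵐ ℝ × ℝ) (ρ : Measure ℝ) [SFinite ρ],
      FiberChart M e ρ → ∀ f : ℝ × ℝ → ℂ, MemLp f p →
        eLpNorm (squareFunction fun k => chartProj ψ e k f) p volume ≤ C * eLpNorm f p volume ∧
        eLpNorm f p volume ≤
          C * eLpNorm (squareFunction fun k => chartProj ψ e k f) p volume := by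
  obtain ⟨C, hC⟩ := hψ.exists_fiber_bounds hp hp'
  -- The cost, in `L^p` norm, of replacing a measure by one at most `M` times as large; it is paid
  -- once on entering the product measure and once on leaving it.
  set N := M ^ (1 / p).toReal
  refine ⟨N * (C * N), fun e ρ _ hc f hf => ?_⟩
  have h1 := hC ρ _ (hc.memLp_symm hf)
  rw [squareFunction_chartProj, eLpNorm_comp_chart e (fiberSquare ψ (f ∘ e.symm)),
    eLpNorm_eq_chart e f]
  push_cast
  simp only [mul_assoc]
  constructor
  · exact (eLpNorm_le_of_measure_le_smul hc.map_le hp' _).trans (mul_le_mul_right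
      (h1.1.trans (mul_le_mul_right (eLpNorm_le_of_measure_le_smul hc.le_map hp' _) _)) _)
  · exact (eLpNorm_le_of_measure_le_smul hc.map_le hp' _).trans (mul_le_mul_right
      (h1.2.trans (mul_le_mul_right (eLpNorm_le_of_measure_le_smul hc.le_map hp' _) _)) _)

/-- The adjoint of `chartProj`, where `j` is the density of the chart. -/
def adjProj (ψ : 𝓢(ℝ, ℂ)) (e : ℝ × ℝ ≃ᵐ ℝ × ℝ) (j : ℝ × ℝ → ℝ≥0) (k : ℤ) (f : ℝ × ℝ → ℂ)
    (q : ℝ × ℝ) : ℂ :=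
  (j (e q))⁻¹ • fiberProj (conjCutoff ψ) k (fun w => j w • (f ∘ e.symm) w) (e q)

theorem memLp_smul {j : ℝ × ℝ → ℝ≥0} (hj : Measurable j) (hjM : ∀ w, j w ≤ M) {μ : Measure (ℝ × ℝ)}
    {p : ℝ≥0∞} {H : ℝ × ℝ → ℂ} (hH : MemLp H p μ) : MemLp (fun w => j w • H w) p μ := by
  refine hH.of_le_mul (c := M) (hj.aestronglyMeasurable.smul hH.1)
    (Filter.Eventually.of_forall fun w => ?_)
  rw [NNReal.smul_def, norm_smul, Real.norm_of_nonneg (NNReal.coe_nonneg _)]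
  gcongr
  exact hjM w

/-- In the coordinates of the chart the pairing has density `j`. The fibrewise adjoint relation is
applied with `j F` in place of `F`, and the factor `j⁻¹` restores the density in the other pairing.
-/
theorem isAdjointValue_adjProj (hc : FiberChart M e ρ) [SFinite ρ] {ψ : 𝓢(ℝ, ℂ)}
    (hψ : IsCutoff ψ) {p : ℝ≥0∞} (hp : 1 < p) (hp' : p ≠ ∞) {j : ℝ × ℝ → ℝ≥0}
    (hj : Measurable j)
    (hd : (volume : Measure (ℝ × ℝ)).map e =
      (ρ.prod volume).withDensity fun w => (j w : ℝ≥0∞))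
    (hjM : ∀ w, j w ≤ M ∧ M⁻¹ ≤ j w) (k : ℤ) {f : ℝ × ℝ → ℂ} (hf : MemLp f p) :
    IsAdjointValue (chartProj ψ e k) p f (adjProj ψ e j k f) := by
  have := ENNReal.HolderConjugate.conjExponent hp.le
  have hM0 : (0 : ℝ≥0) < M⁻¹ := by have := hc.one_le; positivity
  have hq : 1 < ENNReal.conjExponent p :=
    (ENNReal.HolderConjugate.lt_top_iff_one_lt p _).1 hp'.lt_top
  have hq' : ENNReal.conjExponent p ≠ ∞ :=
    ((ENNReal.HolderConjugate.lt_top_iff_one_lt (ENNReal.conjExponent p) p).2 hp).ne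
  have hB := memLp_smul hj (fun w => (hjM w).1) (hc.memLp_symm hf)
  have hinv : ∀ w, (j w)⁻¹ ≤ M := fun w =>
    inv_le_of_inv_le₀ (zero_lt_one.trans_le hc.one_le) (hjM w).2
  refine ⟨hc.memLp_comp (memLp_smul hj.inv hinv (hψ.conjCutoff.memLp_fiberProj k hp hp' hB)),
    fun φ hφ => ?_⟩
  have hchange : ∀ G : ℝ × ℝ → ℂ, ∫ q, G (e q) = ∫ w, j w • G w ∂ρ.prod volume := fun G => by
    rw [← integral_map_equiv, hd, integral_withDensity_eq_integral_smul hj]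
  have h1 := hchange fun w => conj ((φ ∘ e.symm) w) *
    ((j w)⁻¹ • fiberProj (AdaptedLP.conjCutoff ψ) k (fun w => j w • (f ∘ e.symm) w) w)
  have h2 := hchange fun w => conj (fiberProj ψ k (φ ∘ e.symm) w) * (f ∘ e.symm) w
  have h3 := hψ.integral_conj_fiberProj_mul k hp hp' hq hq' (hc.memLp_symm hφ) hB
  simp only [Function.comp_apply, MeasurableEquiv.symm_apply_apply] at h1 h2
  refine h1.trans (Eq.trans ?_ h2.symm)
  refine (integral_congr_ae (Filter.Eventually.of_forall fun w => ?_)).trans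
    (h3.symm.trans (integral_congr_ae (Filter.Eventually.of_forall fun w => ?_)))
  · have : j w ≠ 0 := (hM0.trans_le (hjM w).2).ne'
    simp only [mul_smul_comm, smul_smul, mul_inv_cancel₀ this, one_smul, Function.comp_apply]
  · simp only [mul_smul_comm, Function.comp_apply]

theorem exists_adjoint_bounds {ψ : 𝓢(ℝ, ℂ)} (hψ : IsCutoff ψ) {p : ℝ≥0∞} (hp : 1 < p)
    (hp' : p ≠ ∞) (M : ℝ≥0) : ∃ C : ℝ≥0, ∀ (e : ℝ × ℝ ≃ᵐ ℝ × ℝ) (ρ : Measure ℝ) [SigmaFinite ρ],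
      FiberChart M e ρ → ∀ f : ℝ × ℝ → ℂ, MemLp f p →
        (∀ k : ℤ, ∃ h, IsAdjointValue (chartProj ψ e k) p f h) ∧
        ∀ h : ℤ → ℝ × ℝ → ℂ, (∀ k, IsAdjointValue (chartProj ψ e k) p f (h k)) →
          eLpNorm (squareFunction h) p volume ≤ C * eLpNorm f p volume ∧
          eLpNorm f p volume ≤ C * eLpNorm (squareFunction h) p volume := by
  obtain ⟨C, hC⟩ := hψ.conjCutoff.exists_fiber_bounds hp hp'
  set N := M ^ (1 / p).toReal
  -- The two factors `M` account for multiplication by `j` and by `j⁻¹`, the two factors `N` for the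
  -- changes of measure.
  refine ⟨N * (M * (C * (M * N))), fun e ρ _ hc f hf => ?_⟩
  have := e.sigmaFinite_map (μ := (volume : Measure (ℝ × ℝ)))
  obtain ⟨j, hj, hd, hjM⟩ := exists_bounded_density hc.one_le hc.map_le hc.le_map
  have hM0 : (0 : ℝ≥0) < M⁻¹ := by have := hc.one_le; positivity
  have hj0 : ∀ w, j w ≠ 0 := fun w => (hM0.trans_le (hjM w).2).ne'
  have hinv : ∀ w, (j w)⁻¹ ≤ M := fun w =>
    inv_le_of_inv_le₀ (zero_lt_one.trans_le hc.one_le) (hjM w).2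
  have hadj := fun k => hc.isAdjointValue_adjProj hψ hp hp' hj hd hjM k hf
  refine ⟨fun k => ⟨_, hadj k⟩, fun h hh => ?_⟩
  have hae : squareFunction h =ᵐ[volume] squareFunction fun k => adjProj ψ e j k f := by
    filter_upwards [ae_all_iff.2 fun k => isAdjointValue_ae_eq hp.le (hh k) (hadj k)] with q hq
    simp only [squareFunction, hq]
  set F := f ∘ e.symm with hF
  set B : ℝ × ℝ → ℂ := fun w => j w • F w with hBdef
  have hB : MemLp B p (ρ.prod volume) := memLp_smul hj (fun w => (hjM w).1) (hc.memLp_symm hf)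
  set S : ℝ × ℝ → ℝ≥0∞ :=
    fun w => ((j w)⁻¹ : ℝ≥0) * fiberSquare (AdaptedLP.conjCutoff ψ) B w with hS
  have hsq : (squareFunction fun k => adjProj ψ e j k f) = fun q => S (e q) := by
    ext q
    simp only [squareFunction, adjProj, hS, fiberSquare_eq, enorm_nnreal_smul, mul_pow,
      ENNReal.tsum_mul_left]
    rw [ENNReal.mul_rpow_of_nonneg _ _ (by norm_num), ← ENNReal.rpow_natCast,
      ← ENNReal.rpow_mul]
    simp [hBdef, hF]
  have hB1 : eLpNorm B p (ρ.prod volume) ≤ M * eLpNorm F p (ρ.prod volume) :=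
    eLpNorm_le_nnreal_smul_eLpNorm_of_ae_le_mul' (Filter.Eventually.of_forall fun w => by
      rw [hBdef, enorm_nnreal_smul]
      gcongr
      exact (hjM w).1) p
  have hB2 : eLpNorm F p (ρ.prod volume) ≤ M * eLpNorm B p (ρ.prod volume) :=
    eLpNorm_le_nnreal_smul_eLpNorm_of_ae_le_mul' (Filter.Eventually.of_forall fun w => by
      have : F w = (j w)⁻¹ • B w := by rw [hBdef, smul_smul, inv_mul_cancel₀ (hj0 w), one_smul]
      rw [this, enorm_nnreal_smul]
      gcongr
      exact hinv w) p
  have hS1 : eLpNorm S p (ρ.prod volume) ≤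
      M * eLpNorm (fiberSquare (AdaptedLP.conjCutoff ψ) B) p (ρ.prod volume) :=
    eLpNorm_le_nnreal_smul_eLpNorm_of_ae_le_mul' (Filter.Eventually.of_forall fun w => by
      simp only [hS, enorm_eq_self]
      gcongr
      exact hinv w) p
  have hS2 : eLpNorm (fiberSquare (AdaptedLP.conjCutoff ψ) B) p (ρ.prod volume) ≤
      M * eLpNorm S p (ρ.prod volume) :=
    eLpNorm_le_nnreal_smul_eLpNorm_of_ae_le_mul' (Filter.Eventually.of_forall fun w => by
      simp only [hS, enorm_eq_self]
      have h1 : (1 : ℝ≥0∞) ≤ M * ((j w)⁻¹ : ℝ≥0) := by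
        have h2 : 1 ≤ M * (j w)⁻¹ := by
          rw [← div_eq_mul_inv, one_le_div (hM0.trans_le (hjM w).2)]
          exact (hjM w).1
        exact_mod_cast h2
      rw [← mul_assoc]
      exact le_mul_of_one_le_left zero_le h1) p
  rw [eLpNorm_congr_ae hae, hsq, eLpNorm_comp_chart e S, eLpNorm_eq_chart e f]
  push_cast
  simp only [mul_assoc]
  have hBb := hC ρ B hB
  constructor
  · refine (eLpNorm_le_of_measure_le_smul hc.map_le hp' _).trans (mul_le_mul_right ?_ _)
    refine hS1.trans (mul_le_mul_right (hBb.1.trans (mul_le_mul_right ?_ _)) _)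
    exact hB1.trans (mul_le_mul_right (eLpNorm_le_of_measure_le_smul hc.le_map hp' _) _)
  · refine (eLpNorm_le_of_measure_le_smul hc.map_le hp' _).trans (mul_le_mul_right ?_ _)
    refine hB2.trans (mul_le_mul_right (hBb.2.trans (mul_le_mul_right ?_ _)) _)
    exact hS2.trans (mul_le_mul_right (eLpNorm_le_of_measure_le_smul hc.le_map hp' _) _)

theorem memLp_chartProj (hc : FiberChart M e ρ) [SFinite ρ] {ψ : 𝓢(ℝ, ℂ)} (hψ : IsCutoff ψ)
    {p : ℝ≥0∞} (hp : 1 < p) (hp' : p ≠ ∞) (k : ℤ) {f : ℝ × ℝ → ℂ} (hf : MemLp f p) :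
    MemLp (chartProj ψ e k f) p :=
  hc.memLp_comp (hψ.memLp_fiberProj k hp hp' (hc.memLp_symm hf))

end FiberChart

/-! ### The coordinates adapted to the curves. -/

/-- Change of variables for a bi-Lipschitz bijection of the line. -/
theorem volume_preimage_bounds {h : ℝ → ℝ} {m M : ℝ≥0} (hm : m ≠ 0)
    (hh : ∀ s t, s < t → m * (t - s) ≤ h t - h s ∧ h t - h s ≤ M * (t - s)) (A : Set ℝ) :
    volume (h ⁻¹' A) ≤ (m⁻¹ : ℝ≥0) * volume A ∧ volume A ≤ M * volume (h ⁻¹' A) := by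
  have hm0 : (0 : ℝ) < m := by exact_mod_cast pos_iff_ne_zero.2 hm
  have hd : ∀ s t, m * |s - t| ≤ |h s - h t| ∧ |h s - h t| ≤ M * |s - t| := by
    have key : ∀ s t, s < t → m * |s - t| ≤ |h s - h t| ∧ |h s - h t| ≤ M * |s - t| := by
      intro s t hst
      obtain ⟨h1, h2⟩ := hh s t hst
      have h3 : 0 < m * (t - s) := mul_pos hm0 (sub_pos.2 hst)
      rw [abs_sub_comm s, abs_sub_comm (h s), abs_of_pos (sub_pos.2 hst), abs_of_pos (by linarith)]
      exact ⟨h1, h2⟩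
    intro s t
    rcases lt_trichotomy s t with hst | rfl | hst
    · exact key s t hst
    · simp
    · rw [abs_sub_comm s, abs_sub_comm (h s)]
      exact key t s hst
  have hL : LipschitzWith M h := LipschitzWith.of_dist_le_mul fun s t => (hd s t).2
  have hA : AntilipschitzWith m⁻¹ h := AntilipschitzWith.of_le_mul_dist fun s t => by
    rw [NNReal.coe_inv, ← div_eq_inv_mul, le_div_iff₀ hm0, mul_comm]
    exact (hd s t).1
  have hs : Function.Surjective h := (bijective_of_slope hm0 hh).surjective
  constructor
  -- Lebesgue measure on the line is one dimensional Hausdorff measure, so the Lipschitz bounds act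
  -- on it directly, without derivatives.
  · have := hA.hausdorffMeasure_preimage_le (d := 1) zero_le_one A
    simpa [hausdorffMeasure_real] using this
  · have := hL.hausdorffMeasure_image_le (d := 1) zero_le_one (h ⁻¹' A)
    rw [image_preimage_eq _ hs] at this
    simpa [hausdorffMeasure_real] using this

/-- A Borel bijection of the plane, as a measurable equivalence. -/
def equivOfBijective (F : ℝ × ℝ → ℝ × ℝ) (hm : Measurable F) (hb : Function.Bijective F) :
    ℝ × ℝ ≃ᵐ ℝ × ℝ where
  toEquiv := Equiv.ofBijective F hb
  measurable_toFun := hm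
  measurable_invFun := fun s hs => by
    -- Lusin-Souslin: an injective Borel map between standard Borel spaces sends Borel sets to Borel
    -- sets.
    have h1 := (hm.measurableEmbedding hb.injective).measurableSet_image' hs
    have h2 : (Equiv.ofBijective F hb).symm ⁻¹' s = F '' s :=
      ((Equiv.ofBijective F hb).image_eq_preimage_symm s).symm
    rw [← h2] at h1
    exact h1

theorem measure_le_smul_trans {α : Type*} [MeasurableSpace α] {μ ν κ : Measure α} {a b c : ℝ≥0}
    (h₁ : μ ≤ (a : ℝ≥0∞) • ν) (h₂ : ν ≤ (b : ℝ≥0∞) • κ) (hc : a * b ≤ c) :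
    μ ≤ (c : ℝ≥0∞) • κ := Measure.le_iff'.2 fun s => by
  calc μ s ≤ a * ν s := h₁ s
    _ ≤ a * (b * κ s) := mul_le_mul_right (h₂ s) _
    _ = ((a * b : ℝ≥0) : ℝ≥0∞) * κ s := by rw [ENNReal.coe_mul, mul_assoc]
    _ ≤ c * κ s := mul_le_mul_left (by exact_mod_cast hc) _

theorem map_le_smul_map {α β : Type*} [MeasurableSpace α] [MeasurableSpace β] {μ ν : Measure α}
    {c : ℝ≥0∞} (h : μ ≤ c • ν) {f : α → β} (hf : Measurable f) : μ.map f ≤ c • ν.map f := by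
  rw [← Measure.map_smul]
  exact Measure.map_mono h hf

section Geometry

variable {g : ℝ → ℝ → ℝ} {u : ℝ → ℝ} {a₀ b₀ c₀ : ℝ}

theorem abs_sub_le_of_bounds (ha : 0 < a₀) (hg : HorizontalBound g a₀) (hv : VerticalBound g b₀)
    (x y x' y' : ℝ) : |g x y - g x' y'| ≤ a₀ * |x - x'| + b₀ * |y - y'| := by
  have h1 : |g x y - g x' y| ≤ a₀ * |x - x'| := by
    have key : ∀ s t, s < t → |g s y - g t y| ≤ a₀ * |s - t| := fun s t hst => by
      obtain ⟨h1, h2⟩ := hg s t y hst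
      have h3 : 0 < (t - s) / a₀ := div_pos (sub_pos.2 hst) ha
      rwa [abs_sub_comm, abs_sub_comm s, abs_of_pos (sub_pos.2 hst), abs_of_pos (by linarith)]
    rcases lt_trichotomy x x' with h | rfl | h
    · exact key x x' h
    · simp
    · rw [abs_sub_comm, abs_sub_comm x]
      exact key x' x h
  have h2 := hv x' y y'
  rw [abs_sub_comm y' y] at h2
  exact (abs_sub_le _ (g x' y) _).trans (add_le_add h1 h2)

theorem continuous_of_bounds (ha : 0 < a₀) (hg : HorizontalBound g a₀) (hv : VerticalBound g b₀) :
    Continuous fun w : ℝ × ℝ => g w.1 w.2 := by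
  rw [continuous_iff_continuousAt]
  rintro ⟨x, y⟩
  rw [ContinuousAt, tendsto_iff_dist_tendsto_zero]
  have h1 : Filter.Tendsto (fun w : ℝ × ℝ => a₀ * |w.1 - x| + b₀ * |w.2 - y|) (nhds (x, y))
      (nhds 0) := by
    have : Continuous fun w : ℝ × ℝ => a₀ * |w.1 - x| + b₀ * |w.2 - y| := by fun_prop
    have h2 := this.tendsto (x, y)
    simpa using h2
  exact squeeze_zero (fun w => dist_nonneg) (fun w => by
    rw [Real.dist_eq]
    exact abs_sub_le_of_bounds ha hg hv _ _ _ _) h1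

/-- `(x, y) ↦ (g(x, y), y)`. -/
def curveMap (g : ℝ → ℝ → ℝ) (w : ℝ × ℝ) : ℝ × ℝ := curve g w.1 w.2

/-- `(x, y) ↦ (x, y')`, where `y'` is the rotated second coordinate of `(g(x, y), y)`. -/
def heightMap (g : ℝ → ℝ → ℝ) (u : ℝ → ℝ) (w : ℝ × ℝ) : ℝ × ℝ :=
  (w.1, (rotated (u w.1) (curve g w.1 w.2)).2)

theorem measurable_curveMap (ha : 0 < a₀) (hg : HorizontalBound g a₀) (hv : VerticalBound g b₀) :
    Measurable (curveMap g) :=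
  (continuous_of_bounds ha hg hv).measurable.prodMk measurable_snd

theorem measurable_heightMap (ha : 0 < a₀) (hg : HorizontalBound g a₀) (hv : VerticalBound g b₀)
    (hu : Measurable u) : Measurable (heightMap g u) := by
  have h1 := (continuous_of_bounds ha hg hv).measurable
  have h2 : Measurable fun w : ℝ × ℝ => Real.arctan (u w.1) :=
    Real.measurable_arctan.comp (hu.comp measurable_fst)
  refine measurable_fst.prodMk ?_
  simp only [rotated, curve]
  fun_prop

theorem bijective_curveMap (ha : 0 < a₀) (hg : HorizontalBound g a₀) :
    Function.Bijective (curveMap g) := by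
  constructor
  · rintro ⟨x, y⟩ ⟨x', y'⟩ h
    simp only [curveMap, curve, Prod.mk.injEq] at h
    obtain ⟨h1, rfl⟩ := h
    exact Prod.ext ((bijective_foot ha hg y).injective h1) rfl
  · rintro ⟨s, t⟩
    obtain ⟨x, hx⟩ := (bijective_foot ha hg t).surjective s
    exact ⟨(x, t), Prod.ext hx rfl⟩

theorem bijective_heightMap (hb : 0 < b₀) (hc : c₀ < 1) (hv : VerticalBound g b₀)
    (hu : ∀ x, |u x| ≤ c₀ / b₀) : Function.Bijective (heightMap g u) := by
  constructor
  · rintro ⟨x, y⟩ ⟨x', y'⟩ h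
    simp only [heightMap, Prod.mk.injEq] at h
    obtain ⟨rfl, h2⟩ := h
    exact Prod.ext rfl ((bijective_height hb hc hv (hu x) x).injective h2)
  · rintro ⟨x, z⟩
    obtain ⟨y, hy⟩ := (bijective_height hb hc hv (hu x) x).surjective z
    exact ⟨(x, y), Prod.ext rfl hy⟩

theorem rotated_height_slope (hb : 0 < b₀) (hv : VerticalBound g b₀) {s : ℝ}
    (hs : |s| ≤ c₀ / b₀) (x y y' : ℝ) (hy : y < y') :
    Real.cos (Real.arctan s) * (1 - c₀) * (y' - y) ≤
        (rotated s (curve g x y')).2 - (rotated s (curve g x y)).2 ∧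
      (rotated s (curve g x y')).2 - (rotated s (curve g x y)).2 ≤
        Real.cos (Real.arctan s) * (1 + c₀) * (y' - y) := by
  have hcos := Real.cos_arctan_pos s
  have hsin : Real.sin (Real.arctan s) = s * Real.cos (Real.arctan s) := by
    rw [Real.sin_arctan, Real.cos_arctan]; ring
  have h1 : |s * (g x y' - g x y)| ≤ c₀ * (y' - y) := by
    rw [abs_mul]
    have h2 := hv x y' y
    rw [abs_sub_comm y y', abs_of_pos (sub_pos.2 hy)] at h2
    calc |s| * |g x y' - g x y| ≤ c₀ / b₀ * (b₀ * (y' - y)) :=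
          mul_le_mul hs h2 (abs_nonneg _) ((abs_nonneg _).trans hs)
      _ = c₀ * (y' - y) := by field_simp
  have h3 := abs_le.1 h1
  have e : (rotated s (curve g x y')).2 - (rotated s (curve g x y)).2
      = Real.cos (Real.arctan s) * ((y' - y) - s * (g x y' - g x y)) := by
    simp only [rotated, curve, hsin]; ring
  simp only [e, mul_assoc]
  constructor <;> refine mul_le_mul_of_nonneg_left ?_ hcos.le <;> linarith [h3.1, h3.2]

/-- On each horizontal line the map is `x ↦ g x y`, bi-Lipschitz with constants `1 / a₀` and `a₀`;
Tonelli assembles the slices. -/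
theorem map_curveMap_bounds (ha : 0 < a₀) (hg : HorizontalBound g a₀) (hv : VerticalBound g b₀) :
    (volume : Measure (ℝ × ℝ)).map (curveMap g) ≤ (a₀.toNNReal : ℝ≥0∞) • volume ∧
      (volume : Measure (ℝ × ℝ)) ≤ (a₀.toNNReal : ℝ≥0∞) • volume.map (curveMap g) := by
  have hm := measurable_curveMap ha hg hv
  have h0 : a₀.toNNReal ≠ 0 := by simpa using ha
  have key : ∀ (y : ℝ) (A : Set ℝ), volume ((fun x => g x y) ⁻¹' A) ≤
      (a₀.toNNReal : ℝ≥0∞) * volume A ∧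
      volume A ≤ (a₀.toNNReal : ℝ≥0∞) * volume ((fun x => g x y) ⁻¹' A) := fun y A => by
    have := volume_preimage_bounds (h := fun x => g x y) (m := a₀.toNNReal⁻¹) (M := a₀.toNNReal)
      (inv_ne_zero h0) (fun s t hst => by
        rw [NNReal.coe_inv, Real.coe_toNNReal _ ha.le, inv_mul_eq_div]
        exact hg s t y hst) A
    rwa [inv_inv] at this
  have hsec : ∀ (s : Set (ℝ × ℝ)) (y : ℝ), (fun x => (x, y)) ⁻¹' (curveMap g ⁻¹' s) =
      (fun x => g x y) ⁻¹' ((fun x => (x, y)) ⁻¹' s) := fun _ _ => rfl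
  constructor <;> refine Measure.le_iff.2 fun s hs => ?_ <;>
    rw [Measure.smul_apply, Measure.map_apply hm hs, smul_eq_mul, Measure.volume_eq_prod,
      Measure.prod_apply_symm hs, Measure.prod_apply_symm (hm hs),
      ← lintegral_const_mul' _ _ ENNReal.coe_ne_top] <;>
    refine lintegral_mono fun y => ?_ <;> rw [hsec]
  · exact (key y _).1
  · exact (key y _).2

/-- The cosine of the angle of rotation attached to `Γ_x`. -/
def cosAngle (u : ℝ → ℝ) (x : ℝ) : ℝ≥0 := (Real.cos (Real.arctan (u x))).toNNReal

theorem cosAngle_ne_zero (u : ℝ → ℝ) (x : ℝ) : cosAngle u x ≠ 0 := by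
  simpa [cosAngle] using Real.cos_arctan_pos (u x)

theorem coe_cosAngle (u : ℝ → ℝ) (x : ℝ) : (cosAngle u x : ℝ) = Real.cos (Real.arctan (u x)) :=
  Real.coe_toNNReal _ (Real.cos_arctan_pos (u x)).le

theorem measurable_cosAngle (hu : Measurable u) : Measurable (cosAngle u) := by
  have h2 : Measurable fun x => Real.arctan (u x) := Real.measurable_arctan.comp hu
  unfold cosAngle
  fun_prop

/-- The measure `dx / cos θ_x` on the parameter line. -/
def parameterMeasure (u : ℝ → ℝ) : Measure ℝ :=
  volume.withDensity fun x => ((cosAngle u x)⁻¹ : ℝ≥0)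

theorem sigmaFinite_parameterMeasure (u : ℝ → ℝ) : SigmaFinite (parameterMeasure u) :=
  SigmaFinite.withDensity fun x => (cosAngle u x)⁻¹

/-- On the slice over `x` the slopes are `cos θ_x (1 ± c₀)`. Only the factors `1 ± c₀` enter the
constants, because `cos θ_x` is constant on the slice and is carried by `parameterMeasure`. -/
theorem map_heightMap_bounds (ha : 0 < a₀) (hb : 0 < b₀) (hc₀ : 0 < c₀) (hc : c₀ < 1)
    (hg : HorizontalBound g a₀) (hv : VerticalBound g b₀) (hu : Measurable u)
    (hub : ∀ x, |u x| ≤ c₀ / b₀) :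
    (volume : Measure (ℝ × ℝ)).map (heightMap g u) ≤
        (((1 - c₀).toNNReal⁻¹ : ℝ≥0) : ℝ≥0∞) • (parameterMeasure u).prod volume ∧
      (parameterMeasure u).prod volume ≤
        ((1 + c₀).toNNReal : ℝ≥0∞) • (volume : Measure (ℝ × ℝ)).map (heightMap g u) := by
  have hm := measurable_heightMap ha hg hv hu
  have hw := measurable_cosAngle hu
  have := sigmaFinite_parameterMeasure u
  have key : ∀ (x : ℝ) (A : Set ℝ),
      volume ((fun y => (rotated (u x) (curve g x y)).2) ⁻¹' A) ≤
        ((1 - c₀).toNNReal⁻¹ : ℝ≥0) * (((cosAngle u x)⁻¹ : ℝ≥0) * volume A) ∧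
      ((cosAngle u x)⁻¹ : ℝ≥0) * volume A ≤ ((1 + c₀).toNNReal : ℝ≥0∞) *
        volume ((fun y => (rotated (u x) (curve g x y)).2) ⁻¹' A) := fun x A => by
    have h0 : (1 - c₀).toNNReal ≠ 0 := by simpa using hc
    have hk := cosAngle_ne_zero u x
    obtain ⟨h1, h2⟩ := volume_preimage_bounds
      (h := fun y => (rotated (u x) (curve g x y)).2) (m := cosAngle u x * (1 - c₀).toNNReal)
      (M := cosAngle u x * (1 + c₀).toNNReal) (mul_ne_zero hk h0)
      (fun s t hst => by
        rw [NNReal.coe_mul, NNReal.coe_mul, coe_cosAngle, Real.coe_toNNReal _ (by linarith),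
          Real.coe_toNNReal _ (by linarith)]
        exact rotated_height_slope hb hv (hub x) x s t hst) A
    constructor
    · rw [← mul_assoc, ← ENNReal.coe_mul, ← mul_inv_rev]
      exact h1
    · refine (mul_le_mul_right h2 _).trans (le_of_eq ?_)
      rw [← mul_assoc, ← ENNReal.coe_mul, ← mul_assoc, inv_mul_cancel₀ hk, one_mul]
  have hsec : ∀ (s : Set (ℝ × ℝ)) (x : ℝ), Prod.mk x ⁻¹' (heightMap g u ⁻¹' s) =
      (fun y => (rotated (u x) (curve g x y)).2) ⁻¹' (Prod.mk x ⁻¹' s) := fun _ _ => rfl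
  have hw' : Measurable fun x => (((cosAngle u x)⁻¹ : ℝ≥0) : ℝ≥0∞) := hw.inv.coe_nnreal_ennreal
  have hprod : ∀ s : Set (ℝ × ℝ), MeasurableSet s → ((parameterMeasure u).prod volume) s =
      ∫⁻ x, ((cosAngle u x)⁻¹ : ℝ≥0) * volume (Prod.mk x ⁻¹' s) := fun s hs => by
    rw [Measure.prod_apply hs, parameterMeasure,
      lintegral_withDensity_eq_lintegral_mul _ hw' (measurable_measure_prodMk_left hs)]
    rfl
  constructor <;> refine Measure.le_iff.2 fun s hs => ?_
  · rw [Measure.smul_apply, Measure.map_apply hm hs, hprod s hs, smul_eq_mul,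
      Measure.volume_eq_prod, Measure.prod_apply (hm hs),
      ← lintegral_const_mul' _ _ ENNReal.coe_ne_top]
    refine lintegral_mono fun x => ?_
    rw [hsec]
    exact (key x _).1
  · rw [Measure.smul_apply, Measure.map_apply hm hs, hprod s hs, smul_eq_mul,
      Measure.volume_eq_prod, Measure.prod_apply (hm hs),
      ← lintegral_const_mul' _ _ ENNReal.coe_ne_top]
    refine lintegral_mono fun x => ?_
    rw [hsec]
    exact (key x _).2

/-- The coordinates `(x, y')` on the plane adapted to the curves `Γ_x`. -/
theorem exists_adapted_chart (ha : 0 < a₀) (hb : 0 < b₀) (hc₀ : 0 < c₀) (hc : c₀ < 1)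
    (hg : HorizontalBound g a₀) (hv : VerticalBound g b₀) (hu : Measurable u)
    (hub : ∀ x, |u x| ≤ c₀ / b₀) : ∃ e : ℝ × ℝ ≃ᵐ ℝ × ℝ,
      (∀ q, e q = (foot g q, (rotated (u (foot g q)) q).2)) ∧
      (∀ x z, e.symm (x, z) = graphPoint g u x z) ∧
      FiberChart (1 + a₀.toNNReal * (1 - c₀).toNNReal⁻¹ + (1 + c₀).toNNReal * a₀.toNNReal) e
        (parameterMeasure u) := by
  set e₁ := equivOfBijective (curveMap g) (measurable_curveMap ha hg hv)
    (bijective_curveMap ha hg) with he₁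
  set e₂ := equivOfBijective (heightMap g u) (measurable_heightMap ha hg hv hu)
    (bijective_heightMap hb hc hv hub) with he₂
  have hc₁ : ⇑e₁ = curveMap g := rfl
  have hc₂ : ⇑e₂ = heightMap g u := rfl
  have hs₁ : ∀ q, e₁.symm q = (foot g q, q.2) := fun q => by
    rw [MeasurableEquiv.symm_apply_eq, hc₁]
    exact Prod.ext (Function.invFun_eq ((bijective_foot ha hg q.2).surjective q.1)).symm rfl
  have hs₂ : ∀ x z, e₂.symm (x, z) =
      (x, Function.invFun (fun y => (rotated (u x) (curve g x y)).2) z) := fun x z => by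
    rw [MeasurableEquiv.symm_apply_eq, hc₂]
    exact Prod.ext rfl
      (Function.invFun_eq ((bijective_height hb hc hv (hub x) x).surjective z)).symm
  obtain ⟨h1, h2⟩ := map_curveMap_bounds ha hg hv
  obtain ⟨h3, h4⟩ := map_heightMap_bounds ha hb hc₀ hc hg hv hu hub
  rw [← hc₁] at h1 h2
  rw [← hc₂] at h3 h4
  have h1' := map_le_smul_map h1 e₁.symm.measurable
  have h2' := map_le_smul_map h2 e₁.symm.measurable
  rw [MeasurableEquiv.map_symm_map] at h1' h2'
  have hmap : (volume : Measure (ℝ × ℝ)).map (e₁.symm.trans e₂) =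
      (volume.map e₁.symm).map e₂ := by
    rw [Measure.map_map e₂.measurable e₁.symm.measurable]; rfl
  -- A point goes to `(x, y)` and then to `(x, y')`. The constant is a sum only so that a single
  -- number exceeds `1` and both distortion factors.
  refine ⟨e₁.symm.trans e₂, fun q => ?_, fun x z => ?_, ?_, ?_, ?_⟩
  · rw [MeasurableEquiv.trans_apply, hs₁, hc₂]
    have : curve g (foot g q) q.2 = q := by
      have h5 := e₁.apply_symm_apply q
      rw [hs₁, hc₁] at h5
      exact h5
    simp only [heightMap, this]
  · change e₁ (e₂.symm (x, z)) = _
    rw [hs₂, hc₁]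
    rfl
  · rw [add_assoc]; exact le_self_add
  · rw [hmap]
    refine measure_le_smul_trans (map_le_smul_map h2' e₂.measurable) h3 ?_
    exact le_add_self.trans le_self_add
  · rw [hmap]
    exact measure_le_smul_trans h4 (map_le_smul_map h1' e₂.measurable) le_add_self

end Geometry

end AdaptedLP

end

/-! ### The adapted Littlewood-Paley estimates. -/

theorem mainTheorem6 (ψ : 𝓢(ℝ, ℂ)) (hψ : AdaptedLP.IsCutoff ψ)
    (p : ℝ≥0∞) (hp₁ : 1 < p) (hp : p < ∞)
    (a₀ : ℝ) (ha₀ : 0 < a₀) (c₀ : ℝ) (hc₀ : 0 < c₀) (hc₁ : c₀ < 1) :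
    ∃ C : ℝ≥0, ∀ (b₀ : ℝ) (g : ℝ → ℝ → ℝ) (u : ℝ → ℝ),
      0 < b₀ → AdaptedLP.HorizontalBound g a₀ → AdaptedLP.VerticalBound g b₀ →
      Measurable u → (∀ x, |u x| ≤ c₀ / b₀) →
      ∀ f : ℝ × ℝ → ℂ, MemLp f p volume →
        -- the adapted projections of `f` are well defined, and lie in `L^p`
        (∀ k : ℤ,
          (∀ᵐ q : ℝ × ℝ, Integrable (fun z : ℝ =>
            AdaptedLP.restrict g u f (AdaptedLP.foot g q) z *
              AdaptedLP.kernel ψ k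
                ((AdaptedLP.rotated (u (AdaptedLP.foot g q)) q).2 - z)) volume) ∧
          MemLp (AdaptedLP.adaptedProj ψ g u k f) p volume) ∧
        -- the square function estimate for the adapted projections
        (eLpNorm (AdaptedLP.squareFunction
            (fun k => AdaptedLP.adaptedProj ψ g u k f)) p volume ≤ C * eLpNorm f p volume ∧
          eLpNorm f p volume ≤ C * eLpNorm (AdaptedLP.squareFunction
            (fun k => AdaptedLP.adaptedProj ψ g u k f)) p volume) ∧
        -- the adjoints of the adapted projections are defined at `f`
        (∀ k : ℤ, ∃ h : ℝ × ℝ → ℂ,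
          AdaptedLP.IsAdjointValue (AdaptedLP.adaptedProj ψ g u k) p f h) ∧
        -- the square function estimate for the adjoints
        (∀ h : ℤ → ℝ × ℝ → ℂ,
          (∀ k, AdaptedLP.IsAdjointValue (AdaptedLP.adaptedProj ψ g u k) p f (h k)) →
          eLpNorm (AdaptedLP.squareFunction h) p volume ≤ C * eLpNorm f p volume ∧
          eLpNorm f p volume ≤ C * eLpNorm (AdaptedLP.squareFunction h) p volume) := by
  have hp' : p ≠ ∞ := hp.ne
  obtain ⟨C₁, hC₁⟩ := AdaptedLP.FiberChart.exists_square_bounds hψ hp₁ hp'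
    (1 + a₀.toNNReal * (1 - c₀).toNNReal⁻¹ + (1 + c₀).toNNReal * a₀.toNNReal)
  obtain ⟨C₂, hC₂⟩ := AdaptedLP.FiberChart.exists_adjoint_bounds hψ hp₁ hp'
    (1 + a₀.toNNReal * (1 - c₀).toNNReal⁻¹ + (1 + c₀).toNNReal * a₀.toNNReal)
  have hle : ∀ {C : ℝ≥0} {A B : ℝ≥0∞}, C ≤ C₁ + C₂ → A ≤ C * B →
      A ≤ (C₁ + C₂ : ℝ≥0) * B := fun hC h =>
    h.trans (mul_le_mul_left (by exact_mod_cast hC) _)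
  refine ⟨C₁ + C₂, fun b₀ g u hb hg hv hu hub f hf => ?_⟩
  obtain ⟨e, he, hes, hc⟩ := AdaptedLP.exists_adapted_chart ha₀ hb hc₀ hc₁ hg hv hu hub
  have := AdaptedLP.sigmaFinite_parameterMeasure u
  -- This is an identity of operators, for every function and at every point, so the adjoint
  -- statements transfer as well.
  have hT : ∀ k, AdaptedLP.adaptedProj ψ g u k = AdaptedLP.chartProj ψ e k := fun k => by
    funext f q
    simp only [AdaptedLP.adaptedProj, AdaptedLP.chartProj, AdaptedLP.fiberProj, he,
      Function.comp_apply, hes]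
    rfl
  simp only [hT]
  have h1 := hC₁ e _ hc f hf
  have h2 := hC₂ e _ hc f hf
  refine ⟨fun k => ⟨?_, hc.memLp_chartProj hψ hp₁ hp' k hf⟩,
    ⟨hle le_self_add h1.1, hle le_self_add h1.2⟩, h2.1,
    fun h hh => ⟨hle le_add_self (h2.2 h hh).1, hle le_add_self (h2.2 h hh).2⟩⟩
  have h3 := hc.ae_integrable ψ k hp₁.le hp' hf
  simp only [he, hes] at h3
  exact h3
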